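/- **Theorem A (Weil–Riemann–Roch).** A *metric graph* is a metric space in which every point $p$ has an open neighbourhood isometric to an open star-shaped domain centred at $p$; the number of its rays is the valence $\mathrm{val}(p)$. Let $\Gamma$ be a compact metric graph, possibly disconnected, without isolated points, and let $\chi(\Gamma)=\#V(G)-\#E(G)$ be its Euler characteristic, where $G$ is any finite graph modelling $\Gamma$. Let $\mathcal H_\Gamma$ be the sheaf of harmonic functions on $\Gamma$, that is, of piecewise linear functions with integer slopes whose outgoing slopes sum to $0$ at every point. A *vector bundle* of rank $n$ on $\Gamma$ is a torsor under the sheaf of groups $S_n\ltimes\mathcal H_\Gamma^n$. Its *degree* is the sum, over all edges of an oriented simple model of $\Gamma$, of the slopes of the entries of its transition functions with respect to the cover by open stars of vertices; the transition function on an edge $e$ is the trivialization at the end of $e$ composed with the inverse of the trivialization at the start, and slopes are taken in the direction of $e$. The dual $E^*$ is obtained by negating the harmonic entries of the transition functions. For a divisor $D$ on a metric graph, $\mathcal H(D)$ denotes the line bundle whose sections over $U$ are the piecewise linear functions $s$ on $U$ with integer slopes and $\operatorname{div}(s)=D|_U$, where $\operatorname{ord}_p(s)$ is the sum of the outgoing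 slopes of $s$ at $p$. The canonical divisor is $K_\Gamma=\sum_p(\mathrm{val}(p)-2)\,p$. For a divisor $D$ on a compact connected metric graph, $r(D)=-1$ if $D$ is not linearly equivalent to an effective divisor, and otherwise $r(D)$ is the largest $r\ge 0$ such that $D-D'$ is linearly equivalent to an effective divisor for every effective divisor $D'$ of degree $r$; on a compact metric graph with connected components $\Gamma_1,\dots,\Gamma_k$ one sets $r_\Gamma(D)=\sum_{i=1}^k\bigl(r(D|_{\Gamma_i})+1\bigr)-1$. The *Baker–Norine rank* of a vector bundle $E$ of rank $n$ on $\Gamma$ is $r_\Gamma(E)=r_{\widetilde\Gamma}(D)$ for any covering $f\colon\widetilde\Gamma\to\Gamma$ of degree $n$ by a metric graph $\widetilde\Gamma$, with $f$ a local isometry, and any divisor $D$ on $\widetilde\Gamma$ such that $f_*\mathcal H(D)\simeq E$. Then for every vector bundle $E$ of rank $n$ and degree $d$ on $\Gamma$, $$r_\Gamma(E)-r_\Gamma\bigl(\mathcal H(K_\Gamma)\otimes E^*\bigr)=d+n\,\chi(\Gamma).$$ In particular, if $\Gamma$ is connected of genus $g=1-\chi(\Gamma)$, the right-hand side equals $d-n(g-1)$.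 -/

import Mathlib

open TopologicalSpace CategoryTheory Opposite

universe u

namespace TropicalBundle

/-! ### Metric graphs -/

section MetricGraphs

variable {Γ : Type u} [MetricSpace Γ]

/-- `φ` is an isometry of the open star-shaped domain with `k` rays of length `r` onto an open
neighbourhood of `p`, taking the centre to `p`; `φ i t` is the point at distance `t` from the centre
on the `i`-th ray. For `k = 0` the star-shaped domain is the single point `p`. -/
structure IsStarChart (p : Γ) (k : ℕ) (r : ℝ) (φ : Fin k → ℝ → Γ) : Prop where
  pos : 0 < r
  center : ∀ i, φ i 0 = p
  dist_same : ∀ i, ∀ s ∈ Set.Ico 0 r, ∀ t ∈ Set.Ico 0 r, dist (φ i s) (φ i t) = |s - t|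
  dist_ne : ∀ i j, i ≠ j → ∀ s ∈ Set.Ico 0 r, ∀ t ∈ Set.Ico 0 r, dist (φ i s) (φ j t) = s + t
  isOpen : IsOpen (insert p (⋃ i, φ i '' Set.Ico 0 r))

variable (Γ) in
/-- A metric graph: a metric space in which every point has an open neighbourhood isometric to a
star-shaped domain. -/
class MetricGraph : Prop where
  exists_chart : ∀ p : Γ, ∃ k r φ, IsStarChart p k r φ

/-- The valence of a point: the number of rays of a star-shaped neighbourhood (all such
neighbourhoods of `p` have the same number of rays). -/
noncomputable def valence (p : Γ) : ℕ := sInf {k | ∃ r φ, IsStarChart p k r φ}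

/-- The function `f` on the open set `U` is piecewise linear with integer slopes near `p`, and the
sum `ord_p(f)` of its outgoing slopes at `p` is `a`. (On a metric graph any two charts at `p` agree
near `p` up to a permutation of the rays.) -/
def HasOrd {U : Opens Γ} (f : U → ℝ) (p : U) (a : ℤ) : Prop :=
  ∀ (k : ℕ) (r : ℝ) (φ : Fin k → ℝ → Γ), IsStarChart p.1 k r φ →
    ∃ δ > 0, ∃ m : Fin k → ℤ,
      (∀ i, ∀ t ∈ Set.Ico 0 δ, t < r → ∀ h : φ i t ∈ U, f ⟨φ i t, h⟩ = f p + m i * t) ∧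
      ∑ i, m i = a

theorem HasOrd.add {U : Opens Γ} {f g : U → ℝ} {p : U} {a b : ℤ} (hf : HasOrd f p a)
    (hg : HasOrd g p b) : HasOrd (f + g) p (a + b) := by
  intro k r φ hφ
  obtain ⟨δ, hδ, m, hm, hs⟩ := hf k r φ hφ
  obtain ⟨δ', hδ', m', hm', hs'⟩ := hg k r φ hφ
  refine ⟨min δ δ', lt_min hδ hδ', m + m', ?_, by simp [Finset.sum_add_distrib, hs, hs']⟩
  intro i t ht htr h
  simp only [Pi.add_apply, hm i t ⟨ht.1, ht.2.trans_le (min_le_left _ _)⟩ htr h,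
    hm' i t ⟨ht.1, ht.2.trans_le (min_le_right _ _)⟩ htr h, Int.cast_add]
  ring

theorem HasOrd.neg {U : Opens Γ} {f : U → ℝ} {p : U} {a : ℤ} (hf : HasOrd f p a) :
    HasOrd (-f) p (-a) := by
  intro k r φ hφ
  obtain ⟨δ, hδ, m, hm, hs⟩ := hf k r φ hφ
  refine ⟨δ, hδ, -m, ?_, by simp [hs]⟩
  intro i t ht htr h
  simp only [Pi.neg_apply, hm i t ht htr h, Int.cast_neg]
  ring

theorem hasOrd_zero {U : Opens Γ} (p : U) : HasOrd (0 : U → ℝ) p 0 :=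
  fun _ _ _ _ => ⟨1, one_pos, 0, by simp, by simp⟩

/-- `HasOrd` depends only on the function near the point. -/
theorem HasOrd.of_eq {U V W : Opens Γ} {f : U → ℝ} {g : V → ℝ} {p : Γ} {a : ℤ} (hU : p ∈ U)
    (hV : p ∈ V) (hW : p ∈ W)
    (hfg : ∀ x ∈ W, ∀ (h : x ∈ U) (h' : x ∈ V), f ⟨x, h⟩ = g ⟨x, h'⟩)
    (hf : HasOrd f ⟨p, hU⟩ a) : HasOrd g ⟨p, hV⟩ a := by
  intro k r φ hφ
  obtain ⟨δ, hδ, m, hm, hs⟩ := hf k r φ hφ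
  obtain ⟨ε, hε, hb⟩ := Metric.isOpen_iff.1 (W ⊓ U).isOpen p ⟨hW, hU⟩
  refine ⟨min δ ε, lt_min hδ hε, m, ?_, hs⟩
  intro i t ht htr h
  have hmem : φ i t ∈ W ⊓ U := hb (by
    have h1 := hφ.dist_same i t ⟨ht.1, htr⟩ 0 ⟨le_rfl, hφ.pos⟩
    rw [hφ.center, sub_zero, abs_of_nonneg ht.1] at h1
    rw [Metric.mem_ball, h1]
    exact ht.2.trans_le (min_le_right _ _))
  rw [← hfg _ hmem.1 hmem.2 h, ← hfg _ hW hU hV]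
  exact hm i t ⟨ht.1, ht.2.trans_le (min_le_left _ _)⟩ htr hmem.2

/-- The group `ℋ_Γ(U)` of harmonic functions on `U`: piecewise linear functions with integer slopes
and trivial divisor. -/
def harmonic (U : Opens Γ) : AddSubgroup (U → ℝ) where
  carrier := {f | ∀ p, HasOrd f p 0}
  add_mem' hf hg p := by simpa using (hf p).add (hg p)
  zero_mem' p := hasOrd_zero p
  neg_mem' hf p := by simpa using (hf p).neg

/-- Restriction of harmonic functions. -/
def harmonic.res {U V : Opens Γ} (h : V ≤ U) (f : harmonic U) : harmonic V :=
  ⟨fun x => f.1 ⟨x.1, h x.2⟩, fun p =>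
    (f.2 ⟨p.1, h p.2⟩).of_eq (h p.2) p.2 p.2 fun _ _ _ _ => rfl⟩

end MetricGraphs

/-! ### Models and the Euler characteristic -/

section Models

variable (Γ : Type u) [MetricSpace Γ]

/-- A model `(G, ℓ)` of `Γ`, with an orientation: a finite set of vertices of `Γ` and finitely many
edges, parametrized by arc length by `path e` on `[0, len e]`, such that `Γ` is obtained from the
vertices by gluing in the open edges. Loops and multiple edges are allowed. -/
structure Model where
  V : Finset Γ
  E : Type
  [finE : Fintype E]
  len : E → ℝ
  len_pos : ∀ e, 0 < len e
  path : E → ℝ → Γ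
  continuousOn_path : ∀ e, ContinuousOn (path e) (Set.Icc 0 (len e))
  source_mem : ∀ e, path e 0 ∈ V
  target_mem : ∀ e, path e (len e) ∈ V
  notMem : ∀ e, ∀ t ∈ Set.Ioo 0 (len e), path e t ∉ V
  inj : ∀ e e', ∀ t ∈ Set.Ioo 0 (len e), ∀ t' ∈ Set.Ioo 0 (len e'),
    path e t = path e' t' → e = e' ∧ t = t'
  cover : ∀ x ∉ V, ∃ e, ∃ t ∈ Set.Ioo 0 (len e), path e t = x
  isometric : ∀ e, ∀ t ∈ Set.Ioo 0 (len e), ∃ ε > 0, ∀ s ∈ Set.Ioo (t - ε) (t + ε),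
    ∀ s' ∈ Set.Ioo (t - ε) (t + ε), dist (path e s) (path e s') = |s - s'|

attribute [instance] Model.finE

variable {Γ}

/-- The start vertex of an edge. -/
def Model.src (M : Model Γ) (e : M.E) : M.V := ⟨M.path e 0, M.source_mem e⟩

/-- The end vertex of an edge. -/
def Model.tgt (M : Model Γ) (e : M.E) : M.V := ⟨M.path e (M.len e), M.target_mem e⟩

/-- A model is simple if it has neither loops nor multiple edges. -/
def Model.IsSimple (M : Model Γ) : Prop :=
  (∀ e, M.src e ≠ M.tgt e) ∧
  ∀ e e', ({M.src e, M.tgt e} : Set M.V) = {M.src e', M.tgt e'} → e = e'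

/-- The open star of a vertex: the vertex together with all open edges incident to it. -/
def Model.star (M : Model Γ) (v : M.V) : Set Γ :=
  {v.1} ∪ ⋃ e ∈ {e | M.src e = v ∨ M.tgt e = v}, M.path e '' Set.Ioo 0 (M.len e)

variable (Γ) in
open Classical in
/-- The Euler characteristic of a compact metric graph: `#V - #E` for any model. -/
noncomputable def eulerChar : ℤ :=
  if h : Nonempty (Model Γ) then (h.some.V.card : ℤ) - Fintype.card h.some.E else 0

variable (Γ) in
/-- The genus `g = 1 - χ(Γ) = #E - #V + 1` of a compact connected metric graph. -/
noncomputable def genus : ℤ := 1 - eulerChar Γ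

end Models

/-! ### Divisors and the Baker–Norine rank -/

section Divisors

variable {Γ : Type u} [MetricSpace Γ]

/-- Linear equivalence of divisors: `D - D'` is the divisor of a piecewise linear function with
integer slopes on all of `Γ`. -/
def LinEquiv (D D' : Γ →₀ ℤ) : Prop :=
  ∃ f : (⊤ : Opens Γ) → ℝ, ∀ p, HasOrd f p (D p.1 - D' p.1)

/-- The complete linear system of `D`: all effective divisors linearly equivalent to `D`. -/
def linearSystem (D : Γ →₀ ℤ) : Set (Γ →₀ ℤ) := {D' | 0 ≤ D' ∧ LinEquiv D D'}

/-- The degree of a divisor. -/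
noncomputable def divDegree (D : Γ →₀ ℤ) : ℤ := D.sum fun _ a => a

open Classical in
/-- The Baker–Norine rank of a divisor on a compact connected metric graph: `-1` if the linear
system is empty, and otherwise the largest `r` such that `|D - E| ≠ ∅` for all effective divisors
`E` of degree `r`. -/
noncomputable def connectedRank (D : Γ →₀ ℤ) : ℤ :=
  if (linearSystem D).Nonempty then
    (sSup {r : ℕ | ∀ E : Γ →₀ ℤ, 0 ≤ E → divDegree E = r → (linearSystem (D - E)).Nonempty} : ℕ)
  else -1

/-- A connected component of `Γ` as a metric graph in its own right. -/
abbrev Component (c : ConnectedComponents Γ) : Type u := {x : Γ // ConnectedComponents.mk x = c}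

/-- The restriction of a divisor to a connected component. -/
noncomputable def restrictComponent (D : Γ →₀ ℤ) (c : ConnectedComponents Γ) : Component c →₀ ℤ :=
  D.comapDomain Subtype.val Subtype.val_injective.injOn

/-- The Baker–Norine rank of a divisor on a compact, possibly disconnected, metric graph:
`r_Γ(D) = ∑ᵢ (r_{Γᵢ}(D|_{Γᵢ}) + 1) - 1`, summed over the (finitely many) components. -/
noncomputable def divRank (D : Γ →₀ ℤ) : ℤ :=
  (∑ᶠ c : ConnectedComponents Γ, (connectedRank (restrictComponent D c) + 1)) - 1

end Divisors

/-! ### The sheaf of groups `S_n ⋉ ℋ_Γ^n` -/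

section Group

variable {Γ : Type u} [MetricSpace Γ]

/-- A section over `U` of the sheaf of groups `S_n ⋉ ℋ_Γ^n`: a locally constant family of
permutations (a section of the constant sheaf `S_n`) and an `n`-tuple of harmonic functions. -/
@[ext]
structure TGL (n : ℕ) (U : Opens Γ) where
  perm : LocallyConstant U (Equiv.Perm (Fin n))
  fn : Fin n → harmonic U

namespace TGL

variable {n : ℕ} {U V : Opens Γ}

/-- The action of the sheaf `S_n` on `ℋ_Γ^n` by permutation of the entries. -/
def permute (σ : LocallyConstant U (Equiv.Perm (Fin n))) (h : Fin n → harmonic U) (i : Fin n) :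
    harmonic U :=
  ⟨fun x => (h ((σ x)⁻¹ i)).1 x, fun p => by
    obtain ⟨W, hW, hp, hc⟩ := (IsLocallyConstant.iff_exists_open _).1 σ.isLocallyConstant p
    obtain ⟨W', hW', rfl⟩ := isOpen_induced_iff.1 hW
    refine HasOrd.of_eq (W := ⟨W', hW'⟩) p.2 p.2 hp ?_ ((h ((σ p)⁻¹ i)).2 p)
    intro x hx hU hU'
    have : σ ⟨x, hU⟩ = σ p := hc ⟨x, hU⟩ hx
    simp [this]⟩

theorem permute_apply (σ : LocallyConstant U (Equiv.Perm (Fin n))) (h : Fin n → harmonic U)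
    (i : Fin n) (x : U) : (permute σ h i).1 x = (h ((σ x)⁻¹ i)).1 x := rfl

/-- The group law of the semidirect product: `(σ, h)(τ, k) = (στ, h + σ(k))`. -/
instance : Group (TGL n U) where
  mul a b := ⟨a.perm * b.perm, a.fn + permute a.perm b.fn⟩
  one := ⟨1, 0⟩
  inv a := ⟨a.perm⁻¹, -permute a.perm⁻¹ a.fn⟩
  mul_assoc a b c := by
    refine TGL.ext (mul_assoc _ _ _) ?_
    funext i
    refine Subtype.ext (funext fun x => ?_)
    change (a.fn i).1 x + (b.fn ((a.perm x)⁻¹ i)).1 x + (c.fn ((a.perm x * b.perm x)⁻¹ i)).1 x =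
      (a.fn i).1 x + ((b.fn ((a.perm x)⁻¹ i)).1 x +
        (c.fn ((b.perm x)⁻¹ ((a.perm x)⁻¹ i))).1 x)
    rw [mul_inv_rev, Equiv.Perm.mul_apply, add_assoc]
  one_mul a := by
    refine TGL.ext (one_mul _) ?_
    funext i
    refine Subtype.ext (funext fun x => ?_)
    change 0 + (a.fn ((1 : Equiv.Perm (Fin n))⁻¹ i)).1 x = (a.fn i).1 x
    simp
  mul_one a := by
    refine TGL.ext (mul_one _) ?_
    funext i
    refine Subtype.ext (funext fun x => ?_)
    change (a.fn i).1 x + 0 = (a.fn i).1 x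
    simp
  inv_mul_cancel a := by
    refine TGL.ext (inv_mul_cancel _) ?_
    funext i
    refine Subtype.ext (funext fun x => ?_)
    change -(a.fn _).1 x + (a.fn _).1 x = 0
    exact neg_add_cancel _

theorem mul_perm (a b : TGL n U) (x : U) : (a * b).perm x = a.perm x * b.perm x := rfl

theorem mul_fn (a b : TGL n U) (i : Fin n) (x : U) :
    ((a * b).fn i).1 x = (a.fn i).1 x + (b.fn ((a.perm x)⁻¹ i)).1 x := rfl

/-- Restriction of sections of `S_n ⋉ ℋ_Γ^n`. -/
def res (h : V ≤ U) (g : TGL n U) : TGL n V where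
  perm := g.perm.comap ⟨fun x => ⟨x.1, h x.2⟩, by fun_prop⟩
  fn i := harmonic.res h (g.fn i)

/-- A harmonic function as a scalar matrix. -/
def scalar (n : ℕ) (f : harmonic U) : TGL n U := ⟨1, fun _ => f⟩

theorem scalar_mul_comm (f : harmonic U) (g : TGL n U) : scalar n f * g = g * scalar n f := by
  refine TGL.ext ?_ ?_
  · ext1 x
    change 1 * g.perm x = g.perm x * 1
    rw [one_mul, mul_one]
  · funext i
    refine Subtype.ext (funext fun x => ?_)
    change f.1 x + (g.fn ((1 : Equiv.Perm (Fin n))⁻¹ i)).1 x = (g.fn i).1 x + f.1 x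
    simp [add_comm]

/-- The automorphism `(σ, h) ↦ (σ, -h)` of `S_n ⋉ ℋ_Γ^n`. -/
def dual (g : TGL n U) : TGL n U := ⟨g.perm, -g.fn⟩

theorem dual_one : dual (1 : TGL n U) = 1 :=
  TGL.ext rfl (neg_zero (G := Fin n → harmonic U))

theorem dual_mul (a b : TGL n U) : dual (a * b) = dual a * dual b := by
  refine TGL.ext rfl ?_
  funext i
  refine Subtype.ext (funext fun x => ?_)
  change -((a.fn i).1 x + (b.fn _).1 x) = -(a.fn i).1 x + -(b.fn _).1 x
  exact neg_add _ _

end TGL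

end Group

/-! ### Vector bundles -/

section Bundles

variable (Γ : Type u) [MetricSpace Γ]

/-- A sheaf of sets on `Γ` with an action of the sheaf of groups `S_n ⋉ ℋ_Γ^n`. -/
structure TGLSheaf (n : ℕ) where
  sheaf : TopCat.Sheaf (Type u) (TopCat.of Γ)
  act : ∀ U : Opens Γ, MulAction (TGL n U) (sheaf.1.obj (op U))
  map_smul : ∀ {U V : Opens Γ} (h : V ≤ U) (g : TGL n U) (s : sheaf.1.obj (op U)),
    sheaf.1.map (homOfLE h).op (g • s) = TGL.res h g • sheaf.1.map (homOfLE h).op s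

variable {Γ}

namespace TGLSheaf

variable {n : ℕ}

/-- The sections over an open set. -/
abbrev Sec (E : TGLSheaf Γ n) (U : Opens Γ) : Type u := E.sheaf.1.obj (op U)

instance (E : TGLSheaf Γ n) (U : Opens Γ) : MulAction (TGL n U) (E.Sec U) := E.act U

/-- Restriction of sections. -/
def res (E : TGLSheaf Γ n) {U V : Opens Γ} (h : V ≤ U) (s : E.Sec U) : E.Sec V :=
  E.sheaf.1.map (homOfLE h).op s

theorem res_smul (E : TGLSheaf Γ n) {U V : Opens Γ} (h : V ≤ U) (g : TGL n U) (s : E.Sec U) :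
    E.res h (g • s) = TGL.res h g • E.res h s := E.map_smul h g s

theorem res_self (E : TGLSheaf Γ n) {U : Opens Γ} (s : E.Sec U) : E.res le_rfl s = s := by
  simp [res]

theorem res_res (E : TGLSheaf Γ n) {U V W : Opens Γ} (h : V ≤ U) (h' : W ≤ V) (s : E.Sec U) :
    E.res h' (E.res h s) = E.res (h'.trans h) s := by
  have : (homOfLE (h'.trans h)).op = (homOfLE h).op ≫ (homOfLE h').op := rfl
  simp [res, this]

/-- A vector bundle of rank `n` on `Γ` is an `S_n ⋉ ℋ_Γ^n`-torsor: local sections exist, and the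
action on sections is simply transitive. -/
structure IsVectorBundle (E : TGLSheaf Γ n) : Prop where
  exists_local_section : ∀ p : Γ, ∃ U : Opens Γ, p ∈ U ∧ Nonempty (E.Sec U)
  simply_transitive : ∀ (U : Opens Γ) (s t : E.Sec U), ∃! g : TGL n U, g • s = t

/-- Isomorphism of sheaves with `S_n ⋉ ℋ_Γ^n`-action. -/
def IsIso (E F : TGLSheaf Γ n) : Prop :=
  ∃ α : ∀ U : Opens Γ, E.Sec U ≃ F.Sec U,
    (∀ (U V : Opens Γ) (h : V ≤ U) (s : E.Sec U), α V (E.res h s) = F.res h (α U s)) ∧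
    ∀ (U : Opens Γ) (g : TGL n U) (s : E.Sec U), α U (g • s) = g • α U s

/-- The dual `E^*`: the same sheaf, with the action twisted by `(σ, h) ↦ (σ, -h)`. -/
def dual (E : TGLSheaf Γ n) : TGLSheaf Γ n where
  sheaf := E.sheaf
  act U :=
    { smul := fun g s => (TGL.dual g • s : E.Sec U)
      one_smul := fun s => by
        change (TGL.dual (1 : TGL n U) • s : E.Sec U) = s
        rw [TGL.dual_one, one_smul]
      mul_smul := fun a b s => by
        change (TGL.dual (a * b) • s : E.Sec U) = TGL.dual a • (TGL.dual b • s : E.Sec U)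
        rw [TGL.dual_mul, mul_smul] }
  map_smul h g s := E.map_smul h (TGL.dual g) s

/-- The transition functions of `E` with respect to the star cover of the simple model `M`, for
suitable trivializations, have slopes `m e i`: there are sections `s v` over the open stars, and
over every edge `e` the unique `g e` with `s (src e) = g e • s (tgt e)`, i.e. the matrix of
`(trivialization at tgt e) ∘ (trivialization at src e)⁻¹`, has entries of slope `m e i` in the
direction of `e`. -/
def HasSlopes (E : TGLSheaf Γ n) (M : Model Γ) (m : M.E → Fin n → ℤ) : Prop :=
  ∃ (U : M.V → Opens Γ) (s : ∀ v, E.Sec (U v)) (g : ∀ e, TGL n (U (M.src e) ⊓ U (M.tgt e))),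
    (∀ v, (U v : Set Γ) = M.star v) ∧
    (∀ e, E.res inf_le_left (s (M.src e)) = g e • E.res inf_le_right (s (M.tgt e))) ∧
    ∀ e i, ∀ t ∈ Set.Ioo 0 (M.len e), ∀ t' ∈ Set.Ioo 0 (M.len e),
      ∀ (h : M.path e t ∈ U (M.src e) ⊓ U (M.tgt e)) (h' : M.path e t' ∈ U (M.src e) ⊓ U (M.tgt e)),
        ((g e).fn i).1 ⟨M.path e t', h'⟩ - ((g e).fn i).1 ⟨M.path e t, h⟩ = m e i * (t' - t)

open Classical in
/-- The degree of a vector bundle: the sum of the slopes of the finite entries of its transition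
functions over all edges, for any choice of a simple model and of trivializations. -/
noncomputable def degree (E : TGLSheaf Γ n) : ℤ :=
  if h : ∃ d : ℤ, ∃ M : Model Γ, M.IsSimple ∧ ∃ m, E.HasSlopes M m ∧ d = ∑ e, ∑ i, m e i
  then h.choose else 0

/-- A section over `U` of the tensor product `L ⊗ E` of a line bundle `L` with `E`: a morphism
`L⁻¹|_U → E|_U` of sheaves with an action of `ℋ_Γ`. The section `l ⊗ e` is the morphism
`l + f ↦ (-f) • e`. -/
@[ext]
structure TensorSec (L : TGLSheaf Γ 1) (E : TGLSheaf Γ n) (U : Opens Γ) : Type u where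
  app : ∀ V : Opens Γ, V ≤ U → L.Sec V → E.Sec V
  app_res : ∀ (V W : Opens Γ) (hV : V ≤ U) (hW : W ≤ V) (l : L.Sec V),
    app W (hW.trans hV) (L.res hW l) = E.res hW (app V hV l)
  app_smul : ∀ (V : Opens Γ) (hV : V ≤ U) (f : harmonic V) (l : L.Sec V),
    app V hV (TGL.scalar 1 f • l) = TGL.scalar n (-f) • app V hV l

namespace TensorSec

variable {L : TGLSheaf Γ 1} {E : TGLSheaf Γ n} {U V : Opens Γ}

/-- Restriction of sections of the tensor product. -/
def res (h : V ≤ U) (a : TensorSec L E U) : TensorSec L E V where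
  app W hW := a.app W (hW.trans h)
  app_res W W' hW hW' l := a.app_res W W' (hW.trans h) hW' l
  app_smul W hW f l := a.app_smul W (hW.trans h) f l

instance : MulAction (TGL n U) (TensorSec L E U) where
  smul g a :=
    { app := fun V hV l => TGL.res hV g • a.app V hV l
      app_res := fun V W hV hW l => by
        rw [a.app_res, E.res_smul]; rfl
      app_smul := fun V hV f l => by
        rw [a.app_smul, smul_smul, smul_smul, TGL.scalar_mul_comm] }
  one_smul a := by
    refine TensorSec.ext (funext fun V => funext fun hV => funext fun l => ?_)
    change (1 : TGL n V) • a.app V hV l = _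
    rw [one_smul]
  mul_smul g g' a := by
    refine TensorSec.ext (funext fun V => funext fun hV => funext fun l => ?_)
    change (TGL.res hV g * TGL.res hV g') • a.app V hV l = _
    rw [mul_smul]; rfl

end TensorSec

/-- The presheaf underlying `L ⊗ E`. -/
def tensorPresheaf (L : TGLSheaf Γ 1) (E : TGLSheaf Γ n) :
    TopCat.Presheaf (Type u) (TopCat.of Γ) where
  obj U := TensorSec L E U.unop
  map i := ↾fun a => TensorSec.res i.unop.le a

theorem tensorPresheaf_isSheaf (L : TGLSheaf Γ 1) (E : TGLSheaf Γ n) :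
    (tensorPresheaf L E).IsSheaf := by
  refine TopCat.Presheaf.isSheaf_of_isSheafUniqueGluing_types _ fun ι U a ha => ?_
  have hcompat : ∀ i j, TensorSec.res inf_le_left (a i) = TensorSec.res inf_le_right (a j) := ha
  have happ : ∀ i j (V : Opens Γ) (hi : V ≤ U i) (hj : V ≤ U j) (l : L.Sec V),
      (a i).app V hi l = (a j).app V hj l := fun i j V hi hj l =>
    congrArg (fun b => TensorSec.app b V (le_inf hi hj) l) (hcompat i j)
  have key : ∀ (V : Opens Γ) (_ : V ≤ iSup U) (l : L.Sec V), ∃! e : E.Sec V,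
      ∀ i, E.res (inf_le_left : V ⊓ U i ≤ V) e =
        (a i).app (V ⊓ U i) inf_le_right (L.res inf_le_left l) := by
    intro V hV l
    refine E.sheaf.existsUnique_gluing' (fun i => V ⊓ U i) V (fun i => homOfLE inf_le_left)
      (by rw [← inf_iSup_eq]; exact le_inf le_rfl hV)
      (fun i => (a i).app (V ⊓ U i) inf_le_right (L.res inf_le_left l)) fun i j => ?_
    change E.res _ _ = E.res _ _
    rw [← (a i).app_res, ← (a j).app_res, L.res_res, L.res_res]
    exact happ i j _ _ _ _
  choose e he huniq using key
  let A : TensorSec L E (iSup U) :=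
    { app := e
      app_res := fun V W hV hW l => by
        refine (huniq W _ _ _ fun i => ?_).symm
        have h1 := congrArg (E.res (inf_le_inf_right (U i) hW)) (he V hV l i)
        rw [E.res_res, ← (a i).app_res, L.res_res] at h1
        rw [E.res_res, L.res_res]
        exact h1
      app_smul := fun V hV f l => by
        refine (huniq V _ _ _ fun i => ?_).symm
        rw [E.res_smul, he, L.res_smul]
        exact ((a i).app_smul _ _ (harmonic.res inf_le_left f) _).symm }
  refine ⟨A, fun i => ?_, fun B hB => ?_⟩
  · refine TensorSec.ext (funext fun V => funext fun hV => funext fun l => ?_)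
    change e V (hV.trans (le_iSup U i)) l = (a i).app V hV l
    refine (huniq V _ _ _ fun j => ?_).symm
    rw [← (a i).app_res]
    exact happ i j _ _ _ _
  · refine TensorSec.ext (funext fun V => funext fun hV => funext fun l => ?_)
    refine huniq V hV l _ fun i => ?_
    have h1 : TensorSec.res (le_iSup U i) B = a i := hB i
    rw [← B.app_res, ← h1]
    rfl

/-- The tensor product `L ⊗ E` of a line bundle with a vector bundle. -/
def tensor (L : TGLSheaf Γ 1) (E : TGLSheaf Γ n) : TGLSheaf Γ n where
  sheaf := ⟨tensorPresheaf L E, tensorPresheaf_isSheaf L E⟩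
  act U := inferInstanceAs (MulAction (TGL n U) (TensorSec L E U))
  map_smul _ _ _ := rfl

end TGLSheaf

/-- The local predicate on functions that defines `ℋ_Γ(D)`. -/
def divLocalPredicate (D : Γ → ℤ) : TopCat.LocalPredicate fun _ : TopCat.of Γ => ℝ where
  pred {U} s := ∀ p : U, HasOrd (U := U) s p (D p.1)
  res {U V} i s hs p :=
    (hs ⟨p.1, i.le p.2⟩).of_eq (U := V) (V := U) (W := U) (i.le p.2) p.2 p.2 fun _ _ _ _ => rfl
  locality {U} s hs p := by
    obtain ⟨V, hV, i, h⟩ := hs p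
    exact (h ⟨p.1, hV⟩).of_eq (U := V) (V := U) (W := V) hV p.2 hV fun _ _ _ _ => rfl

/-- The line bundle `ℋ_Γ(D)`: its sections over `U` are the piecewise linear functions `s` on `U`
with integer slopes and `div(s) = D|_U`, and harmonic functions act by addition. -/
def lineBundle (D : Γ → ℤ) : TGLSheaf Γ 1 where
  sheaf := TopCat.subsheafToTypes (divLocalPredicate D)
  act U :=
    { smul := fun g s => ⟨(g.fn 0).1 + s.1, fun p => by
        simpa using ((g.fn 0).2 p).add (s.2 p)⟩
      one_smul := fun s => Subtype.ext (zero_add (M := U → ℝ) s.1)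
      mul_smul := fun a b s => Subtype.ext (funext fun x => by
        change (a.fn 0).1 x + (b.fn ((a.perm x)⁻¹ 0)).1 x + s.1 x =
          (a.fn 0).1 x + ((b.fn 0).1 x + s.1 x)
        rw [Subsingleton.elim ((a.perm x)⁻¹ 0) 0, add_assoc]) }
  map_smul _ _ _ := rfl

variable (Γ) in
/-- The canonical divisor `K_Γ = ∑_p (val(p) - 2) p`. -/
noncomputable def canonicalDivisor (p : Γ) : ℤ := (valence p : ℤ) - 2

end Bundles

/-! ### Multidivisors and the rank of a vector bundle -/

section Multidivisors

variable (Γ : Type u) [MetricSpace Γ]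

/-- A multidivisor of rank `n` on `Γ`: a free cover `f : X → Γ` of degree `n`, i.e. a covering map
that is a local isometry and all of whose fibres have `n` points, and a divisor `D` on `X`. If `Γ`
is a compact metric graph, then so is `X`. -/
structure Multidivisor (n : ℕ) where
  X : Type u
  [metricX : MetricSpace X]
  f : X → Γ
  isCoveringMap : IsCoveringMap f
  isometric : ∀ x : X, ∃ ε > 0, ∀ y ∈ Metric.ball x ε, ∀ z ∈ Metric.ball x ε,
    dist (f y) (f z) = dist y z
  degree : ∀ p : Γ, (f ⁻¹' {p}).encard = n
  D : X →₀ ℤ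

attribute [instance] Multidivisor.metricX

variable {Γ} {n : ℕ}

namespace Multidivisor

/-- The local predicate that defines the frames of `f_* ℋ_X(D)`. The value of a frame at `p` is a
numbering of the sheets over `p` together with a real number for each sheet. -/
def frameLocalPredicate (M : Multidivisor Γ n) : TopCat.LocalPredicate
    fun p : TopCat.of Γ => (Fin n ≃ M.f ⁻¹' {(p : Γ)}) × (Fin n → ℝ) where
  pred {U} s := ∀ i, Continuous (fun p : U => ((s p).1 i : M.X)) ∧
    ∀ p : U, HasOrd (U := U) (fun p => (s p).2 i) p (M.D ((s p).1 i))
  res {U V} i s hs j :=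
    ⟨(hs j).1.comp (Opens.isOpenEmbedding_of_le i.le).continuous, fun p =>
      ((hs j).2 ⟨p.1, i.le p.2⟩).of_eq (U := V) (V := U) (W := U) (i.le p.2) p.2 p.2 fun _ _ _ _ => rfl⟩
  locality {U} s hs j := by
    refine ⟨continuous_iff_continuousAt.2 fun p => ?_, fun p => ?_⟩
    · obtain ⟨V, hV, i, h⟩ := hs p
      exact (Opens.isOpenEmbedding_of_le i.le).continuousAt_iff (x := ⟨p.1, hV⟩).1
        (h j).1.continuousAt
    · obtain ⟨V, hV, i, h⟩ := hs p
      exact ((h j).2 ⟨p.1, hV⟩).of_eq (U := V) (V := U) (W := V) hV p.2 hV fun _ _ _ _ => rfl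

theorem smul_mem (M : Multidivisor Γ n) {U : Opens Γ} (g : TGL n U)
    (s : (TopCat.subsheafToTypes (frameLocalPredicate M)).1.obj (op U)) :
    (frameLocalPredicate M).pred (U := U) fun p => ((g.perm p)⁻¹.trans (s.1 p).1,
      fun i => (g.fn i).1 p + (s.1 p).2 ((g.perm p)⁻¹ i)) := by
  intro i
  have hloc : ∀ p : U, ∃ W : Opens Γ, p.1 ∈ W ∧ ∀ x : U, x.1 ∈ W → g.perm x = g.perm p := by
    intro p
    obtain ⟨W, hW, hp, hc⟩ := (IsLocallyConstant.iff_exists_open _).1 g.perm.isLocallyConstant p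
    obtain ⟨W', hW', rfl⟩ := isOpen_induced_iff.1 hW
    exact ⟨⟨W', hW'⟩, hp, hc⟩
  refine ⟨continuous_iff_continuousAt.2 fun p => ?_, fun p => ?_⟩
  · obtain ⟨W, hp, hc⟩ := hloc p
    refine ((s.2 ((g.perm p)⁻¹ i)).1.continuousAt (x := p)).congr ?_
    filter_upwards [(W.isOpen.preimage continuous_subtype_val).mem_nhds hp] with x hx
    change ((s.1 x).1 ((g.perm p)⁻¹ i) : M.X) = (s.1 x).1 ((g.perm x)⁻¹ i)
    rw [hc x hx]
  · obtain ⟨W, hp, hc⟩ := hloc p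
    have h1 := ((g.fn i).2 p).add ((s.2 ((g.perm p)⁻¹ i)).2 p)
    rw [zero_add] at h1
    refine h1.of_eq (U := U) (V := U) (W := W) p.2 p.2 hp fun x hx hU _ => ?_
    change (g.fn i).1 ⟨x, hU⟩ + (s.1 ⟨x, hU⟩).2 ((g.perm p)⁻¹ i) =
      (g.fn i).1 ⟨x, hU⟩ + (s.1 ⟨x, hU⟩).2 ((g.perm ⟨x, hU⟩)⁻¹ i)
    rw [hc ⟨x, hU⟩ hx]

/-- The vector bundle `ℋ_Γ(f, D) = f_* ℋ_X(D)`, as the torsor of its frames: a section over `U`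
is a numbering of the sheets of `f` over `U` together with a section of `ℋ_X(D)` on every sheet,
regarded as a function on `U`. An element `(σ, h)` of `S_n ⋉ ℋ_Γ^n` renumbers the sheets by `σ` and
adds `h i` to the section on the sheet with the new number `i`. -/
def pushforward (M : Multidivisor Γ n) : TGLSheaf Γ n where
  sheaf := TopCat.subsheafToTypes (frameLocalPredicate M)
  act U :=
    { smul := fun g s => ⟨fun p => ((g.perm p)⁻¹.trans (s.1 p).1,
        fun i => (g.fn i).1 p + (s.1 p).2 ((g.perm p)⁻¹ i)), smul_mem M g s⟩
      one_smul := fun s => Subtype.ext (funext fun p => Prod.ext (Equiv.ext fun i => rfl)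
        (funext fun i => zero_add ((s.1 p).2 i)))
      mul_smul := fun a b s => Subtype.ext (funext fun p => Prod.ext (Equiv.ext fun i => by
          change (s.1 p).1 ((a.perm p * b.perm p)⁻¹ i) = (s.1 p).1 ((b.perm p)⁻¹ ((a.perm p)⁻¹ i))
          rw [mul_inv_rev, Equiv.Perm.mul_apply])
        (funext fun i => by
          change (a.fn i).1 p + (b.fn ((a.perm p)⁻¹ i)).1 p + (s.1 p).2 ((a.perm p * b.perm p)⁻¹ i) =
            (a.fn i).1 p + ((b.fn ((a.perm p)⁻¹ i)).1 p +
              (s.1 p).2 ((b.perm p)⁻¹ ((a.perm p)⁻¹ i)))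
          rw [mul_inv_rev, Equiv.Perm.mul_apply, add_assoc])) }
  map_smul _ _ _ := rfl

end Multidivisor

open Classical in
/-- The Baker–Norine rank of a vector bundle `E`: the rank `r_X(D)` for any multidivisor
`(f : X → Γ, D)` with `f_* ℋ_X(D) ≃ E`. -/
noncomputable def TGLSheaf.bakerNorineRank (E : TGLSheaf Γ n) : ℤ :=
  if h : ∃ M : Multidivisor Γ n, M.pushforward.IsIso E then divRank h.choose.D else 0

end Multidivisors

end TropicalBundle

/-! The theorem reduces to Riemann–Roch for divisors on a cover. Over the open stars of a simple
model, a bundle `E` is given by a cocycle in S_n ⋉ ℋ^n. Distinct stars meet in at most one open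
edge, so the permutation part is constant on overlaps and glues n copies of each star to a free
cover f : X → Γ. The function part is then a line bundle on X. It has a piecewise linear section,
obtained on every edge by interpolating between 0 near the start and the transition function near
the end. If D is the divisor of this section, then E ≅ f_*ℋ(D); this is
`TGLSheaf.IsVectorBundle.exists_multidivisor`.

Everything else is read off from (X, D). An isomorphism of pushforwards induces a locally isometric
homeomorphism of the covers that matches the divisors up to linear equivalence, so the rank depends
on E only (`Multidivisor.divRank_eq_of_isIso`). The slopes of the transition functions add up to deg
D (`TGLSheaf.HasSlopes.sum_eq_divDegree`). Since f preserves valences, K_X = f^*K_Γ; hence ℋ(K_Γ) ⊗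
E^* ≅ f_*ℋ(K_X − D) (`Multidivisor.exists_isIso_tensor_dual`) and deg K_X = n deg K_Γ = −2nχ(Γ).

Riemann–Roch on X is proved component by component with acyclic orientations. A moderator is a
divisor ν = ∑ (indeg(v) − 1) v of such an orientation. By a maximum principle |ν| = ∅
(`IsModerator.linearSystem_eq_empty`). Conversely, if |D| = ∅, then D plus some effective divisor is
equivalent to a moderator (`exists_moderator`): the reduced representative of D at a point q is
negative at q, and the burning algorithm orders the vertices so that the resulting moderator
dominates it. Now r(D) + 1 is the least degree of an effective E with |D − E| = ∅, that is, with D +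
E' ~ ν + E for a moderator ν and an effective E'. Reversing the orientation replaces ν by K − ν, and
the relation becomes (K − D) + E ~ (K − ν) + E': the roles of E and E' are exchanged. As 2 deg ν =
deg K, comparing degrees relates r(D) to r(K − D). -/

namespace TropicalBundle

open Set Filter Topology

/-! ### Comparison of star-shaped charts -/

section Charts

variable {Γ : Type u} [MetricSpace Γ]

namespace IsStarChart

variable {p : Γ} {k k' : ℕ} {r r' : ℝ} {φ : Fin k → ℝ → Γ} {φ' : Fin k' → ℝ → Γ}

theorem dist_center (h : IsStarChart p k r φ) (i : Fin k) {t : ℝ} (h0 : 0 ≤ t) (hr : t < r) :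
    dist (φ i t) p = t := by
  have := h.dist_same i t ⟨h0, hr⟩ 0 ⟨le_rfl, h.pos⟩
  rwa [h.center, sub_zero, abs_of_nonneg h0] at this

theorem eq_iff (h : IsStarChart p k r φ) {i j : Fin k} {s t : ℝ} (hs : s ∈ Ico 0 r)
    (ht : t ∈ Ico 0 r) (hst : φ i s = φ j t) : s = t ∧ (i = j ∨ s = 0) := by
  have h1 := h.dist_center i hs.1 hs.2
  have h2 := h.dist_center j ht.1 ht.2
  rw [hst, h2] at h1
  refine ⟨h1.symm, ?_⟩
  by_contra! hc
  have := h.dist_ne i j hc.1 s hs t ht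
  rw [hst, dist_self, h1] at this
  exact hc.2 (by linarith)

theorem restrict (h : IsStarChart p k r φ) (h0 : 0 < r') (hle : r' ≤ r) :
    IsStarChart p k r' φ where
  pos := h0
  center := h.center
  dist_same i s hs t ht :=
    h.dist_same i s ⟨hs.1, hs.2.trans_le hle⟩ t ⟨ht.1, ht.2.trans_le hle⟩
  dist_ne i j hij s hs t ht :=
    h.dist_ne i j hij s ⟨hs.1, hs.2.trans_le hle⟩ t ⟨ht.1, ht.2.trans_le hle⟩
  isOpen := by
    have : insert p (⋃ i, φ i '' Ico 0 r') =
        insert p (⋃ i, φ i '' Ico 0 r) ∩ Metric.ball p r' := by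
      ext x
      simp only [mem_insert_iff, mem_iUnion, mem_image, mem_inter_iff, Metric.mem_ball]
      constructor
      · rintro (rfl | ⟨i, t, ht, rfl⟩)
        · exact ⟨Or.inl rfl, by simpa using h0⟩
        · refine ⟨Or.inr ⟨i, t, ⟨ht.1, ht.2.trans_le hle⟩, rfl⟩, ?_⟩
          rw [h.dist_center i ht.1 (ht.2.trans_le hle)]
          exact ht.2
      · rintro ⟨rfl | ⟨i, t, ht, rfl⟩, hx⟩
        · exact Or.inl rfl
        · rw [h.dist_center i ht.1 ht.2] at hx
          exact Or.inr ⟨i, t, ⟨ht.1, hx⟩, rfl⟩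
    rw [this]
    exact h.isOpen.inter Metric.isOpen_ball

/-- The ray parameter of a point is its distance to the centre, hence independent of the chart. This
is what makes different charts at `p` comparable. -/
theorem exists_ball (h : IsStarChart p k r φ) :
    ∃ ρ > 0, ρ ≤ r ∧ ∀ x ∈ Metric.ball p ρ, x = p ∨ ∃ i, x = φ i (dist x p) := by
  obtain ⟨ε, hε, hb⟩ := Metric.isOpen_iff.1 h.isOpen p (mem_insert _ _)
  refine ⟨min ε r, lt_min hε h.pos, min_le_right _ _, fun x hx => ?_⟩
  have hx' := hb (Metric.ball_subset_ball (min_le_left _ _) hx)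
  simp only [mem_insert_iff, mem_iUnion, mem_image] at hx'
  obtain rfl | ⟨i, t, ht, rfl⟩ := hx'
  · exact Or.inl rfl
  · exact Or.inr ⟨i, by rw [h.dist_center i ht.1 ht.2]⟩

/-- If the points of one ray at parameters t and δ/2 lay on different rays of the other chart, their
distance would be t + δ/2; but it is |t − δ/2|, which is smaller. -/
theorem exists_rays_sub (h : IsStarChart p k r φ) (h' : IsStarChart p k' r' φ') :
    ∃ δ > 0, δ ≤ r ∧ ∃ σ : Fin k → Fin k', ∀ i, ∀ t ∈ Ico 0 δ, φ i t = φ' (σ i) t := by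
  obtain ⟨ρ, hρ, hρr, hb⟩ := h'.exists_ball
  set δ := min ρ r with hδ
  have hδ0 : 0 < δ := lt_min hρ h.pos
  have hδr : δ ≤ r := min_le_right _ _
  have hδρ : δ ≤ ρ := min_le_left _ _
  have key : ∀ i, ∀ t ∈ Ioo 0 δ, ∃ j, φ i t = φ' j t := by
    intro i t ht
    have hd := h.dist_center i ht.1.le (ht.2.trans_le hδr)
    obtain he | ⟨j, hj⟩ := hb (φ i t) (by rw [Metric.mem_ball, hd]; exact ht.2.trans_le hδρ)
    · rw [he, dist_self] at hd
      exact absurd hd ht.1.ne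
    · exact ⟨j, by rwa [hd] at hj⟩
  have hhalf : δ / 2 ∈ Ioo 0 δ := ⟨by linarith, by linarith⟩
  choose σ hσ using fun i => key i (δ / 2) hhalf
  refine ⟨δ, hδ0, hδr, σ, fun i t ht => ?_⟩
  obtain h0 | h0 := ht.1.eq_or_lt
  · rw [← h0, h.center, h'.center]
  obtain ⟨j, hj⟩ := key i t ⟨h0, ht.2⟩
  by_cases hji : j = σ i
  · rw [hj, hji]
  have h1 := h.dist_same i t ⟨ht.1, ht.2.trans_le hδr⟩ (δ / 2)
    ⟨hhalf.1.le, hhalf.2.trans_le hδr⟩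
  have h2 := h'.dist_ne j (σ i) hji t ⟨ht.1, ht.2.trans_le (hδρ.trans hρr)⟩ (δ / 2)
    ⟨hhalf.1.le, hhalf.2.trans_le (hδρ.trans hρr)⟩
  rw [← hj, ← hσ i, h1] at h2
  have := abs_sub_lt_of_nonneg_of_lt ht.1 (lt_add_of_pos_right t hhalf.1) hhalf.1.le
    (lt_add_of_pos_left (δ / 2) h0)
  exact absurd h2 this.ne

/-- The index maps of the two directions are mutually inverse because distinct rays meet only at the
centre. Hence valences and sums of outgoing slopes do not depend on the chart. -/
theorem compare (h : IsStarChart p k r φ) (h' : IsStarChart p k' r' φ') :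
    ∃ δ > 0, δ ≤ r ∧ δ ≤ r' ∧ ∃ σ : Fin k ≃ Fin k', ∀ i, ∀ t ∈ Ico 0 δ, φ i t = φ' (σ i) t := by
  obtain ⟨δ, hδ, hδr, σ, hσ⟩ := h.exists_rays_sub h'
  obtain ⟨δ', hδ', hδr', σ', hσ'⟩ := h'.exists_rays_sub h
  have hm : 0 < min δ δ' := lt_min hδ hδ'
  have ht : min δ δ' / 2 ∈ Ico 0 (min δ δ') := ⟨by linarith, by linarith⟩
  have ht1 : min δ δ' / 2 ∈ Ico 0 δ := ⟨ht.1, ht.2.trans_le (min_le_left _ _)⟩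
  have ht2 : min δ δ' / 2 ∈ Ico 0 δ' := ⟨ht.1, ht.2.trans_le (min_le_right _ _)⟩
  refine ⟨min δ δ', hm, (min_le_left _ _).trans hδr, (min_le_right _ _).trans hδr',
    ⟨σ, σ', fun i => ?_, fun j => ?_⟩, fun i t hi => hσ i t ⟨hi.1, hi.2.trans_le (min_le_left _ _)⟩⟩
  · have e := (hσ i _ ht1).trans (hσ' (σ i) _ ht2)
    have := (h.eq_iff ⟨ht.1, ht1.2.trans_le hδr⟩ ⟨ht.1, ht1.2.trans_le hδr⟩ e).2
    exact (this.resolve_right (by linarith)).symm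
  · have e := (hσ' j _ ht2).trans (hσ (σ' j) _ ht1)
    have := (h'.eq_iff ⟨ht.1, ht2.2.trans_le hδr'⟩ ⟨ht.1, ht2.2.trans_le hδr'⟩ e).2
    exact (this.resolve_right (by linarith)).symm

theorem valence_eq (h : IsStarChart p k r φ) : valence p = k := by
  have : {k | ∃ r φ, IsStarChart p k r φ} = {k} := by
    ext k'
    simp only [mem_ofPred_eq, mem_singleton_iff]
    constructor
    · rintro ⟨r', φ', h'⟩
      obtain ⟨-, -, -, -, σ, -⟩ := h'.compare h
      simpa using Fintype.card_congr σ
    · rintro rfl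
      exact ⟨r, φ, h⟩
  rw [valence, this, csInf_singleton]

/-- Away from its centre a star is an interval. Therefore kinks of piecewise linear functions and
points of valence other than 2 are isolated. -/
theorem ray (h : IsStarChart p k r φ) (i : Fin k) {t : ℝ} (h0 : 0 < t) (hr : t < r) :
    IsStarChart (φ i t) 2 (min t (r - t)) ![fun s => φ i (t + s), fun s => φ i (t - s)] where
  pos := lt_min h0 (sub_pos.2 hr)
  center j := by fin_cases j <;> simp
  dist_same j s hs s' hs' := by
    simp only [mem_Ico, lt_min_iff] at hs hs'
    fin_cases j
    · have := h.dist_same i (t + s) ⟨by linarith, by linarith⟩ (t + s') ⟨by linarith, by linarith⟩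
      simpa using this
    · have := h.dist_same i (t - s) ⟨by linarith, by linarith⟩ (t - s') ⟨by linarith, by linarith⟩
      simp only [Fin.mk_one, Matrix.cons_val_one, Matrix.cons_val_fin_one]
      rw [this, abs_sub_comm]
      congr 1
      ring
  dist_ne j j' hj s hs s' hs' := by
    simp only [mem_Ico, lt_min_iff] at hs hs'
    have key : ∀ s s' : ℝ, 0 ≤ s ∧ s < t ∧ s < r - t → 0 ≤ s' ∧ s' < t ∧ s' < r - t →
        dist (φ i (t + s)) (φ i (t - s')) = s + s' := by
      intro s s' hs hs'
      rw [h.dist_same i (t + s) ⟨by linarith, by linarith⟩ (t - s') ⟨by linarith, by linarith⟩,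
        abs_of_nonneg (by linarith)]
      ring
    fin_cases j <;> fin_cases j'
    · exact absurd rfl hj
    · exact key s s' hs hs'
    · have := key s' s hs' hs
      rw [dist_comm, add_comm s'] at this
      exact this
    · exact absurd rfl hj
  isOpen := by
    have : insert (φ i t) (⋃ j, (![fun s => φ i (t + s), fun s => φ i (t - s)] : Fin 2 → ℝ → Γ) j ''
        Ico 0 (min t (r - t))) =
        insert p (⋃ i, φ i '' Ico 0 r) ∩ Metric.ball (φ i t) (min t (r - t)) := by
      ext x
      simp only [mem_insert_iff, mem_iUnion, mem_image, mem_inter_iff, Metric.mem_ball,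
        Fin.exists_fin_two, Matrix.cons_val_zero, Matrix.cons_val_one, Matrix.cons_val_fin_one,
        mem_Ico, lt_min_iff]
      constructor
      · rintro (rfl | ⟨s, hs, rfl⟩ | ⟨s, hs, rfl⟩)
        · exact ⟨Or.inr ⟨i, t, ⟨h0.le, hr⟩, rfl⟩, by simpa using ⟨h0, hr⟩⟩
        · refine ⟨Or.inr ⟨i, t + s, ⟨by linarith, by linarith⟩, rfl⟩, ?_⟩
          rw [h.dist_same i (t + s) ⟨by linarith, by linarith⟩ t ⟨h0.le, hr⟩, add_sub_cancel_left,
            abs_of_nonneg hs.1]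
          exact hs.2
        · refine ⟨Or.inr ⟨i, t - s, ⟨by linarith, by linarith⟩, rfl⟩, ?_⟩
          rw [h.dist_same i (t - s) ⟨by linarith, by linarith⟩ t ⟨h0.le, hr⟩, abs_sub_comm,
            sub_sub_cancel, abs_of_nonneg hs.1]
          exact hs.2
      · rintro ⟨rfl | ⟨j, s, hs, rfl⟩, hx⟩
        · rw [dist_comm, h.dist_center i h0.le hr] at hx
          exact absurd hx.1 (lt_irrefl _)
        · by_cases hj : j = i
          · subst hj
            rw [h.dist_same j s hs t ⟨h0.le, hr⟩] at hx
            rcases le_total t s with hts | hts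
            · rw [abs_of_nonneg (by linarith)] at hx
              exact Or.inr (Or.inl ⟨s - t, ⟨by linarith, hx⟩, by simp⟩)
            · rw [abs_of_nonpos (by linarith)] at hx
              exact Or.inr (Or.inr ⟨t - s, ⟨by linarith, by linarith, by linarith⟩, by simp⟩)
          · rw [h.dist_ne j i hj s hs t ⟨h0.le, hr⟩] at hx
            linarith [hx.1, hs.1]
    rw [this]
    exact h.isOpen.inter Metric.isOpen_ball

theorem eventually_nhdsNE (h : IsStarChart p k r φ) {P : Γ → Prop}
    {δ : ℝ} (hδ : 0 < δ) (hP : ∀ i, ∀ t ∈ Ioo 0 δ, P (φ i t)) : ∀ᶠ y in 𝓝[≠] p, P y := by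
  obtain ⟨ρ, hρ, hρr, hb⟩ := h.exists_ball
  rw [eventually_nhdsWithin_iff]
  filter_upwards [Metric.ball_mem_nhds p (lt_min hρ hδ)] with x hx hxp
  obtain rfl | ⟨i, hi⟩ := hb x (Metric.ball_subset_ball (min_le_left _ _) hx)
  · exact absurd rfl hxp
  · rw [hi]
    exact hP i _ ⟨dist_pos.2 hxp, lt_of_lt_of_le hx (min_le_right _ _)⟩

theorem eventually_ray_mem (h : IsStarChart p k r φ) {s : Set Γ} (hs : s ∈ 𝓝 p) :
    ∃ δ > 0, δ ≤ r ∧ ∀ i, ∀ t ∈ Ico 0 δ, φ i t ∈ s := by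
  obtain ⟨ε, hε, hb⟩ := Metric.mem_nhds_iff.1 hs
  refine ⟨min ε r, lt_min hε h.pos, min_le_right _ _, fun i t ht => hb ?_⟩
  rw [Metric.mem_ball, h.dist_center i ht.1 (ht.2.trans_le (min_le_right _ _))]
  exact ht.2.trans_le (min_le_left _ _)

theorem continuousOn (h : IsStarChart p k r φ) (i : Fin k) : ContinuousOn (φ i) (Ico 0 r) := by
  intro s hs
  rw [Metric.continuousWithinAt_iff]
  intro ε hε
  exact ⟨ε, hε, fun {t} ht htd => by rwa [h.dist_same i t ht s hs]⟩

/-- Balls contained in a star-shaped domain are connected. -/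
theorem isPreconnected_ball (h : IsStarChart p k r φ) :
    ∃ c > 0, ∀ x ∈ Metric.ball p c, ∀ ε ≤ c, IsPreconnected (Metric.ball x ε) := by
  obtain ⟨ρ, hρ, hρr, hb⟩ := h.exists_ball
  -- With centre and radius both bounded by ρ/2, the ball stays within distance ρ of `p`, where
  -- every point lies on a ray.
  refine ⟨ρ / 2, by linarith, fun x hx ε hε => ?_⟩
  by_cases hε0 : ε ≤ 0
  · rw [Metric.ball_eq_empty.2 hε0]
    exact isPreconnected_empty
  push Not at hε0
  have hseg : ∀ i, ∀ s ∈ Ico 0 r, ∀ t ∈ Ico 0 r, IsPreconnected (φ i '' uIcc s t) :=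
    fun i s hs t ht => (isPreconnected_uIcc).image _
      ((h.continuousOn i).mono fun y hy =>
        ⟨(le_min hs.1 ht.1).trans hy.1, hy.2.trans_lt (max_lt hs.2 ht.2)⟩)
  refine isPreconnected_of_forall x fun y hy => ?_
  have hxρ : dist x p < ρ := lt_trans hx (by linarith)
  have hyρ : dist y p < ρ := by
    have := dist_triangle y x p
    rw [Metric.mem_ball] at hx hy
    linarith
  -- the geodesic inside one ray
  have same : ∀ i, ∀ s ∈ Ico 0 r, ∀ t ∈ Ico 0 r, x = φ i s → y = φ i t →
      ∃ T ⊆ Metric.ball x ε, x ∈ T ∧ y ∈ T ∧ IsPreconnected T := by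
    rintro i s hs t ht rfl rfl
    refine ⟨φ i '' uIcc s t, ?_, mem_image_of_mem _ left_mem_uIcc, mem_image_of_mem _ right_mem_uIcc,
      hseg i s hs t ht⟩
    rintro _ ⟨z, hz, rfl⟩
    have hzr : z ∈ Ico 0 r := ⟨(le_min hs.1 ht.1).trans hz.1, hz.2.trans_lt (max_lt hs.2 ht.2)⟩
    rw [Metric.mem_ball, h.dist_same i t ht s hs] at hy
    rw [Metric.mem_ball, h.dist_same i z hzr s hs]
    exact (abs_sub_left_of_mem_uIcc hz).trans_lt hy
  have hc : ∀ i : Fin k, (0 : ℝ) ∈ Ico 0 r ∧ p = φ i 0 := fun i => ⟨⟨le_rfl, h.pos⟩, (h.center i).symm⟩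
  obtain hxp | ⟨i, hi⟩ := hb x hxρ <;> obtain hyp | ⟨j, hj⟩ := hb y hyρ
  · rw [hyp, ← hxp]
    exact ⟨{x}, by simpa using hε0, rfl, rfl, isPreconnected_singleton⟩
  · exact same j 0 (hc j).1 _ ⟨dist_nonneg, hyρ.trans_le hρr⟩ (hxp.trans (hc j).2) hj
  · exact same i _ ⟨dist_nonneg, hxρ.trans_le hρr⟩ 0 (hc i).1 hi (hyp.trans (hc i).2)
  · by_cases hij : i = j
    · subst hij
      exact same i _ ⟨dist_nonneg, hxρ.trans_le hρr⟩ _ ⟨dist_nonneg, hyρ.trans_le hρr⟩ hi hj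
    have hs : dist x p ∈ Ico 0 r := ⟨dist_nonneg, hxρ.trans_le hρr⟩
    have ht : dist y p ∈ Ico 0 r := ⟨dist_nonneg, hyρ.trans_le hρr⟩
    have hd : dist y x = dist y p + dist x p := by
      conv_lhs => rw [hi, hj]
      exact h.dist_ne j i (Ne.symm hij) _ ht _ hs
    rw [Metric.mem_ball, hd] at hy
    -- On different rays the path runs through the centre; its points are no farther from `x` than
    -- `y` is.
    refine ⟨φ i '' uIcc (dist x p) 0 ∪ φ j '' uIcc 0 (dist y p), ?_,
      Or.inl ⟨_, left_mem_uIcc, hi.symm⟩, Or.inr ⟨_, right_mem_uIcc, hj.symm⟩,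
      IsPreconnected.union p ⟨_, right_mem_uIcc, (hc i).2.symm⟩
        ⟨_, left_mem_uIcc, (hc j).2.symm⟩ (hseg i _ hs _ (hc i).1)
        (hseg j _ (hc j).1 _ ht)⟩
    rintro _ (⟨z, hz, rfl⟩ | ⟨z, hz, rfl⟩)
    · rw [uIcc_of_ge hs.1] at hz
      have : dist (φ i z) x = |z - dist x p| := by
        conv_lhs => rw [hi]
        exact h.dist_same i z ⟨hz.1, hz.2.trans_lt hs.2⟩ _ hs
      rw [Metric.mem_ball, this, abs_sub_comm, abs_of_nonneg (by linarith [hz.2])]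
      linarith [hz.1, ht.1]
    · rw [uIcc_of_le ht.1] at hz
      have : dist (φ j z) x = z + dist x p := by
        conv_lhs => rw [hi]
        exact h.dist_ne j i (Ne.symm hij) z ⟨hz.1, hz.2.trans_lt ht.2⟩ _ hs
      rw [Metric.mem_ball, this]
      linarith [hz.2]

end IsStarChart

/-! ### Orders of vanishing of globally defined functions -/

/-- The function `f` is piecewise linear with integer slopes near `p`, and the sum of its outgoing
slopes at `p` is `a`. -/
def OrdAt (f : Γ → ℝ) (p : Γ) (a : ℤ) : Prop :=
  ∃ k r φ, IsStarChart p k r φ ∧ ∃ m : Fin k → ℤ,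
    (∀ i, ∀ t ∈ Ico 0 r, f (φ i t) = f p + m i * t) ∧ ∑ i, m i = a

variable {f g : Γ → ℝ} {p : Γ} {a b : ℤ}

theorem OrdAt.of_slopes {k : ℕ} {r δ : ℝ} {φ : Fin k → ℝ → Γ} (h : IsStarChart p k r φ)
    (hδ : 0 < δ) (m : Fin k → ℤ) (hm : ∀ i, ∀ t ∈ Ico 0 δ, f (φ i t) = f p + m i * t) :
    OrdAt f p (∑ i, m i) :=
  ⟨k, min δ r, φ, h.restrict (lt_min hδ h.pos) (min_le_right _ _), m,
    fun i t ht => hm i t ⟨ht.1, ht.2.trans_le (min_le_left _ _)⟩, rfl⟩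

/-- By comparison of charts, slopes known in one chart are known in all. This is the bridge between
`OrdAt`, which asks for one chart, and `HasOrd`, which quantifies over all. -/
theorem OrdAt.exists_slopes (hf : OrdAt f p a) {k : ℕ} {r : ℝ} {φ : Fin k → ℝ → Γ}
    (h : IsStarChart p k r φ) : ∃ δ > 0, δ ≤ r ∧ ∃ m : Fin k → ℤ,
      (∀ i, ∀ t ∈ Ico 0 δ, f (φ i t) = f p + m i * t) ∧ ∑ i, m i = a := by
  obtain ⟨k', r', φ', h', m, hm, hs⟩ := hf
  obtain ⟨δ, hδ, hδr, hδr', σ, hσ⟩ := h.compare h'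
  refine ⟨δ, hδ, hδr, m ∘ σ, fun i t ht => ?_, ?_⟩
  · rw [hσ i t ht, hm _ t ⟨ht.1, ht.2.trans_le hδr'⟩]
    rfl
  · rw [← hs]
    exact σ.sum_comp m

theorem OrdAt.unique (hf : OrdAt f p a) (hf' : OrdAt f p b) : a = b := by
  obtain ⟨k, r, φ, h, m, hm, rfl⟩ := hf
  obtain ⟨δ, hδ, hδr, m', hm', rfl⟩ := hf'.exists_slopes h
  refine Finset.sum_congr rfl fun i _ => ?_
  have h1 := hm i (δ / 2) ⟨by linarith, by linarith⟩
  rw [hm' i (δ / 2) ⟨by linarith, by linarith⟩] at h1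
  have : (m' i : ℝ) = m i := by
    have h2 : (δ / 2) ≠ 0 := by positivity
    exact mul_right_cancel₀ h2 (add_left_cancel h1)
  exact_mod_cast this.symm

theorem OrdAt.congr (hf : OrdAt f p a) (hfg : f =ᶠ[𝓝 p] g) : OrdAt g p a := by
  obtain ⟨k, r, φ, h, m, hm, rfl⟩ := hf
  obtain ⟨δ, hδ, hδr, hs⟩ := h.eventually_ray_mem hfg
  refine OrdAt.of_slopes h hδ m fun i t ht => ?_
  have h1 : f (φ i t) = g (φ i t) := hs i t ht
  rw [← h1, ← hfg.self_of_nhds]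
  exact hm i t ⟨ht.1, ht.2.trans_le hδr⟩

theorem OrdAt.add (hf : OrdAt f p a) (hg : OrdAt g p b) : OrdAt (f + g) p (a + b) := by
  obtain ⟨k, r, φ, h, m, hm, rfl⟩ := hf
  obtain ⟨δ, hδ, hδr, m', hm', rfl⟩ := hg.exists_slopes h
  rw [← Finset.sum_add_distrib]
  refine OrdAt.of_slopes h hδ _ fun i t ht => ?_
  simp only [Pi.add_apply, hm i t ⟨ht.1, ht.2.trans_le hδr⟩, hm' i t ht, Int.cast_add]
  ring

theorem OrdAt.neg (hf : OrdAt f p a) : OrdAt (-f) p (-a) := by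
  obtain ⟨k, r, φ, h, m, hm, rfl⟩ := hf
  rw [← Finset.sum_neg_distrib]
  refine OrdAt.of_slopes h h.pos _ fun i t ht => ?_
  simp only [Pi.neg_apply, hm i t ht, Int.cast_neg]
  ring

theorem OrdAt.sub (hf : OrdAt f p a) (hg : OrdAt g p b) : OrdAt (f - g) p (a - b) := by
  rw [sub_eq_add_neg, sub_eq_add_neg]
  exact hf.add hg.neg

theorem ordAt_const [MetricGraph Γ] (c : ℝ) (p : Γ) : OrdAt (fun _ => c) p 0 := by
  obtain ⟨k, r, φ, h⟩ := MetricGraph.exists_chart p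
  exact ⟨k, r, φ, h, 0, by simp, by simp⟩

theorem OrdAt.sum [MetricGraph Γ] {ι : Type*} (s : Finset ι) {F : ι → Γ → ℝ} {d : ι → ℤ}
    (h : ∀ i ∈ s, OrdAt (F i) p (d i)) : OrdAt (fun x => ∑ i ∈ s, F i x) p (∑ i ∈ s, d i) := by
  classical
  induction s using Finset.induction_on with
  | empty => simpa using ordAt_const 0 p
  | insert i s hi ih =>
    simp only [Finset.sum_insert hi]
    exact (h i (by simp)).add (ih fun j hj => h j (by simp [hj]))

/-- If the values at `p` differ, the maximum coincides near `p` with the larger function; if they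
agree, it has on every ray the larger of the two slopes. Hence effectivity conditions on D + div f
survive maxima. -/
theorem OrdAt.sup (hf : OrdAt f p a) (hg : OrdAt g p b) :
    ∃ c, OrdAt (f ⊔ g) p c ∧ (a ≤ c ∨ b ≤ c) := by
  wlog hle : g p ≤ f p generalizing f g a b
  · obtain ⟨c, hc, h⟩ := this hg hf (le_of_not_ge hle)
    exact ⟨c, sup_comm f g ▸ hc, h.symm⟩
  obtain ⟨k, r, φ, h, m, hm, rfl⟩ := hf
  obtain ⟨δ, hδ, hδr, m', hm', rfl⟩ := hg.exists_slopes h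
  obtain hlt | heq := hle.lt_or_eq
  · obtain ⟨N, hN⟩ := exists_nat_gt (∑ i, |(m' i : ℝ) - m i|)
    -- The slopes differ by at most N, so the larger function stays ahead up to the parameter (f p −
    -- g p)/(N + 1).
    refine ⟨_, OrdAt.of_slopes h (lt_min hδ (div_pos (sub_pos.2 hlt)
      (show (0 : ℝ) < N + 1 by positivity))) m fun i t ht => ?_, Or.inl le_rfl⟩
    have ht1 : t < δ := ht.2.trans_le (min_le_left _ _)
    have ht2 : t < (f p - g p) / (N + 1) := ht.2.trans_le (min_le_right _ _)
    rw [lt_div_iff₀ (by positivity)] at ht2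
    have h3 : (m' i : ℝ) - m i ≤ N := (le_abs_self _).trans
      ((Finset.single_le_sum (f := fun i => |(m' i : ℝ) - m i|) (fun _ _ => abs_nonneg _)
        (Finset.mem_univ i)).trans hN.le)
    have h4 : ((m' i : ℝ) - m i) * t ≤ N * t := mul_le_mul_of_nonneg_right h3 ht.1
    simp only [Pi.sup_apply, hm i t ⟨ht.1, ht1.trans_le hδr⟩, hm' i t ⟨ht.1, ht1⟩,
      sup_eq_left.2 hlt.le]
    refine sup_eq_left.2 ?_
    have := ht.1
    nlinarith
  · refine ⟨_, OrdAt.of_slopes h hδ (fun i => max (m i) (m' i)) fun i t ht => ?_,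
      Or.inl (Finset.sum_le_sum fun i _ => le_max_left _ _)⟩
    simp only [Pi.sup_apply, hm i t ⟨ht.1, ht.2.trans_le hδr⟩, hm' i t ht, heq, sup_idem]
    rw [Int.cast_max, max_mul_of_nonneg _ _ ht.1]
    exact max_add_add_left _ _ _

theorem OrdAt.hasOrd {U : Opens Γ} {h : U → ℝ} {q : U} (hf : OrdAt f q.1 a)
    (hfh : ∀ x : U, h x = f x) : HasOrd h q a := by
  intro k r φ hφ
  obtain ⟨δ, hδ, -, m, hm, hs⟩ := hf.exists_slopes hφ
  exact ⟨δ, hδ, m, fun i t ht _ hx => by rw [hfh, hfh]; exact hm i t ht, hs⟩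

theorem HasOrd.ordAt [MetricGraph Γ] {U : Opens Γ} {h : U → ℝ} {q : U} (hh : HasOrd h q a)
    (hfh : ∀ x : U, h x = f x) : OrdAt f q.1 a := by
  obtain ⟨k, r, φ, hφ⟩ := MetricGraph.exists_chart q.1
  obtain ⟨δ, hδ, m, hm, rfl⟩ := hh k r φ hφ
  obtain ⟨δ', hδ', hδr', hs⟩ := hφ.eventually_ray_mem (U.isOpen.mem_nhds q.2)
  refine OrdAt.of_slopes hφ (lt_min hδ hδ') m fun i t ht => ?_
  have hU := hs i t ⟨ht.1, ht.2.trans_le (min_le_right _ _)⟩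
  rw [← hfh q, ← hfh ⟨_, hU⟩]
  exact hm i t ⟨ht.1, ht.2.trans_le (min_le_left _ _)⟩
    (ht.2.trans_le ((min_le_right _ _).trans hδr')) hU

/-- Extension by zero of a function on an open set. -/
noncomputable def extendZero (U : Opens Γ) (h : U → ℝ) (x : Γ) : ℝ :=
  open Classical in if hx : x ∈ U then h ⟨x, hx⟩ else 0

theorem extendZero_apply {U : Opens Γ} (h : U → ℝ) (x : U) : extendZero U h x = h x :=
  dif_pos x.2

theorem extendZero_of_mem {U : Opens Γ} (h : U → ℝ) {x : Γ} (hx : x ∈ U) :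
    extendZero U h x = h ⟨x, hx⟩ := dif_pos hx

theorem hasOrd_iff [MetricGraph Γ] {U : Opens Γ} {h : U → ℝ} {q : U} :
    HasOrd h q a ↔ OrdAt (extendZero U h) q.1 a :=
  ⟨fun hh => hh.ordAt fun x => (extendZero_apply h x).symm,
    fun hf => hf.hasOrd fun x => (extendZero_apply h x).symm⟩

theorem OrdAt.eventually_zero (hf : OrdAt f p a) : ∀ᶠ y in 𝓝[≠] p, OrdAt f y 0 := by
  obtain ⟨k, r, φ, h, m, hm, rfl⟩ := hf
  refine h.eventually_nhdsNE h.pos fun i t ht => ?_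
  refine ⟨2, _, _, h.ray i ht.1 ht.2, ![m i, -m i], fun j s hs => ?_, by simp⟩
  have h1 := ht.1
  simp only [mem_Ico, lt_min_iff] at hs
  fin_cases j
  · simp only [Fin.zero_eta, Matrix.cons_val_zero]
    rw [hm i t ⟨ht.1.le, ht.2⟩, hm i (t + s) ⟨by linarith, by linarith⟩]
    ring
  · simp only [Fin.mk_one, Matrix.cons_val_one, Matrix.cons_val_fin_one]
    rw [hm i t ⟨ht.1.le, ht.2⟩, hm i (t - s) ⟨by linarith, by linarith⟩]
    push_cast
    ring

theorem eventually_valence_eq_two [MetricGraph Γ] (p : Γ) : ∀ᶠ y in 𝓝[≠] p, valence y = 2 := by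
  obtain ⟨k, r, φ, h⟩ := MetricGraph.exists_chart p
  exact h.eventually_nhdsNE h.pos fun i t ht => (h.ray i ht.1 ht.2).valence_eq

/-- Every point has a neighbourhood that meets the support in at most that point, and finitely many
of these neighbourhoods cover. -/
theorem finite_support_of_eventually {Y : Type*} [TopologicalSpace Y] [CompactSpace Y] {D : Y → ℤ}
    (h : ∀ p, ∀ᶠ y in 𝓝[≠] p, D y = 0) : D.support.Finite := by
  have h' : ∀ p, ∀ᶠ y in 𝓝 p, y ∈ D.support → y = p := fun p => by
    filter_upwards [eventually_nhdsWithin_iff.1 (h p)] with y hy hyD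
    by_contra hne
    exact hyD (hy hne)
  obtain ⟨t, -, ht⟩ := isCompact_univ.elim_nhds_subcover (fun p => {y | y ∈ D.support → y = p})
    fun p _ => h' p
  refine t.finite_toSet.subset fun y hy => ?_
  obtain ⟨p, hp, hyp⟩ := mem_iUnion₂.1 (ht (mem_univ y))
  exact (hyp hy) ▸ hp

theorem exists_pos_le_of_finset {ι : Type*} (t : Finset ι) (c : ι → ℝ) (hc : ∀ i ∈ t, 0 < c i) :
    ∃ c₀ > 0, ∀ i ∈ t, c₀ ≤ c i := by
  obtain rfl | hne := t.eq_empty_or_nonempty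
  · exact ⟨1, one_pos, by simp⟩
  · exact ⟨t.inf' hne c, (Finset.lt_inf'_iff hne).2 hc, fun i hi => Finset.inf'_le c hi⟩

/-- Small balls are connected. As a consequence components are open, hence metric graphs themselves,
and a compact metric graph has finitely many of them. -/
instance locallyConnectedSpace_of_metricGraph [MetricGraph Γ] :
    LocallyConnectedSpace Γ := by
  refine locallyConnectedSpace_of_connected_bases (fun x ε => Metric.ball x ε)
    (fun x ε => 0 < ε ∧ IsPreconnected (Metric.ball x ε)) (fun x => ?_) fun x ε h => h.2
  obtain ⟨k, r, φ, h⟩ := MetricGraph.exists_chart x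
  obtain ⟨c, hc, hb⟩ := h.isPreconnected_ball
  refine Metric.nhds_basis_ball.to_hasBasis (fun ε hε => ?_) fun ε h => ⟨ε, h.1, subset_rfl⟩
  exact ⟨min ε c, ⟨lt_min hε hc, hb x (Metric.mem_ball_self hc) _ (min_le_right _ _)⟩,
    Metric.ball_subset_ball (min_le_left _ _)⟩

end Charts

/-! ### Local isometries -/

section LocalIsometries

variable {X Y : Type*} [MetricSpace X] [MetricSpace Y]

/-- An open map that preserves distances on small balls. -/
structure LocIso (f : X → Y) : Prop where
  isOpenMap : IsOpenMap f
  isometric : ∀ x : X, ∃ ε > 0, ∀ y ∈ Metric.ball x ε, ∀ z ∈ Metric.ball x ε,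
    dist (f y) (f z) = dist y z

theorem LocIso.continuous {f : X → Y} (hf : LocIso f) : Continuous f := by
  refine continuous_iff_continuousAt.2 fun x => Metric.continuousAt_iff.2 fun ε hε => ?_
  obtain ⟨δ, hδ, h⟩ := hf.isometric x
  refine ⟨min δ ε, lt_min hδ hε, fun {y} hy => ?_⟩
  rw [h y (hy.trans_le (min_le_left _ _)) x (Metric.mem_ball_self hδ)]
  exact hy.trans_le (min_le_right _ _)

theorem LocIso.subtypeVal {s : Set X} (hs : IsOpen s) : LocIso (Subtype.val : s → X) where
  isOpenMap := hs.isOpenMap_subtype_val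
  isometric _ := ⟨1, one_pos, fun _ _ _ _ => rfl⟩

variable {f : X → Y} {x : X} {k : ℕ} {r : ℝ}

theorem IsStarChart.map {φ : Fin k → ℝ → X} (h : IsStarChart x k r φ) (hf : LocIso f) :
    ∃ r' > 0, r' ≤ r ∧ IsStarChart (f x) k r' fun i t => f (φ i t) := by
  obtain ⟨ε, hε, hi⟩ := hf.isometric x
  have hpos : 0 < min ε r := lt_min hε h.pos
  have h' := h.restrict hpos (min_le_right ε r)
  have hball : ∀ i, ∀ t ∈ Ico 0 (min ε r), φ i t ∈ Metric.ball x ε := fun i t ht => by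
    rw [Metric.mem_ball, h'.dist_center i ht.1 ht.2]
    exact ht.2.trans_le (min_le_left _ _)
  refine ⟨min ε r, hpos, min_le_right _ _, hpos, fun i => by rw [h.center], ?_, ?_, ?_⟩
  · intro i s hs t ht
    rw [hi _ (hball i s hs) _ (hball i t ht), h'.dist_same i s hs t ht]
  · intro i j hij s hs t ht
    rw [hi _ (hball i s hs) _ (hball j t ht), h'.dist_ne i j hij s hs t ht]
  · have := hf.isOpenMap _ h'.isOpen
    rw [image_insert_eq, image_iUnion] at this
    simpa only [image_image] using this

/-- On a small ball the map is injective with open image, so short initial segments of the rays lift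
uniquely. -/
theorem IsStarChart.lift {φ : Fin k → ℝ → Y} (h : IsStarChart (f x) k r φ) (hf : LocIso f) :
    ∃ r' > 0, r' ≤ r ∧ ∃ ψ : Fin k → ℝ → X, IsStarChart x k r' ψ ∧
      ∀ i, ∀ t ∈ Ico 0 r', f (ψ i t) = φ i t := by
  obtain ⟨ε, hε, hi⟩ := hf.isometric x
  have hopen : f '' Metric.ball x ε ∈ 𝓝 (f x) :=
    (hf.isOpenMap _ Metric.isOpen_ball).mem_nhds (mem_image_of_mem f (Metric.mem_ball_self hε))
  obtain ⟨δ, hδ, hδr, hδm⟩ := h.eventually_ray_mem hopen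
  have hinj : InjOn f (Metric.ball x ε) := fun y hy z hz hyz => by
    rw [← dist_eq_zero, ← hi y hy z hz, hyz, dist_self]
  have : ∀ i t, ∃ y, t ∈ Ico 0 δ → y ∈ Metric.ball x ε ∧ f y = φ i t := fun i t => by
    by_cases ht : t ∈ Ico 0 δ
    · obtain ⟨y, hy, hyf⟩ := hδm i t ht
      exact ⟨y, fun _ => ⟨hy, hyf⟩⟩
    · exact ⟨x, fun h => absurd h ht⟩
  choose ψ hψ using this
  have h' := h.restrict hδ hδr
  refine ⟨δ, hδ, hδr, ψ, ⟨hδ, fun i => ?_, ?_, ?_, ?_⟩, fun i t ht => (hψ i t ht).2⟩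
  · have := hψ i 0 ⟨le_rfl, hδ⟩
    exact hinj this.1 (Metric.mem_ball_self hε) (by rw [this.2, h.center])
  · intro i s hs t ht
    rw [← hi _ (hψ i s hs).1 _ (hψ i t ht).1, (hψ i s hs).2, (hψ i t ht).2,
      h'.dist_same i s hs t ht]
  · intro i j hij s hs t ht
    rw [← hi _ (hψ i s hs).1 _ (hψ j t ht).1, (hψ i s hs).2, (hψ j t ht).2,
      h'.dist_ne i j hij s hs t ht]
  · have : insert x (⋃ i, ψ i '' Ico 0 δ) =
        Metric.ball x ε ∩ f ⁻¹' insert (f x) (⋃ i, φ i '' Ico 0 δ) := by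
      ext y
      simp only [mem_insert_iff, mem_iUnion, mem_image, mem_inter_iff, mem_preimage]
      constructor
      · rintro (rfl | ⟨i, t, ht, rfl⟩)
        · exact ⟨Metric.mem_ball_self hε, Or.inl rfl⟩
        · exact ⟨(hψ i t ht).1, Or.inr ⟨i, t, ht, (hψ i t ht).2.symm⟩⟩
      · rintro ⟨hy, hyx | ⟨i, t, ht, hyt⟩⟩
        · exact Or.inl (hinj hy (Metric.mem_ball_self hε) hyx)
        · exact Or.inr ⟨i, t, ht, hinj (hψ i t ht).1 hy ((hψ i t ht).2.trans hyt)⟩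
    rw [this]
    exact Metric.isOpen_ball.inter (h'.isOpen.preimage hf.continuous)

theorem LocIso.metricGraph [MetricGraph Y] (hf : LocIso f) : MetricGraph X where
  exists_chart x := by
    obtain ⟨k, r, φ, h⟩ := MetricGraph.exists_chart (f x)
    obtain ⟨r', -, -, ψ, hψ, -⟩ := h.lift hf
    exact ⟨k, r', ψ, hψ⟩

theorem LocIso.valence_eq [MetricGraph Y] (hf : LocIso f) (x : X) : valence x = valence (f x) := by
  obtain ⟨k, r, φ, h⟩ := MetricGraph.exists_chart (f x)
  obtain ⟨r', -, -, ψ, hψ, -⟩ := h.lift hf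
  rw [hψ.valence_eq, h.valence_eq]

theorem LocIso.ordAt_comp_iff (hf : LocIso f) {F : Y → ℝ} {a : ℤ} :
    OrdAt (F ∘ f) x a ↔ OrdAt F (f x) a := by
  constructor
  · rintro ⟨k, r, φ, h, m, hm, rfl⟩
    obtain ⟨r', h0, hr', h'⟩ := h.map hf
    exact OrdAt.of_slopes h' h0 m fun i t ht => hm i t ⟨ht.1, ht.2.trans_le hr'⟩
  · rintro ⟨k, r, φ, h, m, hm, rfl⟩
    obtain ⟨r', h0, hr', ψ, hψ, hφ⟩ := h.lift hf
    refine OrdAt.of_slopes hψ h0 m fun i t ht => ?_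
    simp only [Function.comp_apply, hφ i t ht]
    exact hm i t ⟨ht.1, ht.2.trans_le hr'⟩

end LocalIsometries

/-- Local constancy is continuity for the discrete topology on the target. This propagates ray
indices, slopes and intercepts along intervals. -/
theorem eq_of_eventually_eq {α β : Type*} [TopologicalSpace α] {s : Set α}
    (hs : _root_.IsPreconnected s) {f : α → β} (h : ∀ x ∈ s, ∀ᶠ y in 𝓝[s] x, f y = f x) {x y : α}
    (hx : x ∈ s) (hy : y ∈ s) : f x = f y := by
  let _ : TopologicalSpace β := ⊥
  have : DiscreteTopology β := ⟨rfl⟩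
  exact hs.constant (fun z hz => continuousWithinAt_const.congr_of_eventuallyEq (h z hz) rfl) hx hy

theorem IsStarChart.isOpen_image_Ioo {Γ : Type*} [MetricSpace Γ] {p : Γ} {k : ℕ} {r : ℝ}
    {φ : Fin k → ℝ → Γ} (h : IsStarChart p k r φ) (i : Fin k) {a b : ℝ} (ha : 0 ≤ a)
    (hb : b ≤ r) : IsOpen (φ i '' Ioo a b) := by
  rw [isOpen_iff_mem_nhds]
  rintro _ ⟨t, ht, rfl⟩
  have h' := h.ray i (ha.trans_lt ht.1) (ht.2.trans_le hb)
  obtain ⟨ρ, hρ, hρr, hball⟩ := h'.exists_ball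
  refine mem_of_superset (Metric.ball_mem_nhds _ (lt_min hρ (lt_min (sub_pos.2 ht.1)
    (sub_pos.2 ht.2)))) fun x hx => ?_
  simp only [Metric.mem_ball, lt_min_iff] at hx
  obtain rfl | ⟨j, hj⟩ := hball x hx.1
  · exact ⟨t, ht, rfl⟩
  · have h0 : 0 ≤ dist x (φ i t) := dist_nonneg
    rw [hj]
    fin_cases j
    · exact ⟨t + dist x (φ i t), ⟨by linarith [ht.1], by linarith [hx.2.2]⟩, rfl⟩
    · exact ⟨t - dist x (φ i t), ⟨by linarith [hx.2.1], by linarith [ht.2]⟩, rfl⟩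

/-! ### Half-edges of a model and its topology -/

namespace Model

variable {Γ : Type u} [MetricSpace Γ] (M : Model Γ)

/-- The edge of a half-edge, parametrized starting from the base vertex of the half-edge. -/
def hpath (h : M.E × Bool) (t : ℝ) : Γ := M.path h.1 (bif h.2 then M.len h.1 - t else t)

/-- The vertex at which a half-edge starts. -/
def base (h : M.E × Bool) : M.V := bif h.2 then M.tgt h.1 else M.src h.1

/-- The other half of the edge of a half-edge. -/
def flip (h : M.E × Bool) : M.E × Bool := (h.1, !h.2)

@[simp] theorem flip_flip (h : M.E × Bool) : M.flip (M.flip h) = h := by simp [flip]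

@[simp] theorem flip_fst (h : M.E × Bool) : (M.flip h).1 = h.1 := rfl

theorem hpath_flip (h : M.E × Bool) (t : ℝ) :
    M.hpath (M.flip h) t = M.hpath h (M.len h.1 - t) := by
  rcases h with ⟨e, _ | _⟩ <;> simp [hpath, flip]

theorem hpath_zero (h : M.E × Bool) : M.hpath h 0 = M.base h := by
  rcases h with ⟨e, _ | _⟩ <;> simp [hpath, base, src, tgt]

theorem hpath_len (h : M.E × Bool) : M.hpath h (M.len h.1) = M.base (M.flip h) := by
  rw [← hpath_zero, hpath_flip, sub_zero]

@[simp] theorem hpath_false (e : M.E) (t : ℝ) : M.hpath (e, false) t = M.path e t := rfl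

@[simp] theorem base_false (e : M.E) : M.base (e, false) = M.src e := rfl

@[simp] theorem base_true (e : M.E) : M.base (e, true) = M.tgt e := rfl

theorem continuousOn_hpath (h : M.E × Bool) :
    ContinuousOn (M.hpath h) (Icc 0 (M.len h.1)) := by
  rcases h with ⟨e, _ | _⟩
  · exact M.continuousOn_path e
  · exact (M.continuousOn_path e).comp (f := fun t => M.len e - t) (by fun_prop) fun t ht =>
      ⟨by simpa using ht.2, by simpa using ht.1⟩

theorem hpath_notMem (h : M.E × Bool) {t : ℝ} (ht : t ∈ Ioo 0 (M.len h.1)) :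
    M.hpath h t ∉ M.V := by
  rcases h with ⟨e, _ | _⟩
  · exact M.notMem e t ht
  · exact M.notMem e _ ⟨by simpa using ht.2, by simpa using ht.1⟩

theorem hpath_isometric (h : M.E × Bool) {t : ℝ} (ht : t ∈ Ioo 0 (M.len h.1)) :
    ∃ ε > 0, ∀ s ∈ Ioo (t - ε) (t + ε), ∀ s' ∈ Ioo (t - ε) (t + ε),
      dist (M.hpath h s) (M.hpath h s') = |s - s'| := by
  rcases h with ⟨e, _ | _⟩
  · exact M.isometric e t ht
  · simp only [mem_Ioo] at ht
    obtain ⟨ε, hε, hi⟩ := M.isometric e (M.len e - t) ⟨by linarith, by linarith⟩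
    refine ⟨ε, hε, fun s hs s' hs' => ?_⟩
    simp only [hpath, cond_true]
    rw [hi _ ⟨by linarith [hs.2], by linarith [hs.1]⟩ _ ⟨by linarith [hs'.2], by linarith [hs'.1]⟩,
      abs_sub_comm]
    congr 1
    ring

theorem hpath_inj (h h' : M.E × Bool) {t t' : ℝ} (ht : t ∈ Ioo 0 (M.len h.1))
    (ht' : t' ∈ Ioo 0 (M.len h'.1)) (heq : M.hpath h t = M.hpath h' t') :
    (h = h' ∧ t = t') ∨ (h' = M.flip h ∧ t' = M.len h.1 - t) := by
  simp only [mem_Ioo] at ht ht'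
  rcases h with ⟨e, _ | _⟩ <;> rcases h' with ⟨e', _ | _⟩ <;>
    simp only [hpath, cond_true, cond_false] at heq ht ht'
  · obtain ⟨rfl, rfl⟩ := M.inj e e' _ ht _ ht' heq
    exact Or.inl ⟨rfl, rfl⟩
  · obtain ⟨rfl, rfl⟩ := M.inj e e' _ ht _ ⟨by linarith, by linarith⟩ heq
    exact Or.inr ⟨rfl, by ring⟩
  · obtain ⟨rfl, h2⟩ := M.inj e e' _ ⟨by linarith, by linarith⟩ _ ht' heq
    exact Or.inr ⟨rfl, by rw [← h2]⟩
  · obtain ⟨rfl, h2⟩ := M.inj e e' _ ⟨by linarith, by linarith⟩ _ ⟨by linarith, by linarith⟩ heq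
    exact Or.inl ⟨rfl, by linarith⟩

theorem cover_mem (x : Γ) : x ∈ M.V ∨ ∃ e, ∃ t ∈ Ioo 0 (M.len e), M.path e t = x := by
  by_cases hx : x ∈ M.V
  · exact Or.inl hx
  · exact Or.inr (M.cover x hx)

theorem eq_zero_or_len {e : M.E} {t : ℝ} (ht : t ∈ Icc 0 (M.len e)) (hV : M.path e t ∈ M.V) :
    t = 0 ∨ t = M.len e := by
  by_contra! hc
  exact M.notMem e t ⟨lt_of_le_of_ne ht.1 (Ne.symm hc.1), lt_of_le_of_ne ht.2 hc.2⟩ hV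

theorem isClosed_image (e : M.E) {C : Set ℝ} (hC : IsClosed C) :
    IsClosed (M.path e '' (Icc 0 (M.len e) ∩ C)) :=
  ((isCompact_Icc.inter_right hC).image_of_continuousOn
    ((M.continuousOn_path e).mono inter_subset_left)).isClosed

/-- Openness comes from compactness: the complement is a finite union of vertices, other closed
edges and closed pieces of the same edge, all of them compact. -/
theorem isOpen_image_Ioo (e : M.E) {a b : ℝ} (ha : 0 ≤ a) (hb : b ≤ M.len e) :
    IsOpen (M.path e '' Ioo a b) := by
  have hc : IsClosed ((M.V : Set Γ) ∪ (⋃ e' ∈ {e' | e' ≠ e}, (M.path e') '' (Icc 0 (M.len e') ∩ univ)) ∪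
      M.path e '' (Icc 0 (M.len e) ∩ (Iic a ∪ Ici b))) :=
    (M.V.finite_toSet.isClosed.union ((toFinite _).isClosed_biUnion fun e' _ =>
      M.isClosed_image e' isClosed_univ)).union (M.isClosed_image e (isClosed_Iic.union isClosed_Ici))
  convert hc.isOpen_compl using 1
  ext x
  simp only [mem_image, mem_compl_iff, mem_union, mem_iUnion, SetLike.mem_coe,
    inter_univ, not_or, not_exists, not_and, mem_inter_iff, mem_Iic, mem_Ici]
  constructor
  · rintro ⟨t, ht, rfl⟩
    have ht0 : t ∈ Ioo 0 (M.len e) := ⟨ha.trans_lt ht.1, ht.2.trans_le hb⟩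
    have hV := M.notMem e t ht0
    have hinterior : ∀ e' s, s ∈ Icc 0 (M.len e') → M.path e' s = M.path e t → s ∈ Ioo 0 (M.len e') := by
      intro e' s hs hst
      refine ⟨hs.1.lt_of_ne ?_, hs.2.lt_of_ne ?_⟩
      · rintro rfl
        exact hV (hst ▸ M.source_mem e')
      · rintro rfl
        exact hV (hst ▸ M.target_mem e')
    refine ⟨⟨hV, fun e' he' s hs hst => he' (M.inj e' e s (hinterior e' s hs hst) t ht0 hst).1⟩,
      fun s hs hst => ?_⟩
    obtain ⟨-, rfl⟩ := M.inj e e s (hinterior e s hs.1 hst) t ht0 hst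
    rcases hs.2 with h | h
    · exact absurd ht.1 (not_lt.2 h)
    · exact absurd ht.2 (not_lt.2 h)
  · rintro ⟨⟨hV, he⟩, hs⟩
    obtain ⟨e', t, ht, rfl⟩ := M.cover x hV
    by_cases hee : e' = e
    · subst hee
      refine ⟨t, ?_, rfl⟩
      by_contra hc
      refine hs t ⟨⟨ht.1.le, ht.2.le⟩, ?_⟩ rfl
      by_contra! hcc
      exact hc hcc
    · exact absurd rfl (he e' hee t ⟨ht.1.le, ht.2.le⟩)

/-- The complement consists of the other vertices and of the closed edges not ending at `v`; this is
a finite union of compact sets. -/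
theorem isOpen_star (v : M.V) : IsOpen (M.star v) := by
  have hc : IsClosed (((M.V : Set Γ) \ {v.1}) ∪
      (⋃ e ∈ {e | M.src e ≠ v ∧ M.tgt e ≠ v}, M.path e '' (Icc 0 (M.len e) ∩ univ))) :=
    (M.V.finite_toSet.subset sdiff_subset).isClosed.union ((toFinite _).isClosed_biUnion fun e' _ =>
      M.isClosed_image e' isClosed_univ)
  convert hc.isOpen_compl using 1
  ext x
  simp only [star, mem_union, mem_singleton_iff, mem_iUnion, mem_image, inter_univ,
    mem_compl_iff, not_or, not_exists, not_and, Set.mem_sdiff, SetLike.mem_coe, not_not]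
  constructor
  · rintro (rfl | ⟨e, he, t, ht, rfl⟩)
    · refine ⟨fun _ => rfl, fun e he t ht htv => ?_⟩
      rcases M.eq_zero_or_len ht (htv ▸ v.2) with rfl | rfl
      · exact he.1 (Subtype.ext htv)
      · exact he.2 (Subtype.ext htv)
    · have hV := M.notMem e t ht
      refine ⟨fun h => absurd h hV, fun e' he' s hs hst => ?_⟩
      have hs' : s ∈ Ioo 0 (M.len e') := by
        refine ⟨hs.1.lt_of_ne ?_, hs.2.lt_of_ne ?_⟩
        · rintro rfl
          exact hV (hst ▸ M.source_mem e')
        · rintro rfl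
          exact hV (hst ▸ M.target_mem e')
      obtain ⟨rfl, -⟩ := M.inj e' e s hs' t ht hst
      exact he.elim he'.1 he'.2
  · rintro ⟨h1, h2⟩
    obtain hx | ⟨e, t, ht, rfl⟩ := M.cover_mem x
    · exact Or.inl (h1 hx)
    · refine Or.inr ⟨e, ?_, t, ht, rfl⟩
      by_contra hc
      refine h2 e ?_ t ⟨ht.1.le, ht.2.le⟩ rfl
      exact ⟨fun h => hc (Or.inl h), fun h => hc (Or.inr h)⟩

/-- The chart of `Γ` at a point in the interior of an edge. -/
theorem exists_chart_interior (e : M.E) {t : ℝ} (ht : t ∈ Ioo 0 (M.len e)) :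
    ∃ ε > 0, ε ≤ t ∧ ε ≤ M.len e - t ∧
      IsStarChart (M.path e t) 2 ε ![fun s => M.path e (t + s), fun s => M.path e (t - s)] := by
  obtain ⟨ε', hε', hi⟩ := M.isometric e t ht
  set ε := min ε' (min t (M.len e - t)) with hε
  have h0 : 0 < ε := lt_min hε' (lt_min ht.1 (sub_pos.2 ht.2))
  have h1 : ε ≤ ε' := min_le_left _ _
  have h2 : ε ≤ t := (min_le_right _ _).trans (min_le_left _ _)
  have h3 : ε ≤ M.len e - t := (min_le_right _ _).trans (min_le_right _ _)
  refine ⟨ε, h0, h2, h3, h0, fun j => by fin_cases j <;> simp, ?_, ?_, ?_⟩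
  · intro j s hs s' hs'
    have := hs.1
    have := hs'.1
    have := hs.2
    have := hs'.2
    fin_cases j
    · have := hi (t + s) ⟨by linarith, by linarith⟩ (t + s') ⟨by linarith, by linarith⟩
      simpa using this
    · have := hi (t - s) ⟨by linarith, by linarith⟩ (t - s') ⟨by linarith, by linarith⟩
      simp only [Fin.mk_one, Matrix.cons_val_one, Matrix.cons_val_fin_one]
      rw [this, abs_sub_comm]
      congr 1
      ring
  · intro j j' hj s hs s' hs'
    have key : ∀ s s' : ℝ, s ∈ Ico 0 ε → s' ∈ Ico 0 ε →
        dist (M.path e (t + s)) (M.path e (t - s')) = s + s' := by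
      intro s s' hs hs'
      have := hs.1
      have := hs'.1
      have := hs.2
      have := hs'.2
      rw [hi (t + s) ⟨by linarith, by linarith⟩ (t - s') ⟨by linarith, by linarith⟩,
        abs_of_nonneg (by linarith)]
      ring
    fin_cases j <;> fin_cases j'
    · exact absurd rfl hj
    · exact key s s' hs hs'
    · have := key s' s hs' hs
      rw [dist_comm, add_comm s'] at this
      exact this
    · exact absurd rfl hj
  · convert M.isOpen_image_Ioo e (a := t - ε) (b := t + ε) (by linarith) (by linarith) using 1
    ext x
    simp only [mem_insert_iff, mem_iUnion, mem_image, Fin.exists_fin_two, Matrix.cons_val_zero,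
      Matrix.cons_val_one, Matrix.cons_val_fin_one]
    constructor
    · rintro (rfl | ⟨s, hs, rfl⟩ | ⟨s, hs, rfl⟩)
      · exact ⟨t, ⟨by linarith, by linarith⟩, rfl⟩
      · exact ⟨t + s, ⟨by linarith [hs.1], by linarith [hs.2]⟩, rfl⟩
      · exact ⟨t - s, ⟨by linarith [hs.2], by linarith [hs.1]⟩, rfl⟩
    · rintro ⟨s, hs, rfl⟩
      rcases le_total t s with h | h
      · exact Or.inr (Or.inl ⟨s - t, ⟨by linarith, by linarith [hs.2]⟩, by simp⟩)
      · exact Or.inr (Or.inr ⟨t - s, ⟨by linarith, by linarith [hs.1]⟩, by simp⟩)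

/-- A half-edge agrees near its base vertex with a ray of any chart. -/
theorem exists_ray (h : M.E × Bool) {k : ℕ} {r : ℝ} {φ : Fin k → ℝ → Γ}
    (hφ : IsStarChart (M.base h : Γ) k r φ) :
    ∃ i, ∃ ε > 0, ε ≤ M.len h.1 ∧ ε ≤ r ∧ ∀ t ∈ Ico 0 ε, M.hpath h t = φ i t := by
  obtain ⟨ρ, hρ, hρr, hb⟩ := hφ.exists_ball
  set v : Γ := (M.base h).1 with hv
  have hL := M.len_pos h.1
  have hcont := M.continuousOn_hpath h
  obtain ⟨δ, hδ, hδb⟩ := Metric.continuousOn_iff.1 hcont 0 ⟨le_rfl, hL.le⟩ ρ hρ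
  set ε := min δ (M.len h.1) with hε
  have hε0 : 0 < ε := lt_min hδ hL
  have hεL : ε ≤ M.len h.1 := min_le_right _ _
  have hsub : Ioo 0 ε ⊆ Icc 0 (M.len h.1) := fun t ht => ⟨ht.1.le, ht.2.le.trans hεL⟩
  have hcont' := hcont.mono hsub
  set s : ℝ → ℝ := fun t => dist (M.hpath h t) v with hs
  have hsρ : ∀ t ∈ Ioo 0 ε, s t < ρ := fun t ht => by
    have := hδb t (hsub ht) (by
      rw [Real.dist_eq, sub_zero, abs_of_pos ht.1]
      exact ht.2.trans_le (min_le_left _ _))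
    rwa [M.hpath_zero] at this
  have hne : ∀ t ∈ Ioo 0 ε, M.hpath h t ≠ v := fun t ht heq =>
    M.hpath_notMem h ⟨ht.1, ht.2.trans_le hεL⟩ (heq ▸ (M.base h).2)
  have hspos : ∀ t ∈ Ioo 0 ε, 0 < s t := fun t ht => dist_pos.2 (hne t ht)
  -- Outside (0, ε) the index is irrelevant, but `Fin k` must be known to be inhabited; the point at
  -- ε/2 supplies an element.
  have hray : ∀ t, ∃ i, t ∈ Ioo 0 ε → M.hpath h t = φ i (s t) := fun t => by
    by_cases ht : t ∈ Ioo 0 ε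
    · obtain h1 | ⟨i, hi⟩ := hb _ (hsρ t ht)
      · exact absurd h1 (hne t ht)
      · exact ⟨i, fun _ => hi⟩
    · obtain h1 | ⟨i, hi⟩ := hb _ (hsρ (ε / 2) ⟨by linarith, by linarith⟩)
      · exact absurd h1 (hne _ ⟨by linarith, by linarith⟩)
      · exact ⟨i, fun h => absurd h ht⟩
  choose i hi using hray
  have hsr : ∀ t ∈ Ioo 0 ε, s t ∈ Ico 0 r := fun t ht =>
    ⟨dist_nonneg, (hsρ t ht).trans_le hρr⟩
  -- Points on different rays are at distance s y + s x, but points near `hpath h x` are at distance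
  -- less than s x from it.
  have hiconst : ∀ t ∈ Ioo 0 ε, ∀ t' ∈ Ioo 0 ε, i t = i t' := by
    intro t ht t' ht'
    refine eq_of_eventually_eq isPreconnected_Ioo (fun x hx => ?_) ht ht'
    have : ∀ᶠ y in 𝓝[Ioo 0 ε] x, dist (M.hpath h y) (M.hpath h x) < s x :=
      (hcont' x hx).eventually (Metric.ball_mem_nhds _ (hspos x hx))
    filter_upwards [this, self_mem_nhdsWithin] with y hy hyI
    by_contra hne
    rw [hi y hyI, hi x hx, hφ.dist_ne _ _ hne _ (hsr y hyI) _ (hsr x hx)] at hy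
    linarith [hspos y hyI]
  set j := i (ε / 2) with hj
  have hij : ∀ t ∈ Ioo 0 ε, M.hpath h t = φ j (s t) := fun t ht => by
    rw [hi t ht, hiconst t ht (ε / 2) ⟨by linarith, by linarith⟩]
  have hscont : ContinuousOn s (Ioo 0 ε) := (continuous_id.dist continuous_const).comp_continuousOn hcont'
  have hinj : InjOn s (Ioo 0 ε) := fun t ht t' ht' htt => by
    have heq : M.hpath h t = M.hpath h t' := by rw [hij t ht, hij t' ht', htt]
    rcases M.hpath_inj h h ⟨ht.1, ht.2.trans_le hεL⟩ ⟨ht'.1, ht'.2.trans_le hεL⟩ heq with h1 | h1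
    · exact h1.2
    · have := congrArg Prod.snd h1.1
      simp [flip] at this
  have hloc : ∀ x ∈ Ioo 0 ε, ∀ᶠ y in 𝓝[Ioo 0 ε] x, |s y - s x| = |y - x| := by
    intro x hx
    obtain ⟨η, hη, hiso⟩ := M.hpath_isometric h ⟨hx.1, hx.2.trans_le hεL⟩
    have : Ioo (x - η) (x + η) ∈ 𝓝[Ioo 0 ε] x :=
      mem_nhdsWithin_of_mem_nhds (Ioo_mem_nhds (by linarith) (by linarith))
    filter_upwards [this, self_mem_nhdsWithin] with y hy hyI
    rw [← hiso y hy x ⟨by linarith, by linarith⟩, hij y hyI, hij x hx,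
      hφ.dist_same j _ (hsr y hyI) _ (hsr x hx)]
  have hlim : Tendsto s (𝓝[Ioo 0 ε] 0) (𝓝 0) := by
    have h1 : Tendsto (M.hpath h) (𝓝[Ioo 0 ε] 0) (𝓝 (M.hpath h 0)) :=
      (hcont 0 ⟨le_rfl, hL.le⟩).mono_left (nhdsWithin_mono _ hsub)
    have h2 := h1.dist (tendsto_const_nhds (x := v))
    rwa [M.hpath_zero, dist_self] at h2
  have : (𝓝[Ioo 0 ε] (0 : ℝ)).NeBot := by
    rw [← mem_closure_iff_nhdsWithin_neBot, closure_Ioo hε0.ne]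
    exact ⟨le_rfl, hε0.le⟩
  -- A continuous injective function on an interval is strictly monotone. Being locally isometric, s
  -- is t + const or −t + const; the limit 0 at t = 0 makes the constant vanish, and s > 0 excludes
  -- the second case.
  have hst : ∀ t ∈ Ioo 0 ε, s t = t := by
    intro t ht
    rcases hscont.strictMonoOn_of_injOn_Ioo hε0 hinj with hmono | hanti
    · have hc : ∀ x ∈ Ioo 0 ε, s x - x = s t - t := fun x hx => by
        refine eq_of_eventually_eq (f := fun x => s x - x) isPreconnected_Ioo (fun x hx => ?_) hx ht
        filter_upwards [hloc x hx, self_mem_nhdsWithin] with y hy hyI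
        rcases lt_trichotomy y x with hlt | rfl | hlt
        · rw [abs_of_neg (sub_neg.2 (hmono hyI hx hlt)), abs_of_neg (sub_neg.2 hlt)] at hy
          linarith
        · rfl
        · rw [abs_of_pos (sub_pos.2 (hmono hx hyI hlt)), abs_of_pos (sub_pos.2 hlt)] at hy
          linarith
      have h1 : Tendsto (fun x => s x - x) (𝓝[Ioo 0 ε] 0) (𝓝 (0 - 0)) :=
        hlim.sub (tendsto_id.mono_left nhdsWithin_le_nhds)
      have h2 : Tendsto (fun x => s x - x) (𝓝[Ioo 0 ε] 0) (𝓝 (s t - t)) :=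
        tendsto_const_nhds.congr' (by
          filter_upwards [self_mem_nhdsWithin] with x hx
          exact (hc x hx).symm)
      have := tendsto_nhds_unique h1 h2
      linarith
    · have hc : ∀ x ∈ Ioo 0 ε, s x + x = s t + t := fun x hx => by
        refine eq_of_eventually_eq (f := fun x => s x + x) isPreconnected_Ioo (fun x hx => ?_) hx ht
        filter_upwards [hloc x hx, self_mem_nhdsWithin] with y hy hyI
        rcases lt_trichotomy y x with hlt | rfl | hlt
        · rw [abs_of_pos (sub_pos.2 (hanti hyI hx hlt)), abs_of_neg (sub_neg.2 hlt)] at hy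
          linarith
        · rfl
        · rw [abs_of_neg (sub_neg.2 (hanti hx hyI hlt)), abs_of_pos (sub_pos.2 hlt)] at hy
          linarith
      have h1 : Tendsto (fun x => s x + x) (𝓝[Ioo 0 ε] 0) (𝓝 (0 + 0)) :=
        hlim.add (tendsto_id.mono_left nhdsWithin_le_nhds)
      have h2 : Tendsto (fun x => s x + x) (𝓝[Ioo 0 ε] 0) (𝓝 (s t + t)) :=
        tendsto_const_nhds.congr' (by
          filter_upwards [self_mem_nhdsWithin] with x hx
          exact (hc x hx).symm)
      have := tendsto_nhds_unique h1 h2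
      linarith [hspos t ht, ht.1]
  refine ⟨j, min ε r, lt_min hε0 hφ.pos, (min_le_left _ _).trans hεL, min_le_right _ _,
    fun t ht => ?_⟩
  rcases ht.1.eq_or_lt with h0 | h0
  · rw [← h0, M.hpath_zero, hφ.center]
  · have ht' : t ∈ Ioo 0 ε := ⟨h0, ht.2.trans_le (min_le_left _ _)⟩
    rw [hij t ht', hst t ht']

/-- The initial segments of the half-edges at a vertex form a neighbourhood of the vertex. -/
theorem halfEdges_mem_nhds (v : M.V) {δ : ℝ} (hδ : 0 < δ) :
    {x : Γ | x = v ∨ ∃ h, M.base h = v ∧ ∃ t ∈ Ioo 0 δ, t < M.len h.1 ∧ M.hpath h t = x} ∈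
      𝓝 (v : Γ) := by
  have himp : ∀ (P : Prop) (a b : ℝ), IsClosed {t : ℝ | P → a ≤ b * t} := fun P a b => by
    by_cases hP : P
    · simpa [hP] using isClosed_le continuous_const (continuous_const.mul continuous_id)
    · simp [hP]
  -- `C e` is the part of the edge at parameter distance at least δ from those of its ends that are
  -- at `v`. The factors 1 and −1 bring both conditions into the shape of `himp`.
  set C : M.E → Set ℝ := fun e => {t : ℝ | M.src e = v → δ ≤ 1 * t} ∩
    {t : ℝ | M.tgt e = v → δ - M.len e ≤ -1 * t} with hC
  have hc : IsClosed (((M.V : Set Γ) \ {v.1}) ∪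
      ⋃ e, M.path e '' (Icc 0 (M.len e) ∩ C e)) :=
    (M.V.finite_toSet.subset sdiff_subset).isClosed.union (isClosed_iUnion_of_finite fun e =>
      M.isClosed_image e ((himp _ _ _).inter (himp _ _ _)))
  refine mem_of_superset (hc.isOpen_compl.mem_nhds ?_) fun x hx => ?_
  · simp only [mem_compl_iff, mem_union, Set.mem_sdiff, mem_singleton_iff, not_true_eq_false, and_false,
      mem_iUnion, false_or, not_exists]
    rintro e ⟨t, ⟨htI, ht⟩, htv⟩
    rcases M.eq_zero_or_len htI (htv ▸ v.2) with rfl | rfl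
    · have := ht.1 (Subtype.ext htv)
      linarith
    · have := ht.2 (Subtype.ext htv)
      linarith
  · simp only [mem_compl_iff, mem_union, Set.mem_sdiff, mem_singleton_iff, SetLike.mem_coe, not_or,
      not_and, not_not, mem_iUnion, not_exists] at hx
    obtain hxV | ⟨e, t, ht, rfl⟩ := M.cover_mem x
    · exact Or.inl (hx.1 hxV)
    · refine Or.inr ?_
      have h1 : t ∉ C e := fun h => hx.2 e ⟨t, ⟨⟨ht.1.le, ht.2.le⟩, h⟩, rfl⟩
      rw [hC, mem_inter_iff, not_and_or] at h1
      rcases h1 with h1 | h1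
      · simp only [mem_ofPred_eq, Classical.not_imp, not_le] at h1
        exact ⟨(e, false), h1.1, t, ⟨ht.1, by linarith [h1.2]⟩, ht.2, rfl⟩
      · simp only [mem_ofPred_eq, Classical.not_imp, not_le] at h1
        exact ⟨(e, true), h1.1, M.len e - t, ⟨by linarith [ht.2], by linarith [h1.2]⟩,
          by simpa using ht.1, by simp [hpath]⟩

/-- The half-edges at a vertex correspond to the rays of a chart. -/
theorem exists_halfEdge_equiv (v : M.V) {k : ℕ} {r : ℝ} {φ : Fin k → ℝ → Γ}
    (hφ : IsStarChart (v : Γ) k r φ) :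
    ∃ σ : {h : M.E × Bool // M.base h = v} ≃ Fin k, ∃ δ > 0, δ ≤ r ∧
      ∀ h : {h : M.E × Bool // M.base h = v}, δ ≤ M.len h.1.1 ∧
        ∀ t ∈ Ico 0 δ, M.hpath h.1 t = φ (σ h) t := by
  have key : ∀ h : {h : M.E × Bool // M.base h = v}, ∃ i, ∃ ε > 0, ε ≤ M.len h.1.1 ∧ ε ≤ r ∧
      ∀ t ∈ Ico 0 ε, M.hpath h.1 t = φ i t := by
    rintro ⟨h, rfl⟩
    exact M.exists_ray h hφ
  choose σ ε hε hεL hεr heq using key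
  classical
  obtain ⟨δ', hδ', hle⟩ := exists_pos_le_of_finset Finset.univ ε fun i _ => hε i
  set δ := min δ' r with hδdef
  have hδ : 0 < δ := lt_min hδ' hφ.pos
  have hδr : δ ≤ r := min_le_right _ _
  have hδε : ∀ h, δ ≤ ε h := fun h => (min_le_left _ _).trans (hle h (Finset.mem_univ h))
  have heq' : ∀ h t, t ∈ Ico 0 δ → M.hpath h.1 t = φ (σ h) t := fun h t ht =>
    heq h t ⟨ht.1, ht.2.trans_le (hδε h)⟩
  have hδL : ∀ h : {h : M.E × Bool // M.base h = v}, δ ≤ M.len h.1.1 :=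
    fun h => (hδε h).trans (hεL h)
  have hinj : Function.Injective σ := by
    intro h h' hσ
    have h2 : ∀ t ∈ Ioo 0 δ, M.hpath h.1 t = M.hpath h'.1 t := fun t ht => by
      rw [heq' h t ⟨ht.1.le, ht.2⟩, heq' h' t ⟨ht.1.le, ht.2⟩, hσ]
    -- Two parameters are tested because the half-edges could be opposite halves of one edge: this
    -- would force t = len − t, which cannot hold for both δ/2 and δ/3.
    have ha : δ / 2 ∈ Ioo 0 δ := ⟨by linarith, by linarith⟩
    have hb : δ / 3 ∈ Ioo 0 δ := ⟨by linarith, by linarith⟩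
    rcases M.hpath_inj h.1 h'.1 ⟨ha.1, ha.2.trans_le (hδL h)⟩ ⟨ha.1, ha.2.trans_le (hδL h')⟩
      (h2 _ ha) with h3 | h3
    · exact Subtype.ext h3.1
    rcases M.hpath_inj h.1 h'.1 ⟨hb.1, hb.2.trans_le (hδL h)⟩ ⟨hb.1, hb.2.trans_le (hδL h')⟩
      (h2 _ hb) with h4 | h4
    · exact Subtype.ext h4.1
    · linarith [h3.2, h4.2]
  have hsurj : Function.Surjective σ := by
    intro i
    obtain ⟨η, hη, hηr, hmem⟩ := hφ.eventually_ray_mem (M.halfEdges_mem_nhds v hδ)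
    have hη2 : η / 2 ∈ Ico 0 η := ⟨by linarith, by linarith⟩
    have hd := hφ.dist_center i hη2.1 (hη2.2.trans_le hηr)
    obtain h1 | ⟨h, hbase, t, ht, -, hx⟩ := hmem i (η / 2) hη2
    · rw [h1, dist_self] at hd
      linarith
    · rw [heq' ⟨h, hbase⟩ t ⟨ht.1.le, ht.2⟩] at hx
      have := hφ.eq_iff ⟨ht.1.le, ht.2.trans_le hδr⟩ ⟨hη2.1, hη2.2.trans_le hηr⟩ hx
      exact ⟨_, this.2.resolve_right ht.1.ne'⟩
  exact ⟨Equiv.ofBijective σ ⟨hinj, hsurj⟩, δ, hδ, hδr, fun h => ⟨hδL h, heq' h⟩⟩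

/-- The vertices satisfying `P`, together with the closed edges starting at them, form a closed set,
and its complement is the corresponding set for ¬`P`. So it is clopen. -/
theorem connected_induction [ConnectedSpace Γ] {P : M.V → Prop} (v₀ : M.V) (h₀ : P v₀)
    (hP : ∀ e, P (M.src e) ↔ P (M.tgt e)) (v : M.V) : P v := by
  have hclosed : ∀ Q : M.V → Prop, IsClosed ((Subtype.val '' {v : M.V | Q v}) ∪
      ⋃ e ∈ {e | Q (M.src e)}, M.path e '' (Icc 0 (M.len e) ∩ univ)) := fun Q =>
    ((toFinite {v : M.V | Q v}).image _).isClosed.union ((toFinite _).isClosed_biUnion fun e _ =>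
      M.isClosed_image e isClosed_univ)
  set Z : (M.V → Prop) → Set Γ := fun Q => (Subtype.val '' {v : M.V | Q v}) ∪
      ⋃ e ∈ {e | Q (M.src e)}, M.path e '' (Icc 0 (M.len e) ∩ univ) with hZ
  have hvert : ∀ Q : M.V → Prop, (∀ e, Q (M.src e) ↔ Q (M.tgt e)) → ∀ v : M.V, v.1 ∈ Z Q → Q v := by
    intro Q hQ v hv
    simp only [hZ, mem_union, mem_image, mem_iUnion, inter_univ] at hv
    rcases hv with ⟨w, hw, hwv⟩ | ⟨e, he, t, ht, htv⟩
    · rwa [← Subtype.ext hwv]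
    · rcases M.eq_zero_or_len ht (htv ▸ v.2) with rfl | rfl
      · have : M.src e = v := Subtype.ext htv
        rwa [← this]
      · have : M.tgt e = v := Subtype.ext htv
        rw [← this]
        exact (hQ e).1 he
  have hcompl : (Z P)ᶜ = Z fun v => ¬ P v := by
    ext x
    obtain hx | ⟨e, t, ht, rfl⟩ := M.cover_mem x
    · have h1 : ∀ Q : M.V → Prop, (∀ e, Q (M.src e) ↔ Q (M.tgt e)) → (x ∈ Z Q ↔ Q ⟨x, hx⟩) :=
        fun Q hQ => ⟨fun h => hvert Q hQ ⟨x, hx⟩ h, fun h => Or.inl ⟨⟨x, hx⟩, h, rfl⟩⟩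
      rw [mem_compl_iff, h1 P hP, h1 _ fun e => not_congr (hP e)]
    · have h1 : ∀ Q : M.V → Prop, (M.path e t ∈ Z Q ↔ Q (M.src e)) := fun Q => by
        simp only [hZ, mem_union, mem_image, mem_iUnion, inter_univ]
        constructor
        · rintro (⟨w, hw, hwv⟩ | ⟨e', he', s, hs, hst⟩)
          · exact absurd (hwv ▸ w.2) (M.notMem e t ht)
          · have hV := M.notMem e t ht
            have hs' : s ∈ Ioo 0 (M.len e') := by
              refine ⟨hs.1.lt_of_ne ?_, hs.2.lt_of_ne ?_⟩
              · rintro rfl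
                exact hV (hst ▸ M.source_mem e')
              · rintro rfl
                exact hV (hst ▸ M.target_mem e')
            obtain ⟨rfl, -⟩ := M.inj e' e s hs' t ht hst
            exact he'
        · exact fun h => Or.inr ⟨e, h, t, ⟨ht.1.le, ht.2.le⟩, rfl⟩
      rw [mem_compl_iff, h1, h1]
  have hclopen : IsClopen (Z P) := ⟨hclosed P, by
    rw [← isClosed_compl_iff, hcompl]
    exact hclosed _⟩
  have huniv : Z P = univ := hclopen.eq_univ ⟨v₀, Or.inl ⟨v₀, h₀, rfl⟩⟩
  exact hvert P hP v (huniv ▸ mem_univ _)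

end Model

/-! ### Existence of fine simple models -/

section Existence

variable {Γ : Type u} [MetricSpace Γ]

/-- An arc on a ray of a star-shaped domain whose interior is disjoint from `V` and whose ends lie
in `V`. -/
structure IsArc {J : Type u} (V : Set Γ) (ψ : J → ℝ → Γ) (d : J → ℝ) (A : Set Γ) (j : J)
    (a b : ℝ) : Prop where
  nonneg : 0 ≤ a
  lt : a < b
  le : b ≤ d j
  left_mem : ψ j a ∈ V
  right_mem : ψ j b ∈ V
  notMem : ∀ t ∈ Ioo a b, ψ j t ∉ V
  eq : A = ψ j '' Ioo a b

/-- The connected set `A` avoids `V` and thus the ends of `A'`, so it is covered by the disjoint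
open sets `A'` and the complement of the closed arc. Since it meets `A'`, it is contained in it. -/
theorem IsArc.eq_of_mem {J : Type u} {V : Set Γ} {ψ : J → ℝ → Γ} {d : J → ℝ} {A A' : Set Γ}
    {j j' : J} {a b a' b' : ℝ}
    (hψ : ∀ j, ∀ s ∈ Icc 0 (d j), ∀ t ∈ Icc 0 (d j), dist (ψ j s) (ψ j t) = |s - t|)
    (hopen : ∀ j a b, 0 ≤ a → b ≤ d j → IsOpen (ψ j '' Ioo a b))
    (h : IsArc V ψ d A j a b) (h' : IsArc V ψ d A' j' a' b') {x : Γ} (hx : x ∈ A) (hx' : x ∈ A') :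
    A = A' := by
  have hcont : ∀ j, ContinuousOn (ψ j) (Icc 0 (d j)) := fun j s hs => by
    rw [Metric.continuousWithinAt_iff]
    exact fun ε hε => ⟨ε, hε, fun {t} ht htd => by rwa [hψ j t ht s hs]⟩
  have key : ∀ {A A' : Set Γ} {j j' : J} {a b a' b' : ℝ}, IsArc V ψ d A j a b →
      IsArc V ψ d A' j' a' b' → x ∈ A → x ∈ A' → A ⊆ A' := by
    intro A A' j j' a b a' b' h h' hx hx'
    have hsub : Ioo a b ⊆ Icc 0 (d j) := fun t ht => ⟨h.nonneg.trans ht.1.le, ht.2.le.trans h.le⟩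
    have hsub' : Icc a' b' ⊆ Icc 0 (d j') := fun t ht => ⟨h'.nonneg.trans ht.1, ht.2.trans h'.le⟩
    have hpre : _root_.IsPreconnected A := by
      rw [h.eq]
      exact isPreconnected_Ioo.image _ ((hcont j).mono hsub)
    have hcl : IsClosed ((ψ j') '' Icc a' b') :=
      (isCompact_Icc.image_of_continuousOn ((hcont j').mono hsub')).isClosed
    have hA' : IsOpen A' := h'.eq ▸ hopen j' a' b' h'.nonneg h'.le
    refine hpre.subset_left_of_subset_union hA' hcl.isOpen_compl ?_ ?_ ⟨x, hx, hx'⟩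
    · rw [h'.eq]
      exact (disjoint_compl_right.mono_left (image_mono Ioo_subset_Icc_self))
    · intro y hy
      by_cases hy' : y ∈ (ψ j') '' Icc a' b'
      · left
        obtain ⟨t, ht, rfl⟩ := hy'
        have hyV : ψ j' t ∉ V := by
          rw [h.eq] at hy
          obtain ⟨s, hs, hst⟩ := hy
          exact hst ▸ h.notMem s hs
        rw [h'.eq]
        refine ⟨t, ⟨ht.1.lt_of_ne ?_, ht.2.lt_of_ne ?_⟩, rfl⟩
        · rintro rfl
          exact hyV h'.left_mem
        · rintro rfl
          exact hyV h'.right_mem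
      · exact Or.inr hy'
  exact (key h h' hx hx').antisymm (key h' h hx' hx)

/-- Midpoints in a star-shaped domain are unique. -/
theorem IsStarChart.midpoint_unique {p : Γ} {k : ℕ} {r : ℝ} {φ : Fin k → ℝ → Γ}
    (h : IsStarChart p k r φ) {u w x y : Γ} {l : ℝ} (hl : 0 < l)
    (hmem : ∀ z ∈ ({u, w, x, y} : Set Γ), z ∈ insert p (⋃ i, φ i '' Ico 0 r))
    (huw : dist u w = l) (hux : dist u x = l / 2) (huy : dist u y = l / 2)
    (hwx : dist w x = l / 2) (hwy : dist w y = l / 2) : x = y := by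
  rcases k.eq_zero_or_pos with rfl | hk
  · have h1 := hmem x (by simp)
    have h2 := hmem y (by simp)
    simp only [iUnion_of_empty, insert_empty_eq, mem_singleton_iff] at h1 h2
    rw [h1, h2]
  have hc : ∀ z ∈ ({u, w, x, y} : Set Γ), ∃ i, ∃ t ∈ Ico 0 r, z = φ i t := by
    intro z hz
    have := hmem z hz
    simp only [mem_insert_iff, mem_iUnion, mem_image] at this
    obtain rfl | ⟨i, t, ht, rfl⟩ := this
    · exact ⟨⟨0, hk⟩, 0, ⟨le_rfl, h.pos⟩, (h.center _).symm⟩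
    · exact ⟨i, t, ht, rfl⟩
  have hd : ∀ i j s t, s ∈ Ico 0 r → t ∈ Ico 0 r →
      dist (φ i s) (φ j t) = if i = j then |s - t| else s + t := fun i j s t hs ht => by
    split_ifs with hij
    · rw [hij]
      exact h.dist_same j s hs t ht
    · exact h.dist_ne i j hij s hs t ht
  obtain ⟨i₁, s₁, h₁, rfl⟩ := hc u (by simp)
  obtain ⟨i₂, s₂, h₂, rfl⟩ := hc w (by simp)
  obtain ⟨i₃, s₃, h₃, rfl⟩ := hc x (by simp)
  obtain ⟨i₄, s₄, h₄, rfl⟩ := hc y (by simp)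
  rw [← dist_eq_zero]
  rw [hd _ _ _ _ (by assumption) (by assumption)] at huw hux huy hwx hwy ⊢
  have g₁ := h₁.1
  have g₂ := h₂.1
  have g₃ := h₃.1
  have g₄ := h₄.1
  clear hd hc hmem h₁ h₂ h₃ h₄
  -- What remains is linear arithmetic in four ray parameters, by cases on which rays coincide.
  have e1 : ∀ s t : ℝ, |s - t| = max (s - t) (t - s) := fun s t => by
    rw [abs_eq_max_neg, neg_sub]
  simp only [e1] at *
  grind

variable [MetricGraph Γ] [CompactSpace Γ]

/-- A compact metric graph has models with arbitrarily short, isometrically embedded edges and with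
prescribed vertices. -/
theorem exists_model (S : Finset Γ) {ρ : ℝ} (hρ : 0 < ρ) :
    ∃ M : Model Γ, S ⊆ M.V ∧ (∀ e, M.len e < ρ) ∧
      ∀ e, ∀ s ∈ Icc 0 (M.len e), ∀ t ∈ Icc 0 (M.len e),
        dist (M.path e s) (M.path e t) = |s - t| := by
  classical
  have hchart : ∀ p : Γ, ∃ k, ∃ φ : Fin k → ℝ → Γ, ∃ r d : ℝ, IsStarChart p k r φ ∧ 0 < d ∧ d < r ∧
      d < ρ ∧ ∀ x ∈ Metric.ball p d, x = p ∨ ∃ i, x = φ i (dist x p) := by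
    intro p
    obtain ⟨k, r, φ, h⟩ := MetricGraph.exists_chart p
    obtain ⟨ε, hε, hεr, hb⟩ := h.exists_ball
    have h0 : 0 < min ε ρ := lt_min hε hρ
    refine ⟨k, φ, r, min ε ρ / 2, h, by linarith, ?_, ?_, fun x hx => hb x ?_⟩
    · linarith [min_le_left ε ρ]
    · linarith [min_le_right ε ρ]
    · rw [Metric.mem_ball] at hx ⊢
      linarith [min_le_left ε ρ]
  choose k φ r d hφ hd hdr hdρ hb using hchart
  obtain ⟨t, -, ht⟩ := isCompact_univ.elim_nhds_subcover (fun p => Metric.ball p (d p))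
    fun p _ => Metric.ball_mem_nhds p (hd p)
  -- `J` indexes the rays of finitely many stars whose balls of radius `d` cover Γ. The vertices are
  -- the prescribed points, the centres and the points at distance `d` on the rays; these cut the
  -- rays into arcs.
  let J : Type u := Σ p : t, Fin (k p)
  let ψ : J → ℝ → Γ := fun j => φ j.1 j.2
  let dd : J → ℝ := fun j => d j.1
  have hψ : ∀ j, ∀ s ∈ Icc 0 (dd j), ∀ t ∈ Icc 0 (dd j), dist (ψ j s) (ψ j t) = |s - t| :=
    fun j s hs t ht => (hφ _).dist_same _ s ⟨hs.1, hs.2.trans_lt (hdr _)⟩ t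
      ⟨ht.1, ht.2.trans_lt (hdr _)⟩
  have hopen : ∀ j a b, 0 ≤ a → b ≤ dd j → IsOpen (ψ j '' Ioo a b) := fun j a b ha hb =>
    (hφ _).isOpen_image_Ioo _ ha (hb.trans (hdr _).le)
  have hinj : ∀ j, InjOn (ψ j) (Icc 0 (dd j)) := fun j s hs t ht hst => by
    have := hψ j s hs t ht
    rw [hst, dist_self] at this
    exact sub_eq_zero.1 (abs_eq_zero.1 this.symm)
  let V : Finset Γ := S ∪ t ∪ Finset.univ.image fun j : J => ψ j (dd j)
  have hcenter : ∀ j : J, ψ j 0 ∈ V := fun j => by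
    simp only [ψ, (hφ _).center, V, Finset.mem_union]
    exact Or.inl (Or.inr j.1.2)
  have hend : ∀ j : J, ψ j (dd j) ∈ V := fun j =>
    Finset.mem_union_right _ (Finset.mem_image_of_mem _ (Finset.mem_univ j))
  have hTfin : ∀ j, {s | s ∈ Icc 0 (dd j) ∧ ψ j s ∈ V}.Finite := fun j =>
    Finite.of_finite_image (f := ψ j) (V.finite_toSet.subset (by
      rintro _ ⟨s, hs, rfl⟩
      exact hs.2)) ((hinj j).mono fun s hs => hs.1)
  -- Arcs are recorded as subsets of Γ, so that an arc lying on several rays becomes a single edge.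
  let 𝒜 : Set (Set Γ) := {A | ∃ j a b, IsArc (V : Set Γ) ψ dd A j a b}
  have h𝒜 : 𝒜.Finite := by
    have hfin : (⋃ j : J, (fun ab : ℝ × ℝ => ψ j '' Ioo ab.1 ab.2) ''
        ({s | s ∈ Icc 0 (dd j) ∧ ψ j s ∈ V} ×ˢ {s | s ∈ Icc 0 (dd j) ∧ ψ j s ∈ V})).Finite :=
      finite_iUnion fun j => ((hTfin j).prod (hTfin j)).image _
    refine hfin.subset ?_
    rintro A ⟨j, a, b, h⟩
    refine mem_iUnion.2 ⟨j, (a, b), ⟨⟨⟨h.nonneg, h.lt.le.trans h.le⟩, h.left_mem⟩,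
      ⟨h.nonneg.trans h.lt.le, h.le⟩, h.right_mem⟩, h.eq.symm⟩
  have : Finite 𝒜 := h𝒜
  obtain ⟨N, ⟨σ⟩⟩ := Finite.exists_equiv_fin 𝒜
  choose j a b hA using fun e : Fin N => (σ.symm e).2
  have hsub : ∀ e, ∀ s ∈ Icc 0 (b e - a e), a e + s ∈ Icc 0 (dd (j e)) := fun e s hs =>
    ⟨by linarith [(hA e).nonneg, hs.1], by linarith [(hA e).le, hs.2]⟩
  have hiso : ∀ e, ∀ s ∈ Icc 0 (b e - a e), ∀ t ∈ Icc 0 (b e - a e),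
      dist (ψ (j e) (a e + s)) (ψ (j e) (a e + t)) = |s - t| := fun e s hs t ht => by
    rw [hψ _ _ (hsub e s hs) _ (hsub e t ht), add_sub_add_left_eq_sub]
  refine ⟨{
    V := V
    E := Fin N
    len := fun e => b e - a e
    len_pos := fun e => sub_pos.2 (hA e).lt
    path := fun e s => ψ (j e) (a e + s)
    continuousOn_path := ?_
    source_mem := fun e => by simpa using (hA e).left_mem
    target_mem := fun e => by simpa using (hA e).right_mem
    notMem := fun e s hs => (hA e).notMem _ ⟨by linarith [hs.1], by linarith [hs.2]⟩
    inj := ?_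
    cover := ?_
    isometric := ?_ }, fun x hx => ?_, fun e => ?_, hiso⟩
  · intro e s hs
    rw [Metric.continuousWithinAt_iff]
    exact fun ε hε => ⟨ε, hε, fun {t} ht htd => by rwa [hiso e t ht s hs]⟩
  · intro e e' s hs s' hs' heq
    have h1 : ψ (j e) (a e + s) ∈ (σ.symm e).1 := by
      rw [(hA e).eq]
      exact ⟨_, ⟨by linarith [hs.1], by linarith [hs.2]⟩, rfl⟩
    have h2 : ψ (j e) (a e + s) ∈ (σ.symm e').1 := by
      rw [(hA e').eq, heq]
      exact ⟨_, ⟨by linarith [hs'.1], by linarith [hs'.2]⟩, rfl⟩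
    have h3 := (hA e).eq_of_mem hψ hopen (hA e') h1 h2
    have h4 : e = e' := σ.symm.injective (Subtype.ext h3)
    subst h4
    have h5 := hinj _ (hsub e s ⟨hs.1.le, hs.2.le⟩) (hsub e s' ⟨hs'.1.le, hs'.2.le⟩) heq
    exact ⟨rfl, by linarith⟩
  · intro x hx
    obtain ⟨p, hp, hxp⟩ := mem_iUnion₂.1 (ht (mem_univ x))
    obtain rfl | ⟨i, hi⟩ := hb p x hxp
    · exact absurd (Finset.mem_union_left _ (Finset.mem_union_right _ hp)) hx
    let j₀ : J := ⟨⟨p, hp⟩, i⟩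
    have hxψ : x = ψ j₀ (dist x p) := hi
    set s := dist x p with hs
    have hs0 : 0 ≤ s := dist_nonneg
    have hsd : s < dd j₀ := hxp
    let T := (hTfin j₀).toFinset
    have hT : ∀ y, y ∈ T ↔ y ∈ Icc 0 (dd j₀) ∧ ψ j₀ y ∈ V := fun y => by simp [T]
    -- The nearest parameters of vertices on both sides of s bound the arc through x. They exist
    -- since the centre and the end of the ray are vertices.
    have hl : (T.filter (· ≤ s)).Nonempty := ⟨0, by
      rw [Finset.mem_filter, hT]
      exact ⟨⟨⟨le_rfl, hs0.trans hsd.le⟩, hcenter j₀⟩, hs0⟩⟩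
    have hr : (T.filter (s ≤ ·)).Nonempty := ⟨dd j₀, by
      rw [Finset.mem_filter, hT]
      exact ⟨⟨⟨hs0.trans hsd.le, le_rfl⟩, hend j₀⟩, hsd.le⟩⟩
    obtain ⟨a₀, ha₀, hamax⟩ := Finset.exists_max_image _ id hl
    obtain ⟨b₀, hb₀, hbmin⟩ := Finset.exists_min_image _ id hr
    rw [Finset.mem_filter, hT] at ha₀ hb₀
    have hsV : ψ j₀ s ∉ V := hxψ ▸ hx
    have has : a₀ < s := ha₀.2.lt_of_ne fun h => hsV (h ▸ ha₀.1.2)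
    have hsb : s < b₀ := hb₀.2.lt_of_ne fun h => hsV (h ▸ hb₀.1.2)
    have harc : IsArc (V : Set Γ) ψ dd (ψ j₀ '' Ioo a₀ b₀) j₀ a₀ b₀ := by
      refine ⟨ha₀.1.1.1, has.trans hsb, hb₀.1.1.2, ha₀.1.2, hb₀.1.2, fun y hy hyV => ?_, rfl⟩
      have hyT : y ∈ T := (hT y).2 ⟨⟨ha₀.1.1.1.trans hy.1.le, hy.2.le.trans hb₀.1.1.2⟩, hyV⟩
      rcases le_total y s with h | h
      · exact absurd hy.1 (not_lt.2 (hamax y (Finset.mem_filter.2 ⟨hyT, h⟩)))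
      · exact absurd hy.2 (not_lt.2 (hbmin y (Finset.mem_filter.2 ⟨hyT, h⟩)))
    let e := σ ⟨_, j₀, a₀, b₀, harc⟩
    have he : (σ.symm e).1 = ψ j₀ '' Ioo a₀ b₀ := by simp [e]
    have hxe : x ∈ (σ.symm e).1 := by
      rw [he, hxψ]
      exact ⟨s, ⟨has, hsb⟩, rfl⟩
    rw [(hA e).eq] at hxe
    obtain ⟨y, hy, hyx⟩ := hxe
    exact ⟨e, y - a e, ⟨by linarith [hy.1], by linarith [hy.2]⟩, by simpa using hyx⟩
  · intro e s hs
    have h1 := hs.1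
    have h2 := hs.2
    refine ⟨min s (b e - a e - s), lt_min h1 (by linarith), fun y hy z hz => ?_⟩
    have h3 := min_le_left s (b e - a e - s)
    have h4 := min_le_right s (b e - a e - s)
    exact hiso e y ⟨by linarith [hy.1], by linarith [hy.2]⟩ z
      ⟨by linarith [hz.1], by linarith [hz.2]⟩
  · exact Finset.mem_union_left _ (Finset.mem_union_left _ hx)
  · linarith [(hA e).le, (hA e).nonneg, hdρ (j e).1]

/-- Simple models exist; they can be chosen such that the star of every vertex is contained in a
member of a given open cover. -/
theorem exists_simple_model (S : Finset Γ) {ι : Type*} (U : ι → Set Γ) (hU : ∀ i, IsOpen (U i))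
    (hcov : ∀ x, ∃ i, x ∈ U i) :
    ∃ M : Model Γ, M.IsSimple ∧ S ⊆ M.V ∧ ∀ v, ∃ i, M.star v ⊆ U i := by
  obtain ⟨δ, hδ, hδU⟩ := lebesgue_number_lemma_of_metric (s := (univ : Set Γ)) isCompact_univ hU
    fun x _ => mem_iUnion.2 (hcov x)
  choose k r φ hφ using fun p : Γ => MetricGraph.exists_chart p
  -- Edges shorter than δ force stars into members of the cover. Edges shorter than ε are used for
  -- simplicity: two edges with the same ends lie with their midpoints in one star-shaped domain,
  -- where midpoints are unique, so they share an interior point.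
  obtain ⟨ε, hε, hεφ⟩ := lebesgue_number_lemma_of_metric (s := (univ : Set Γ)) isCompact_univ
    (fun p => (hφ p).isOpen) fun x _ => mem_iUnion.2 ⟨x, mem_insert _ _⟩
  obtain ⟨M, hS, hlen, hiso⟩ := exists_model S (lt_min hδ hε)
  have hd : ∀ e, dist (M.path e 0) (M.path e (M.len e)) = M.len e := fun e => by
    rw [hiso e 0 ⟨le_rfl, (M.len_pos e).le⟩ _ ⟨(M.len_pos e).le, le_rfl⟩, zero_sub, abs_neg,
      abs_of_pos (M.len_pos e)]
  refine ⟨M, ⟨fun e he => ?_, fun e e' hee => ?_⟩, hS, fun v => ?_⟩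
  · have h1 : M.path e 0 = M.path e (M.len e) := congrArg Subtype.val he
    have := hd e
    rw [h1, dist_self] at this
    exact (M.len_pos e).ne this
  · have hmid : ∀ e, M.len e / 2 ∈ Icc 0 (M.len e) := fun e =>
      ⟨by linarith [M.len_pos e], by linarith [M.len_pos e]⟩
    have hsrc : ∀ e, dist (M.src e : Γ) (M.path e (M.len e / 2)) = M.len e / 2 := fun e => by
      have := hiso e 0 ⟨le_rfl, (M.len_pos e).le⟩ _ (hmid e)
      rwa [zero_sub, abs_neg, abs_of_nonneg (hmid e).1] at this
    have htgt : ∀ e, dist (M.tgt e : Γ) (M.path e (M.len e / 2)) = M.len e / 2 := fun e => by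
      have := hiso e _ ⟨(M.len_pos e).le, le_rfl⟩ _ (hmid e)
      rw [abs_of_nonneg (by linarith [(hmid e).2])] at this
      change dist (M.path e (M.len e)) _ = _
      rw [this]
      ring
    have hst : dist (M.src e : Γ) (M.tgt e) = M.len e := hd e
    have hst' : dist (M.src e' : Γ) (M.tgt e') = M.len e' := hd e'
    have hcase : (M.src e' = M.src e ∧ M.tgt e' = M.tgt e) ∨
        (M.src e' = M.tgt e ∧ M.tgt e' = M.src e) := by
      rw [Set.pair_eq_pair_iff] at hee
      rcases hee with h | h
      · exact Or.inl ⟨h.1.symm, h.2.symm⟩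
      · exact Or.inr ⟨h.2.symm, h.1.symm⟩
    have hlen' : M.len e' = M.len e := by
      rcases hcase with ⟨h1, h2⟩ | ⟨h1, h2⟩
      · rw [← hst, ← hst', h1, h2]
      · rw [← hst, ← hst', h1, h2, dist_comm]
    have hux : dist (M.src e : Γ) (M.path e' (M.len e / 2)) = M.len e / 2 := by
      rcases hcase with ⟨h1, h2⟩ | ⟨h1, h2⟩
      · rw [← h1, ← hlen', hsrc]
      · rw [← h2, ← hlen', htgt]
    have hwx : dist (M.tgt e : Γ) (M.path e' (M.len e / 2)) = M.len e / 2 := by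
      rcases hcase with ⟨h1, h2⟩ | ⟨h1, h2⟩
      · rw [← h2, ← hlen', htgt]
      · rw [← h1, ← hlen', hsrc]
    obtain ⟨p, hp⟩ := hεφ (M.src e) (mem_univ _)
    have hle : M.len e < ε := (hlen e).trans_le (min_le_right _ _)
    have hpos := M.len_pos e
    have heq := (hφ p).midpoint_unique (M.len_pos e) (u := M.src e) (w := M.tgt e)
      (x := M.path e (M.len e / 2)) (y := M.path e' (M.len e / 2)) (by
        intro z hz
        refine hp ?_
        rw [Metric.mem_ball, dist_comm]
        simp only [mem_insert_iff, mem_singleton_iff] at hz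
        rcases hz with rfl | rfl | rfl | rfl
        · rwa [dist_self]
        · rwa [hst]
        · rw [hsrc]
          linarith
        · rw [hux]
          linarith) hst (hsrc e) hux (htgt e) hwx
    exact (M.inj e e' _ ⟨by linarith, by linarith⟩ _
      ⟨by linarith, by rw [hlen']; linarith⟩ heq).1
  · obtain ⟨i, hi⟩ := hδU v (mem_univ _)
    refine ⟨i, Subset.trans ?_ hi⟩
    rintro x (rfl | hx)
    · exact Metric.mem_ball_self hδ
    · simp only [mem_iUnion, mem_image] at hx
      obtain ⟨e, he, t, ht, rfl⟩ := hx
      have hle : M.len e < δ := (hlen e).trans_le (min_le_left _ _)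
      have htI : t ∈ Icc 0 (M.len e) := ⟨ht.1.le, ht.2.le⟩
      rcases he with rfl | rfl
      · have := hiso e t htI 0 ⟨le_rfl, (M.len_pos e).le⟩
        rw [sub_zero, abs_of_pos ht.1] at this
        exact (this.trans_lt ht.2).trans hle
      · have := hiso e t htI _ ⟨(M.len_pos e).le, le_rfl⟩
        rw [abs_sub_comm, abs_of_nonneg (by linarith [ht.2])] at this
        refine (this.trans_lt ?_).trans hle
        linarith [ht.1]

end Existence

/-! ### Piecewise linear functions on intervals -/

theorem isStarChart_real (x : ℝ) {r : ℝ} (hr : 0 < r) :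
    IsStarChart x 2 r ![fun s => x + s, fun s => x - s] where
  pos := hr
  center j := by fin_cases j <;> simp
  dist_same j s _ t _ := by
    fin_cases j
    · simp [Real.dist_eq]
    · simp only [Fin.mk_one, Matrix.cons_val_one, Matrix.cons_val_fin_one, Real.dist_eq]
      rw [abs_sub_comm]
      congr 1
      ring
  dist_ne i j hij s hs t ht := by
    have h1 := hs.1
    have h2 := ht.1
    fin_cases i <;> fin_cases j
    · exact absurd rfl hij
    · simp only [Fin.zero_eta, Matrix.cons_val_zero, Fin.mk_one, Matrix.cons_val_one,
        Matrix.cons_val_fin_one, Real.dist_eq]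
      rw [abs_of_nonneg (by linarith)]
      ring
    · simp only [Fin.zero_eta, Matrix.cons_val_zero, Fin.mk_one, Matrix.cons_val_one,
        Matrix.cons_val_fin_one, Real.dist_eq]
      rw [abs_of_nonpos (by linarith)]
      ring
    · exact absurd rfl hij
  isOpen := by
    convert isOpen_Ioo (a := x - r) (b := x + r) using 1
    ext y
    simp only [mem_insert_iff, mem_iUnion, mem_image, Fin.exists_fin_two, Matrix.cons_val_zero,
      Matrix.cons_val_one, Matrix.cons_val_fin_one]
    constructor
    · rintro (rfl | ⟨s, hs, rfl⟩ | ⟨s, hs, rfl⟩)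
      · exact ⟨by linarith, by linarith⟩
      · exact ⟨by linarith [hs.1], by linarith [hs.2]⟩
      · exact ⟨by linarith [hs.2], by linarith [hs.1]⟩
    · rintro ⟨h1, h2⟩
      rcases le_total x y with h | h
      · exact Or.inr (Or.inl ⟨y - x, ⟨by linarith, by linarith⟩, by simp⟩)
      · exact Or.inr (Or.inr ⟨x - y, ⟨by linarith, by linarith⟩, by simp⟩)

instance : MetricGraph ℝ where
  exists_chart x := ⟨2, 1, _, isStarChart_real x one_pos⟩

theorem OrdAt.of_two_slopes {Γ : Type*} [MetricSpace Γ] {F : Γ → ℝ} {p : Γ} {r : ℝ}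
    {α β : ℝ → Γ} (h : IsStarChart p 2 r ![α, β]) {m m' : ℤ} {δ : ℝ} (hδ : 0 < δ)
    (h1 : ∀ s ∈ Ico 0 δ, F (α s) = F p + m * s) (h2 : ∀ s ∈ Ico 0 δ, F (β s) = F p + m' * s) :
    OrdAt F p (m + m') := by
  have := OrdAt.of_slopes h hδ ![m, m'] (f := F) fun i s hs => by
    fin_cases i
    · exact h1 s hs
    · exact h2 s hs
  simpa using this

theorem OrdAt.exists_two_slopes {Γ : Type*} [MetricSpace Γ] {F : Γ → ℝ} {p : Γ} {r : ℝ}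
    {α β : ℝ → Γ} (h : IsStarChart p 2 r ![α, β]) {κ : ℤ} (hF : OrdAt F p κ) :
    ∃ m m' : ℤ, m + m' = κ ∧ ∃ δ > 0, δ ≤ r ∧ (∀ s ∈ Ico 0 δ, F (α s) = F p + m * s) ∧
      ∀ s ∈ Ico 0 δ, F (β s) = F p + m' * s := by
  obtain ⟨δ, hδ, hδr, m, hm, hs⟩ := hF.exists_slopes h
  exact ⟨m 0, m 1, by simpa using hs, δ, hδ, hδr, hm 0, hm 1⟩

theorem OrdAt.intCast_mul {Γ : Type*} [MetricSpace Γ] {F : Γ → ℝ} {p : Γ} {a : ℤ}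
    (h : OrdAt F p a) (n : ℤ) : OrdAt (fun x => n * F x) p (n * a) := by
  obtain ⟨k, r, φ, hφ, m, hm, rfl⟩ := h
  rw [Finset.mul_sum]
  refine OrdAt.of_slopes hφ hφ.pos _ fun i t ht => ?_
  rw [hm i t ht]
  push_cast
  ring

theorem ordAt_max_zero_sub (c x : ℝ) :
    OrdAt (fun t => max 0 (t - c)) x (if x = c then 1 else 0) := by
  rcases lt_trichotomy x c with h | rfl | h
  · rw [if_neg h.ne]
    refine (ordAt_const 0 x).congr ?_
    filter_upwards [Iio_mem_nhds h] with t ht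
    rw [max_eq_left (by linarith [mem_Iio.1 ht])]
  · rw [if_pos rfl]
    have := OrdAt.of_two_slopes (F := fun t => max 0 (t - x)) (m := 1) (m' := 0)
      (isStarChart_real x one_pos) one_pos (fun s hs => by simp [hs.1]) fun s hs => by simp [hs.1]
    simpa using this
  · rw [if_neg h.ne']
    have hpos := sub_pos.2 h
    have := OrdAt.of_two_slopes (F := fun t => max 0 (t - c)) (m := 1) (m' := -1)
      (isStarChart_real x one_pos) (δ := x - c) hpos (fun s hs => by
        rw [max_eq_right (by linarith [hs.1]), max_eq_right hpos.le]
        push_cast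
        ring) fun s hs => by
        rw [max_eq_right (by linarith [hs.2]), max_eq_right hpos.le]
        push_cast
        ring
    simpa using this

/-- A piecewise linear function with integer slopes on an open interval is the sum of an affine
function and of hinge functions at its kinks. -/
theorem exists_hinge_form {u : ℝ → ℝ} {L : ℝ} {κ : ℝ → ℤ} {S : Finset ℝ}
    (hS : ∀ t ∈ Ioo 0 L, κ t ≠ 0 → t ∈ S) (hu : ∀ t ∈ Ioo 0 L, OrdAt u t (κ t)) :
    ∃ a : ℤ, ∃ c : ℝ, ∀ t ∈ Ioo 0 L, u t = c + a * t + ∑ x ∈ S, κ x * max 0 (t - x) := by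
  classical
  by_cases hL : 0 < L
  swap
  · exact ⟨0, 0, fun t ht => absurd (ht.1.trans ht.2) hL⟩
  -- The hinge at x has order 1 at x and 0 elsewhere. Subtracting all hinges leaves a function of
  -- order 0, hence locally affine, and its slope is locally constant.
  set w : ℝ → ℝ := u - fun t => ∑ x ∈ S, κ x * max 0 (t - x) with hw
  have hw0 : ∀ t ∈ Ioo 0 L, OrdAt w t 0 := fun t ht => by
    have h1 := OrdAt.sum S fun x _ => (ordAt_max_zero_sub x t).intCast_mul (κ x)
    have h2 : ∑ x ∈ S, κ x * (if t = x then 1 else 0) = κ t := by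
      simp only [mul_ite, mul_one, mul_zero, Finset.sum_ite_eq]
      split_ifs with h
      · rfl
      · by_contra hne
        exact h (hS t ht (Ne.symm hne))
    rw [h2] at h1
    simpa using (hu t ht).sub h1
  have hloc : ∀ t, ∃ m : ℤ, t ∈ Ioo 0 L → ∃ δ > 0, ∀ s, |s - t| < δ → w s = w t + m * (s - t) := by
    intro t
    by_cases ht : t ∈ Ioo 0 L
    swap
    · exact ⟨0, fun h => absurd h ht⟩
    obtain ⟨m, m', hmm, δ, hδ, -, h1, h2⟩ := (hw0 t ht).exists_two_slopes (isStarChart_real t one_pos)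
    have hm' : m' = -m := by linarith
    refine ⟨m, fun _ => ⟨δ, hδ, fun s hs => ?_⟩⟩
    rcases le_total t s with h | h
    · rw [abs_of_nonneg (by linarith)] at hs
      have := h1 (s - t) ⟨by linarith, hs⟩
      rwa [add_sub_cancel] at this
    · rw [abs_of_nonpos (by linarith)] at hs
      have := h2 (t - s) ⟨by linarith, by linarith⟩
      rw [sub_sub_cancel, hm'] at this
      rw [this]
      push_cast
      ring
  choose m hm using hloc
  have hmid : L / 2 ∈ Ioo 0 L := ⟨by linarith, by linarith⟩
  have hmc : ∀ t ∈ Ioo 0 L, m t = m (L / 2) := fun t ht => by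
    refine eq_of_eventually_eq isPreconnected_Ioo (fun x hx => ?_) ht hmid
    obtain ⟨δ, hδ, h1⟩ := hm x hx
    have : Metric.ball x δ ∈ 𝓝[Ioo 0 L] x := mem_nhdsWithin_of_mem_nhds (Metric.ball_mem_nhds x hδ)
    filter_upwards [this, self_mem_nhdsWithin] with y hy hyI
    obtain ⟨δ', hδ', h2⟩ := hm y hyI
    rw [Metric.mem_ball, Real.dist_eq] at hy
    -- The point y + η lies in the neighbourhoods of both x and y on which w is affine, so comparing
    -- values there identifies the slopes.
    set η := min δ' (δ - |y - x|) / 2 with hη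
    have hmin : 0 < min δ' (δ - |y - x|) := lt_min hδ' (by linarith)
    have hη0 : 0 < η := by positivity
    have hηδ' : η < δ' := by linarith [min_le_left δ' (δ - |y - x|)]
    have hηδ : η < δ - |y - x| := by linarith [min_le_right δ' (δ - |y - x|)]
    have e1 := h2 (y + η) (by rw [add_sub_cancel_left, abs_of_pos hη0]; exact hηδ')
    have e2 := h1 (y + η) (by
      have : |y + η - x| ≤ |y - x| + |η| := by
        rw [show y + η - x = (y - x) + η by ring]
        exact abs_add_le _ _
      rw [abs_of_pos hη0] at this
      linarith)
    have e3 := h1 y hy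
    have e4 : (m y : ℝ) * η = m x * η := by linear_combination e2 - e1 - e3
    exact_mod_cast mul_right_cancel₀ hη0.ne' e4
  have hwc : ∀ t ∈ Ioo 0 L, w t - m (L / 2) * t = w (L / 2) - m (L / 2) * (L / 2) := fun t ht => by
    refine eq_of_eventually_eq (f := fun t => w t - m (L / 2) * t) isPreconnected_Ioo
      (fun x hx => ?_) ht hmid
    obtain ⟨δ, hδ, h1⟩ := hm x hx
    have : Metric.ball x δ ∈ 𝓝[Ioo 0 L] x := mem_nhdsWithin_of_mem_nhds (Metric.ball_mem_nhds x hδ)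
    filter_upwards [this, self_mem_nhdsWithin] with y hy hyI
    rw [h1 y hy, hmc x hx]
    ring
  refine ⟨m (L / 2), w (L / 2) - m (L / 2) * (L / 2), fun t ht => ?_⟩
  have := hwc t ht
  simp only [hw, Pi.sub_apply] at this ⊢
  linarith

/-! ### Slopes along half-edges and the degree of a divisor -/

namespace Model

variable {Γ : Type u} [MetricSpace Γ] (M : Model Γ)

/-- The half-edges at a vertex. -/
noncomputable def halfEdges (v : M.V) : Finset (M.E × Bool) :=
  open Classical in Finset.univ.filter fun h => M.base h = v

@[simp] theorem mem_halfEdges {v : M.V} {h : M.E × Bool} : h ∈ M.halfEdges v ↔ M.base h = v := by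
  simp [halfEdges]

/-- Handshake: every edge has two halves. Applied to 1, to slopes and to incidence counts, it yields
the degrees of K, of principal divisors and of moderators. -/
theorem sum_halfEdges {A : Type*} [AddCommMonoid A] (m : M.E × Bool → A) :
    ∑ v, ∑ h ∈ M.halfEdges v, m h = ∑ e, (m (e, false) + m (e, true)) := by
  classical
  have h1 : ∑ v, ∑ h ∈ M.halfEdges v, m h = ∑ h, m h := by
    simp only [halfEdges]
    convert Finset.sum_fiberwise Finset.univ M.base m
  rw [h1, Fintype.sum_prod_type]
  refine Finset.sum_congr rfl fun e _ => ?_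
  rw [Fintype.sum_bool, add_comm]

theorem valence_vertex [MetricGraph Γ] (v : M.V) : valence (v : Γ) = (M.halfEdges v).card := by
  classical
  obtain ⟨k, r, φ, h⟩ := MetricGraph.exists_chart (v : Γ)
  obtain ⟨σ, -⟩ := M.exists_halfEdge_equiv v h
  rw [h.valence_eq, halfEdges, ← Fintype.card_subtype, Fintype.card_congr σ, Fintype.card_fin]

theorem valence_interior {e : M.E} {t : ℝ} (ht : t ∈ Ioo 0 (M.len e)) :
    valence (M.path e t) = 2 := by
  obtain ⟨ε, -, -, -, h⟩ := M.exists_chart_interior e ht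
  exact h.valence_eq

theorem ordAt_interior_iff {F : Γ → ℝ} {e : M.E} {t : ℝ} (ht : t ∈ Ioo 0 (M.len e)) {κ : ℤ} :
    OrdAt F (M.path e t) κ ↔ OrdAt (fun s => F (M.path e s)) t κ := by
  obtain ⟨ε, hε, -, -, h⟩ := M.exists_chart_interior e ht
  constructor
  · intro hF
    obtain ⟨m, m', rfl, δ, hδ, -, h1, h2⟩ := hF.exists_two_slopes h
    exact OrdAt.of_two_slopes (isStarChart_real t one_pos) hδ h1 h2
  · intro hF
    obtain ⟨m, m', rfl, δ, hδ, -, h1, h2⟩ := hF.exists_two_slopes (isStarChart_real t one_pos)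
    exact OrdAt.of_two_slopes h hδ h1 h2

theorem ordAt_hpath_iff {F : Γ → ℝ} {h : M.E × Bool} {t : ℝ} (ht : t ∈ Ioo 0 (M.len h.1)) {κ : ℤ} :
    OrdAt F (M.hpath h t) κ ↔ OrdAt (fun s => F (M.hpath h s)) t κ := by
  rcases h with ⟨e, _ | _⟩
  · exact M.ordAt_interior_iff ht
  · simp only [mem_Ioo] at ht
    simp only [hpath, cond_true]
    rw [M.ordAt_interior_iff ⟨by linarith, by linarith⟩]
    constructor
    · intro hF
      obtain ⟨m, m', rfl, δ, hδ, -, h1, h2⟩ := hF.exists_two_slopes (isStarChart_real _ one_pos)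
      rw [add_comm]
      refine OrdAt.of_two_slopes (isStarChart_real t one_pos) hδ (fun s hs => ?_) fun s hs => ?_
      · rw [← h2 s hs, sub_add_eq_sub_sub]
      · rw [← h1 s hs, sub_sub_eq_add_sub, sub_add_eq_add_sub]
    · intro hF
      obtain ⟨m, m', rfl, δ, hδ, -, h1, h2⟩ := hF.exists_two_slopes (isStarChart_real _ one_pos)
      rw [add_comm]
      refine OrdAt.of_two_slopes (isStarChart_real _ one_pos) hδ (fun s hs => ?_) fun s hs => ?_
      · rw [← h2 s hs, sub_sub_eq_add_sub, sub_add_eq_add_sub]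
      · rw [← h1 s hs, sub_add_eq_sub_sub]

theorem ordAt_vertex {F : Γ → ℝ} [MetricGraph Γ] {m : M.E × Bool → ℤ} {v : M.V}
    (hm : ∀ h, M.base h = v → ∃ δ > 0, ∀ t ∈ Ico 0 δ, F (M.hpath h t) = F v + m h * t) :
    OrdAt F v (∑ h ∈ M.halfEdges v, m h) := by
  classical
  obtain ⟨k, r, φ, hφ⟩ := MetricGraph.exists_chart (v : Γ)
  obtain ⟨σ, δ, hδ, hδr, hσ⟩ := M.exists_halfEdge_equiv v hφ
  choose δ' hδ' hm' using fun h : {h // M.base h = v} => hm h.1 h.2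
  obtain ⟨ε, hε, hle⟩ := exists_pos_le_of_finset Finset.univ δ' fun i _ => hδ' i
  have hsum : ∑ h ∈ M.halfEdges v, m h = ∑ i, m (σ.symm i).1 := by
    rw [halfEdges, Finset.sum_filter, ← Finset.sum_filter, ← Finset.sum_subtype_eq_sum_filter,
      Finset.subtype_univ]
    exact (σ.symm.sum_comp fun h => m h.1).symm
  rw [hsum]
  refine OrdAt.of_slopes hφ (lt_min hδ hε) _ fun i t ht => ?_
  have h1 := (hσ (σ.symm i)).2 t ⟨ht.1, ht.2.trans_le (min_le_left _ _)⟩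
  rw [Equiv.apply_symm_apply] at h1
  rw [← h1]
  exact hm' _ t ⟨ht.1, ht.2.trans_le ((min_le_right _ _).trans (hle _ (Finset.mem_univ _)))⟩

theorem exists_vertex_slopes {F : Γ → ℝ} [MetricGraph Γ] {v : M.V} {κ : ℤ} (hF : OrdAt F v κ) :
    ∃ m : M.E × Bool → ℤ, ∑ h ∈ M.halfEdges v, m h = κ ∧
      ∀ h, M.base h = v → ∃ δ > 0, ∀ t ∈ Ico 0 δ, F (M.hpath h t) = F v + m h * t := by
  classical
  obtain ⟨k, r, φ, hφ⟩ := MetricGraph.exists_chart (v : Γ)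
  obtain ⟨σ, δ, hδ, hδr, hσ⟩ := M.exists_halfEdge_equiv v hφ
  obtain ⟨ε, hε, hεr, n, hn, rfl⟩ := hF.exists_slopes hφ
  refine ⟨fun h => if hh : M.base h = v then n (σ ⟨h, hh⟩) else 0, ?_, fun h hh => ?_⟩
  · rw [halfEdges, Finset.sum_filter, ← Finset.sum_filter, ← Finset.sum_subtype_eq_sum_filter,
      Finset.subtype_univ, ← σ.sum_comp n]
    exact Finset.sum_congr rfl fun h _ => dif_pos h.2
  · refine ⟨min δ ε, lt_min hδ hε, fun t ht => ?_⟩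
    simp only [dif_pos hh]
    rw [(hσ ⟨h, hh⟩).2 t ⟨ht.1, ht.2.trans_le (min_le_left _ _)⟩]
    exact hn _ t ⟨ht.1, ht.2.trans_le (min_le_right _ _)⟩

theorem injOn_hpath (h : M.E × Bool) : InjOn (M.hpath h) (Ioo 0 (M.len h.1)) := by
  intro t ht t' ht' heq
  rcases M.hpath_inj h h ht ht' heq with h1 | h1
  · exact h1.2
  · have := congrArg Prod.snd h1.1
    simp [flip] at this

theorem finite_kinks (D : Γ →₀ ℤ) (h : M.E × Bool) :
    {t | t ∈ Ioo 0 (M.len h.1) ∧ D (M.hpath h t) ≠ 0}.Finite :=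
  Finite.of_finite_image (f := M.hpath h) (D.support.finite_toSet.subset (by
    rintro _ ⟨t, ht, rfl⟩
    simpa using ht.2)) ((M.injOn_hpath h).mono fun t ht => ht.1)

/-- The parameters of the points of the support of `D` in the interior of a half-edge. -/
noncomputable def kinks (D : Γ →₀ ℤ) (h : M.E × Bool) : Finset ℝ := (M.finite_kinks D h).toFinset

theorem mem_kinks {D : Γ →₀ ℤ} {h : M.E × Bool} {t : ℝ} :
    t ∈ M.kinks D h ↔ t ∈ Ioo 0 (M.len h.1) ∧ D (M.hpath h t) ≠ 0 := by simp [kinks]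

theorem sum_kinks_flip (D : Γ →₀ ℤ) (h : M.E × Bool) {A : Type*} [AddCommMonoid A] (g : ℝ → A) :
    ∑ x ∈ M.kinks D (M.flip h), g (M.len h.1 - x) = ∑ x ∈ M.kinks D h, g x := by
  refine Finset.sum_nbij' (fun x => M.len h.1 - x) (fun x => M.len h.1 - x) ?_ ?_ ?_ ?_ ?_
  · intro x hx
    rw [mem_kinks, hpath_flip, flip_fst] at hx
    rw [mem_kinks]
    exact ⟨⟨by linarith [hx.1.2], by linarith [hx.1.1]⟩, hx.2⟩
  · intro x hx
    rw [mem_kinks] at hx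
    rw [mem_kinks, hpath_flip, sub_sub_cancel]
    exact ⟨⟨by linarith [hx.1.2], by rw [flip_fst]; linarith [hx.1.1]⟩, hx.2⟩
  · simp
  · simp
  · simp

theorem divDegree_eq (D : Γ →₀ ℤ) : divDegree D =
    ∑ v : M.V, D v + ∑ e, ∑ t ∈ M.kinks D (e, false), D (M.path e t) := by
  classical
  rw [divDegree, Finsupp.sum, ← Finset.sum_filter_add_sum_filter_not D.support (· ∈ M.V)]
  congr 1
  · rw [Finset.sum_coe_sort M.V (fun x => D x)]
    refine Finset.sum_subset (fun x hx => (Finset.mem_filter.1 hx).2) fun x hx hx' => ?_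
    by_contra hne
    exact hx' (Finset.mem_filter.2 ⟨Finsupp.mem_support_iff.2 hne, hx⟩)
  · rw [Finset.sum_sigma']
    symm
    refine Finset.sum_nbij (fun y : Σ _ : M.E, ℝ => M.path y.1 y.2) ?_ ?_ ?_ fun _ _ => rfl
    · rintro ⟨e, t⟩ h
      simp only [Finset.mem_sigma, Finset.mem_univ, true_and, mem_kinks, hpath_false] at h
      simpa using ⟨h.2, M.notMem e t h.1⟩
    · rintro ⟨e, t⟩ h ⟨e', t'⟩ h' heq
      simp only [Finset.coe_sigma, mem_sigma_iff, SetLike.mem_coe, Finset.mem_univ, true_and,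
        mem_kinks, hpath_false] at h h'
      obtain ⟨rfl, rfl⟩ := M.inj e e' t h.1 t' h'.1 heq
      rfl
    · intro x hx
      simp only [Finset.coe_filter, mem_ofPred_eq, Finsupp.mem_support_iff] at hx
      obtain ⟨e, t, ht, rfl⟩ := M.cover x hx.2
      exact ⟨⟨e, t⟩, by simpa [mem_kinks] using ⟨ht, hx.1⟩, rfl⟩

/-- A piecewise linear function on a half-edge, in terms of its initial slope and its kinks. -/
theorem hpath_form {F : Γ → ℝ} {D : Γ →₀ ℤ} {h : M.E × Bool} {m : ℤ} {δ : ℝ} (hδ : 0 < δ)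
    (hm : ∀ t ∈ Ico 0 δ, F (M.hpath h t) = F (M.base h) + m * t)
    (hF : ∀ t ∈ Ioo 0 (M.len h.1), OrdAt F (M.hpath h t) (D (M.hpath h t))) :
    ∀ t ∈ Ico 0 (M.len h.1), F (M.hpath h t) =
      F (M.base h) + m * t + ∑ x ∈ M.kinks D h, D (M.hpath h x) * max 0 (t - x) := by
  have hL := M.len_pos h.1
  obtain ⟨a, c, hac⟩ := exists_hinge_form (u := fun t => F (M.hpath h t)) (L := M.len h.1)
    (κ := fun t => D (M.hpath h t)) (S := M.kinks D h) (fun t ht hne => M.mem_kinks.2 ⟨ht, hne⟩)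
    fun t ht => (M.ordAt_hpath_iff ht).1 (hF t ht)
  obtain ⟨ε, hε, hle⟩ := exists_pos_le_of_finset (M.kinks D h) id fun x hx =>
    (M.mem_kinks.1 hx).1.1
  have hsmall : ∀ t, 0 < t → t < δ → t < ε → t < M.len h.1 → c + a * t = F (M.base h) + m * t := by
    intro t h0 h1 h2 h3
    rw [← hm t ⟨h0.le, h1⟩]
    have e := hac t ⟨h0, h3⟩
    have e0 : ∑ x ∈ M.kinks D h, (D (M.hpath h x) : ℝ) * max 0 (t - x) = 0 :=
      Finset.sum_eq_zero fun x hx => by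
        rw [max_eq_left (by have := hle x hx; simp only [id] at this; linarith), mul_zero]
    rw [e0, add_zero] at e
    exact e.symm
  set η := min δ (min ε (M.len h.1)) with hη
  have hη0 : 0 < η := lt_min hδ (lt_min hε hL)
  have hη1 : η ≤ δ := min_le_left _ _
  have hη2 : η ≤ ε := (min_le_right _ _).trans (min_le_left _ _)
  have hη3 : η ≤ M.len h.1 := (min_le_right _ _).trans (min_le_right _ _)
  -- Below the first kink two affine functions agree; two sample points identify slope and
  -- intercept.
  have e1 := hsmall (η / 2) (by linarith) (by linarith) (by linarith) (by linarith)
  have e2 := hsmall (η / 3) (by linarith) (by linarith) (by linarith) (by linarith)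
  have ham : (a : ℝ) = m := by
    have h1 : ((a : ℝ) - m) * (η / 6) = 0 := by linear_combination e1 - e2
    have := (mul_eq_zero.1 h1).resolve_right (by positivity)
    linarith
  have hc : c = F (M.base h) := by rw [ham] at e1; linarith
  intro t ht
  rcases ht.1.eq_or_lt with h0 | h0
  · rw [← h0, M.hpath_zero]
    rw [Finset.sum_eq_zero fun x hx => ?_]
    · simp
    · rw [max_eq_left (by linarith [(M.mem_kinks.1 hx).1.1]), mul_zero]
  · rw [hac t ⟨h0, ht.2⟩, ham, hc]

/-- Two piecewise linear functions along an edge with the same kinks, seen from the two ends. -/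
theorem slope_add_slope {F G : Γ → ℝ} {D : Γ →₀ ℤ} {h : M.E × Bool} {m m' : ℤ} {c c' k : ℝ}
    (hF : ∀ t ∈ Ico 0 (M.len h.1), F (M.hpath h t) =
      c + m * t + ∑ x ∈ M.kinks D h, D (M.hpath h x) * max 0 (t - x))
    (hG : ∀ t ∈ Ico 0 (M.len h.1), G (M.hpath (M.flip h) t) =
      c' + m' * t + ∑ x ∈ M.kinks D (M.flip h), D (M.hpath (M.flip h) x) * max 0 (t - x))
    (hk : ∀ t ∈ Ioo 0 (M.len h.1), ∀ t' ∈ Ioo 0 (M.len h.1),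
      F (M.hpath h t') - G (M.hpath h t') - (F (M.hpath h t) - G (M.hpath h t)) = k * (t' - t)) :
    k = m + m' + ∑ x ∈ M.kinks D h, (D (M.hpath h x) : ℝ) ∧
    ∀ t ∈ Ioo 0 (M.len h.1), F (M.hpath h t) - G (M.hpath h t) =
      c - c' - m' * M.len h.1 - ∑ x ∈ M.kinks D h, (D (M.hpath h x) : ℝ) * x + k * t := by
  have hL := M.len_pos h.1
  have hdiff : ∀ t ∈ Ioo 0 (M.len h.1), F (M.hpath h t) - G (M.hpath h t) =
      c - c' - m' * M.len h.1 - ∑ x ∈ M.kinks D h, (D (M.hpath h x) : ℝ) * x +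
        (m + m' + ∑ x ∈ M.kinks D h, (D (M.hpath h x) : ℝ)) * t := by
    intro t ht
    have h1 := hF t ⟨ht.1.le, ht.2⟩
    have h2 := hG (M.len h.1 - t) ⟨by linarith [ht.2], by linarith [ht.1]⟩
    rw [hpath_flip, sub_sub_cancel] at h2
    have h3 : ∑ x ∈ M.kinks D (M.flip h), (D (M.hpath (M.flip h) x) : ℝ) *
        max 0 (M.len h.1 - t - x) = ∑ x ∈ M.kinks D h, (D (M.hpath h x) : ℝ) * max 0 (x - t) := by
      rw [← M.sum_kinks_flip D h]
      refine Finset.sum_congr rfl fun x _ => ?_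
      rw [hpath_flip]
      congr 2
      ring
    -- Termwise this is max(0, t − x) = max(0, x − t) + (t − x): hinges seen from one end differ
    -- from those seen from the other by an affine function.
    have h4 : ∑ x ∈ M.kinks D h, (D (M.hpath h x) : ℝ) * max 0 (t - x) =
        ∑ x ∈ M.kinks D h, (D (M.hpath h x) : ℝ) * max 0 (x - t) +
          (∑ x ∈ M.kinks D h, (D (M.hpath h x) : ℝ)) * t -
          ∑ x ∈ M.kinks D h, (D (M.hpath h x) : ℝ) * x := by
      rw [Finset.sum_mul, ← Finset.sum_add_distrib, ← Finset.sum_sub_distrib]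
      refine Finset.sum_congr rfl fun x _ => ?_
      rcases le_total t x with h | h
      · rw [max_eq_left (by linarith), max_eq_right (by linarith)]
        ring
      · rw [max_eq_right (by linarith), max_eq_left (by linarith)]
        ring
    rw [h1, h2, h3, h4]
    ring
  have hk' : k = m + m' + ∑ x ∈ M.kinks D h, (D (M.hpath h x) : ℝ) := by
    have ha : M.len h.1 / 3 ∈ Ioo 0 (M.len h.1) := ⟨by linarith, by linarith⟩
    have hb : M.len h.1 / 2 ∈ Ioo 0 (M.len h.1) := ⟨by linarith, by linarith⟩
    have := hk _ ha _ hb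
    rw [hdiff _ ha, hdiff _ hb] at this
    have h5 : (k - (m + m' + ∑ x ∈ M.kinks D h, (D (M.hpath h x) : ℝ))) *
        (M.len h.1 / 2 - M.len h.1 / 3) = 0 := by linear_combination -this
    have := (mul_eq_zero.1 h5).resolve_right (by linarith)
    linarith
  exact ⟨hk', fun t ht => by rw [hdiff t ht, hk']⟩

/-- The degree of a divisor in terms of local trivializations over the stars of a model. -/
theorem sum_slopes_eq_divDegree [MetricGraph Γ] {D : Γ →₀ ℤ} {Φ : M.V → Γ → ℝ}
    (hΦ : ∀ v, ∀ p ∈ M.star v, OrdAt (Φ v) p (D p)) {k : M.E → ℤ}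
    (hk : ∀ e, ∀ t ∈ Ioo 0 (M.len e), ∀ t' ∈ Ioo 0 (M.len e),
      Φ (M.src e) (M.path e t') - Φ (M.tgt e) (M.path e t') -
        (Φ (M.src e) (M.path e t) - Φ (M.tgt e) (M.path e t)) = k e * (t' - t)) :
    ∑ e, k e = divDegree D := by
  choose m hm hms using fun v => M.exists_vertex_slopes (hΦ v v (Or.inl rfl))
  have hform : ∀ h : M.E × Bool, ∀ t ∈ Ico 0 (M.len h.1), Φ (M.base h) (M.hpath h t) =
      Φ (M.base h) (M.base h) + m (M.base h) h * t +
        ∑ x ∈ M.kinks D h, D (M.hpath h x) * max 0 (t - x) := by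
    intro h
    obtain ⟨δ, hδ, h1⟩ := hms (M.base h) h rfl
    refine M.hpath_form hδ h1 fun t ht => hΦ _ _ (Or.inr ?_)
    simp only [mem_iUnion]
    refine ⟨h.1, ?_, ?_⟩
    · rcases h with ⟨e, _ | _⟩
      · exact Or.inl rfl
      · exact Or.inr rfl
    · rcases h with ⟨e, _ | _⟩
      · exact ⟨t, ht, rfl⟩
      · exact ⟨M.len e - t, ⟨by simpa using ht.2, by simpa using ht.1⟩, rfl⟩
  have hk' : ∀ e, k e = m (M.src e) (e, false) + m (M.tgt e) (e, true) +
      ∑ x ∈ M.kinks D (e, false), D (M.path e x) := fun e => by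
    have := (M.slope_add_slope (h := (e, false)) (G := Φ (M.tgt e)) (hform (e, false))
      (hform (e, true)) (hk e)).1
    exact_mod_cast this
  -- The kinks account for D in the interiors of the edges; by the handshake the initial slopes,
  -- collected at each vertex, account for D at the vertices.
  rw [M.divDegree_eq, Finset.sum_congr rfl fun e _ => hk' e, Finset.sum_add_distrib]
  congr 1
  have h1 := M.sum_halfEdges fun h => m (M.base h) h
  simp only [base_false, base_true] at h1
  rw [← h1]
  refine Finset.sum_congr rfl fun v _ => ?_
  rw [← hm v]
  exact Finset.sum_congr rfl fun h hh => by rw [M.mem_halfEdges.1 hh]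

/-- The divisor of a function has degree `0`. -/
theorem divDegree_eq_zero (M : Model Γ) [MetricGraph Γ] {D : Γ →₀ ℤ} {F : Γ → ℝ} (hF : ∀ p, OrdAt F p (D p)) :
    divDegree D = 0 := by
  rw [← M.sum_slopes_eq_divDegree (Φ := fun _ => F) (k := 0) (fun _ p _ => hF p)
    fun e t _ t' _ => by simp]
  simp

/-- The restriction to the edges of a function with divisor `D`. -/
theorem exists_edge_slopes [MetricGraph Γ] {D : Γ →₀ ℤ} {F : Γ → ℝ} (hF : ∀ p, OrdAt F p (D p)) :
    ∃ m : M.E × Bool → ℤ, (∀ v, ∑ h ∈ M.halfEdges v, m h = D v) ∧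
      (∀ h, m h + m (M.flip h) = -∑ x ∈ M.kinks D h, D (M.hpath h x)) ∧
      ∀ h, ∀ t ∈ Icc 0 (M.len h.1), F (M.hpath h t) =
        F (M.base h) + m h * t + ∑ x ∈ M.kinks D h, D (M.hpath h x) * max 0 (t - x) := by
  choose m hm hms using fun v : M.V => M.exists_vertex_slopes (hF v)
  have hform : ∀ h : M.E × Bool, ∀ t ∈ Ico 0 (M.len h.1), F (M.hpath h t) =
      F (M.base h) + m (M.base h) h * t +
        ∑ x ∈ M.kinks D h, D (M.hpath h x) * max 0 (t - x) := by
    intro h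
    obtain ⟨δ, hδ, h1⟩ := hms (M.base h) h rfl
    exact M.hpath_form hδ h1 fun t _ => hF _
  -- The same function is described from both ends, so the difference has slope 0.
  have hpair := fun h : M.E × Bool => M.slope_add_slope (h := h) (k := 0) (hform h)
    (hform (M.flip h)) fun t _ t' _ => by simp
  have hadd : ∀ h, m (M.base h) h + m (M.base (M.flip h)) (M.flip h) =
      -∑ x ∈ M.kinks D h, D (M.hpath h x) := fun h => by
    have := (hpair h).1
    have h2 : (0 : ℤ) = m (M.base h) h + m (M.base (M.flip h)) (M.flip h) +
        ∑ x ∈ M.kinks D h, D (M.hpath h x) := by exact_mod_cast this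
    linarith
  refine ⟨fun h => m (M.base h) h, fun v => ?_, hadd, fun h t ht => ?_⟩
  · rw [← hm v]
    exact Finset.sum_congr rfl fun h hh => by simp only [M.mem_halfEdges.1 hh]
  · rcases ht.2.lt_or_eq with hlt | rfl
    · exact hform h t ⟨ht.1, hlt⟩
    · have hL := M.len_pos h.1
      -- The value at the far end is the constant term of the description from that end; comparing
      -- the two descriptions at the midpoint determines it.
      have h1 := (hpair h).2 (M.len h.1 / 2) ⟨by linarith, by linarith⟩
      have h2 : (m (M.base h) h : ℝ) + m (M.base (M.flip h)) (M.flip h) =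
          -∑ x ∈ M.kinks D h, (D (M.hpath h x) : ℝ) := by exact_mod_cast hadd h
      have h3 : ∑ x ∈ M.kinks D h, (D (M.hpath h x) : ℝ) * max 0 (M.len h.1 - x) =
          (∑ x ∈ M.kinks D h, (D (M.hpath h x) : ℝ)) * M.len h.1 -
            ∑ x ∈ M.kinks D h, (D (M.hpath h x) : ℝ) * x := by
        rw [Finset.sum_mul, ← Finset.sum_sub_distrib]
        refine Finset.sum_congr rfl fun x hx => ?_
        rw [max_eq_right (by linarith [(M.mem_kinks.1 hx).1.2])]
        ring
      rw [h3, hpath_len]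
      rw [sub_self, zero_mul, add_zero] at h1
      linear_combination h1 - M.len h.1 * h2

/-- Gluing a function from functions on the edges. -/
theorem exists_glue (c : M.V → ℝ) (w : M.E → ℝ → ℝ) (h0 : ∀ e, w e 0 = c (M.src e))
    (h1 : ∀ e, w e (M.len e) = c (M.tgt e)) :
    ∃ F : Γ → ℝ, (∀ v : M.V, F v = c v) ∧ ∀ e, ∀ t ∈ Icc 0 (M.len e), F (M.path e t) = w e t := by
  classical
  choose e t ht hx using M.cover
  let F : Γ → ℝ := fun x => if hxV : x ∈ M.V then c ⟨x, hxV⟩ else w (e x hxV) (t x hxV)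
  have hV : ∀ v : M.V, F v = c v := fun v => dif_pos v.2
  refine ⟨F, hV, fun e' s hs => ?_⟩
  by_cases hs0 : s ∈ Ioo 0 (M.len e')
  · have hn := M.notMem e' s hs0
    simp only [F, dif_neg hn]
    obtain ⟨h2, h3⟩ := M.inj _ _ _ (ht _ hn) _ hs0 (hx _ hn)
    rw [h2, h3]
  · rcases hs.1.eq_or_lt with h | h
    · rw [← h, h0]
      exact hV (M.src e')
    · have : s = M.len e' := by
        by_contra hne
        exact hs0 ⟨h, hs.2.lt_of_ne hne⟩
      rw [this, h1]
      exact hV (M.tgt e')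

theorem ordAt_of_edge {F : Γ → ℝ} {w : ℝ → ℝ} {e : M.E}
    (hF : ∀ t ∈ Icc 0 (M.len e), F (M.path e t) = w t) {t : ℝ} (ht : t ∈ Ioo 0 (M.len e)) {κ : ℤ}
    (hw : OrdAt w t κ) : OrdAt F (M.path e t) κ := by
  rw [M.ordAt_interior_iff ht]
  refine hw.congr ?_
  filter_upwards [Ioo_mem_nhds ht.1 ht.2] with s hs
  exact (hF s ⟨hs.1.le, hs.2.le⟩).symm

theorem divDegree_of_support {D : Γ →₀ ℤ} (h : ∀ x ∉ M.V, D x = 0) :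
    divDegree D = ∑ v : M.V, D v := by
  rw [M.divDegree_eq, add_eq_left]
  refine Finset.sum_eq_zero fun e _ => Finset.sum_eq_zero fun t ht => h _ ?_
  exact M.notMem e t (M.mem_kinks.1 ht).1

/-- A function with divisor `κ` that is nonnegative away from the vertices is convex on the
edges. -/
theorem le_of_edge_form {F : Γ → ℝ} {κ : Γ →₀ ℤ} {m : M.E × Bool → ℤ} {h : M.E × Bool}
    (hκ : ∀ x ∉ M.V, 0 ≤ κ x)
    (hm : ∀ t ∈ Icc 0 (M.len h.1), F (M.hpath h t) =
        F (M.base h) + m h * t + ∑ x ∈ M.kinks κ h, κ (M.hpath h x) * max 0 (t - x))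
    {t : ℝ} (ht : t ∈ Icc 0 (M.len h.1)) : F (M.base h) + m h * t ≤ F (M.hpath h t) := by
  rw [hm t ht]
  refine le_add_of_nonneg_right (Finset.sum_nonneg fun x hx => mul_nonneg ?_ (le_max_left _ _))
  exact_mod_cast hκ _ (M.hpath_notMem h (M.mem_kinks.1 hx).1)

end Model

/-! ### Linear equivalence, moderators and the canonical divisor -/

section LinearEquivalence

variable {Γ : Type u}

theorem divDegree_add (D D' : Γ →₀ ℤ) : divDegree (D + D') = divDegree D + divDegree D' :=
  Finsupp.sum_add_index' (fun _ => rfl) fun _ _ _ => rfl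

theorem divDegree_neg (D : Γ →₀ ℤ) : divDegree (-D) = -divDegree D := by
  have := divDegree_add D (-D)
  rw [add_neg_cancel] at this
  have h0 : divDegree (0 : Γ →₀ ℤ) = 0 := rfl
  linarith

theorem divDegree_sub (D D' : Γ →₀ ℤ) : divDegree (D - D') = divDegree D - divDegree D' := by
  rw [sub_eq_add_neg, divDegree_add, divDegree_neg, sub_eq_add_neg]

theorem divDegree_single (p : Γ) (a : ℤ) : divDegree (Finsupp.single p a) = a :=
  Finsupp.sum_single_index rfl

theorem divDegree_nonneg {D : Γ →₀ ℤ} (h : 0 ≤ D) : 0 ≤ divDegree D :=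
  Finset.sum_nonneg fun p _ => h p

theorem eq_zero_of_divDegree_eq_zero {D : Γ →₀ ℤ} (h : 0 ≤ D) (h0 : divDegree D = 0) : D = 0 := by
  ext p
  by_contra hp
  have := (Finset.sum_eq_zero_iff_of_nonneg fun p _ => h p).1 h0 p (Finsupp.mem_support_iff.2 hp)
  exact hp this

variable [MetricSpace Γ]

/-- Where two ordered functions touch, the slopes are ordered on every ray. Against a constant this
is the maximum principle. -/
theorem OrdAt.mono {F G : Γ → ℝ} {p : Γ} {a b : ℤ} (hF : OrdAt F p a) (hG : OrdAt G p b)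
    (hle : ∀ x, F x ≤ G x) (hp : F p = G p) : a ≤ b := by
  obtain ⟨k, r, φ, h, m, hm, rfl⟩ := hF
  obtain ⟨δ, hδ, hδr, m', hm', rfl⟩ := hG.exists_slopes h
  refine Finset.sum_le_sum fun i _ => ?_
  have h1 := hle (φ i (δ / 2))
  rw [hm i _ ⟨by linarith, by linarith⟩, hm' i _ ⟨by linarith, by linarith⟩, hp] at h1
  have h2 : (m i : ℝ) ≤ m' i := le_of_mul_le_mul_right (by linarith : (m i : ℝ) * (δ / 2) ≤ _)
    (by linarith : (0 : ℝ) < δ / 2)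
  exact_mod_cast h2

theorem exists_divisor [CompactSpace Γ] {F : Γ → ℝ} (h : ∀ p, ∃ a, OrdAt F p a) :
    ∃ κ : Γ →₀ ℤ, ∀ p, OrdAt F p (κ p) := by
  choose κ hκ using h
  have hfin : κ.support.Finite := finite_support_of_eventually fun p => by
    filter_upwards [(hκ p).eventually_zero] with y hy
    exact (hκ y).unique hy
  exact ⟨Finsupp.ofSupportFinite κ hfin, hκ⟩

variable [MetricGraph Γ]

theorem linEquiv_iff {D D' : Γ →₀ ℤ} :
    LinEquiv D D' ↔ ∃ F : Γ → ℝ, ∀ p, OrdAt F p (D p - D' p) := by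
  constructor
  · rintro ⟨f, hf⟩
    exact ⟨fun x => f ⟨x, trivial⟩, fun p => (hf ⟨p, trivial⟩).ordAt fun _ => rfl⟩
  · rintro ⟨F, hF⟩
    exact ⟨fun x => F x, fun p => (hF p).hasOrd fun _ => rfl⟩

theorem LinEquiv.symm {D D' : Γ →₀ ℤ} (h : LinEquiv D D') : LinEquiv D' D := by
  obtain ⟨F, hF⟩ := linEquiv_iff.1 h
  exact linEquiv_iff.2 ⟨-F, fun p => by simpa using (hF p).neg⟩

theorem LinEquiv.trans {D D' D'' : Γ →₀ ℤ} (h : LinEquiv D D') (h' : LinEquiv D' D'') :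
    LinEquiv D D'' := by
  obtain ⟨F, hF⟩ := linEquiv_iff.1 h
  obtain ⟨G, hG⟩ := linEquiv_iff.1 h'
  exact linEquiv_iff.2 ⟨F + G, fun p => by simpa using (hF p).add (hG p)⟩

theorem LinEquiv.congr {D D' A A' : Γ →₀ ℤ} (h : LinEquiv D D') (hA : A - A' = D - D') :
    LinEquiv A A' := by
  obtain ⟨F, hF⟩ := linEquiv_iff.1 h
  refine linEquiv_iff.2 ⟨F, fun p => ?_⟩
  have := DFunLike.congr_fun hA p
  simp only [Finsupp.coe_sub, Pi.sub_apply] at this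
  rw [this]
  exact hF p

/-! ### Divisors of acyclic orientations -/

open Classical in
/-- The divisor `∑ (indeg(v) - 1) v` of the acyclic orientation of a model in which edges are
directed towards the end with the larger value of an injective function on the vertices. -/
def IsModerator (ν : Γ →₀ ℤ) : Prop :=
  ∃ (M : Model Γ) (ρ : M.V → ℤ), (∀ e, ρ (M.src e) ≠ ρ (M.tgt e)) ∧ (∀ x ∉ M.V, ν x = 0) ∧
    ∀ v : M.V, ν v = ((M.halfEdges v).filter fun h => ρ (M.base (M.flip h)) < ρ v).card - 1

/-- Suppose div F = D − ν with D effective. Then F is convex on edges. Among the vertices where F is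
largest, let v have minimal ρ. No slope at v is positive, and along incoming edges the neighbour has
smaller ρ, so F is strictly smaller there and the integral slope is at most −1. Thus D(v) − ν(v) ≤
−indeg(v), that is D(v) ≤ −1. -/
theorem IsModerator.linearSystem_eq_empty [Nonempty Γ] {ν : Γ →₀ ℤ} (h : IsModerator ν) :
    linearSystem ν = ∅ := by
  classical
  obtain ⟨M, ρ, hρ, h0, hν⟩ := h
  refine eq_empty_of_forall_notMem fun D ⟨hD, hlin⟩ => ?_
  obtain ⟨F, hF⟩ := linEquiv_iff.1 hlin.symm
  have hF' : ∀ p, OrdAt F p ((D - ν) p) := hF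
  obtain ⟨m, hmv, -, hm⟩ := M.exists_edge_slopes hF'
  have hκ : ∀ x ∉ M.V, 0 ≤ (D - ν) x := fun x hx => by
    simpa [h0 x hx] using hD x
  have hVne : Nonempty M.V := by
    obtain ⟨x⟩ := ‹Nonempty Γ›
    obtain hx | ⟨e, -⟩ := M.cover_mem x
    · exact ⟨⟨x, hx⟩⟩
    · exact ⟨M.src e⟩
  obtain ⟨v₀, hv₀⟩ := Finite.exists_max fun v : M.V => F v
  obtain ⟨v, hv, hmin⟩ := Finset.exists_min_image
    (Finset.univ.filter fun v : M.V => F v = F v₀) ρ ⟨v₀, by simp⟩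
  simp only [Finset.mem_filter, Finset.mem_univ, true_and] at hv hmin
  have hslope : ∀ h ∈ M.halfEdges v,
      m h ≤ if ρ (M.base (M.flip h)) < ρ v then -1 else 0 := by
    intro h hh
    have hb := M.mem_halfEdges.1 hh
    have hL := M.len_pos h.1
    have h1 := M.le_of_edge_form hκ (hm h) ⟨hL.le, le_rfl⟩
    rw [M.hpath_len, hb, hv] at h1
    split_ifs with hlt
    · have hne : F (M.base (M.flip h)) ≠ F v₀ := fun he => absurd hlt (not_lt.2 (hmin _ he))
      have h2 : F (M.base (M.flip h)) < F v₀ := (hv₀ _).lt_of_ne hne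
      have h3 : (m h : ℝ) * M.len h.1 < 0 := by linarith
      have h4 : (m h : ℝ) < 0 := by
        by_contra hc
        exact absurd h3 (not_lt.2 (mul_nonneg (not_lt.1 hc) hL.le))
      have h5 : m h < 0 := by exact_mod_cast h4
      linarith
    · have h3 : (m h : ℝ) * M.len h.1 ≤ 0 := by linarith [hv₀ (M.base (M.flip h))]
      have h4 : (m h : ℝ) ≤ 0 := by
        by_contra hc
        exact absurd h3 (not_le.2 (mul_pos (not_le.1 hc) hL))
      exact_mod_cast h4
  have h1 := Finset.sum_le_sum hslope
  rw [hmv, ← Finset.sum_filter, Finset.sum_const, Finsupp.sub_apply, hν v] at h1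
  have h2 := hD v
  simp only [Finsupp.coe_zero, Pi.zero_apply] at h2
  simp only [nsmul_eq_mul, mul_neg, mul_one] at h1
  linarith

variable [CompactSpace Γ]

theorem nonempty_model : Nonempty (Model Γ) :=
  ⟨(exists_model (∅ : Finset Γ) one_pos).choose⟩

theorem LinEquiv.divDegree_eq {D D' : Γ →₀ ℤ} (h : LinEquiv D D') : divDegree D = divDegree D' := by
  obtain ⟨F, hF⟩ := linEquiv_iff.1 h
  have := nonempty_model.some.divDegree_eq_zero (D := D - D') (F := F) hF
  rw [divDegree_sub] at this
  linarith

variable (Γ) in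
/-- The canonical divisor of a compact metric graph, as a finitely supported function. -/
noncomputable def canonDiv : Γ →₀ ℤ :=
  Finsupp.ofSupportFinite (canonicalDivisor Γ) (finite_support_of_eventually fun p => by
    filter_upwards [eventually_valence_eq_two p] with y hy
    simp [canonicalDivisor, hy])

theorem canonDiv_apply (p : Γ) : canonDiv Γ p = (valence p : ℤ) - 2 := rfl

namespace Model

variable (M : Model Γ)

theorem canonDiv_of_notMem {x : Γ} (hx : x ∉ M.V) : canonDiv Γ x = 0 := by
  obtain ⟨e, t, ht, rfl⟩ := M.cover x hx
  rw [canonDiv_apply, M.valence_interior ht]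
  norm_num

theorem divDegree_canonDiv :
    divDegree (canonDiv Γ) = 2 * (Fintype.card M.E : ℤ) - 2 * M.V.card := by
  rw [M.divDegree_of_support fun x hx => M.canonDiv_of_notMem hx]
  have h := M.sum_halfEdges fun _ => (1 : ℤ)
  simp only [Finset.sum_const, nsmul_eq_mul, mul_one] at h
  simp only [canonDiv_apply, M.valence_vertex, Finset.sum_sub_distrib, h]
  simp
  ring

end Model

/-- By the handshake the valences sum to 2#E. The right-hand side is intrinsic, so the choice of
model in `eulerChar` is immaterial. -/
theorem two_mul_eulerChar : 2 * eulerChar Γ = -divDegree (canonDiv Γ) := by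
  have h := nonempty_model (Γ := Γ)
  rw [eulerChar, dif_pos h, h.some.divDegree_canonDiv]
  ring

/-- Reversing the order reverses the orientation, and (val − 2) − (indeg − 1) = outdeg − 1. -/
theorem IsModerator.canonDiv_sub {ν : Γ →₀ ℤ} (h : IsModerator ν) :
    IsModerator (canonDiv Γ - ν) := by
  classical
  obtain ⟨M, ρ, hρ, h0, hν⟩ := h
  refine ⟨M, -ρ, fun e he => hρ e (neg_injective he), fun x hx => ?_, fun v => ?_⟩
  · simp [M.canonDiv_of_notMem hx, h0 x hx]
  · have hne : ∀ h ∈ M.halfEdges v, ρ (M.base (M.flip h)) ≠ ρ v := by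
      intro h hh
      rw [← M.mem_halfEdges.1 hh]
      rcases h with ⟨e, _ | _⟩
      · exact (hρ e).symm
      · exact hρ e
    have h1 : ((M.halfEdges v).filter fun h => (-ρ) (M.base (M.flip h)) < (-ρ) v) =
        (M.halfEdges v).filter fun h => ¬ ρ (M.base (M.flip h)) < ρ v := by
      refine Finset.filter_congr fun h hh => ?_
      simp only [Pi.neg_apply, neg_lt_neg_iff, not_lt]
      exact ⟨le_of_lt, fun hle => hle.lt_of_ne (hne h hh).symm⟩
    have h2 := Finset.card_filter_add_card_filter_not (s := M.halfEdges v)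
      fun h => ρ (M.base (M.flip h)) < ρ v
    rw [h1, Finsupp.sub_apply, hν v, canonDiv_apply, M.valence_vertex]
    zify at h2
    convert_to (((M.halfEdges v).card : ℤ) - 2) - _ = _
    linarith

/-- Every edge is incoming at exactly one end, so deg ν = #E − #V. -/
theorem IsModerator.two_mul_divDegree {ν : Γ →₀ ℤ} (h : IsModerator ν) :
    2 * divDegree ν = divDegree (canonDiv Γ) := by
  classical
  obtain ⟨M, ρ, hρ, h0, hν⟩ := h
  have h1 := M.sum_halfEdges fun h => if ρ (M.base (M.flip h)) < ρ (M.base h) then (1 : ℤ) else 0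
  have h2 : ∀ e, ((if ρ (M.base (M.flip (e, false))) < ρ (M.base (e, false)) then (1 : ℤ) else 0) +
      if ρ (M.base (M.flip (e, true))) < ρ (M.base (e, true)) then (1 : ℤ) else 0) = 1 := by
    intro e
    simp only [Model.flip, Bool.not_false, Bool.not_true, Model.base_true, Model.base_false]
    rcases lt_or_gt_of_ne (hρ e) with h | h
    · rw [if_neg h.not_gt, if_pos h, zero_add]
    · rw [if_pos h, if_neg h.not_gt, add_zero]
  simp only [h2, Finset.sum_const, nsmul_eq_mul, mul_one] at h1
  rw [M.divDegree_canonDiv, M.divDegree_of_support h0]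
  simp only [hν, Finset.sum_sub_distrib, Finset.card_filter, Nat.cast_sum, Nat.cast_ite,
    Nat.cast_one, Nat.cast_zero]
  have h3 : ∑ v : M.V, ∑ h ∈ M.halfEdges v,
      (if ρ (M.base (M.flip h)) < ρ v then (1 : ℤ) else 0) = Fintype.card M.E := by
    rw [← Finset.card_univ, ← h1]
    refine Finset.sum_congr rfl fun v _ => Finset.sum_congr rfl fun h hh => ?_
    rw [M.mem_halfEdges.1 hh]
  rw [h3]
  simp
  ring

end LinearEquivalence

/-! ### Explicit piecewise linear functions: moving chips and firing sets -/

theorem ordAt_affine (k : ℤ) (b x : ℝ) : OrdAt (fun t : ℝ => k * t + b) x 0 := by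
  have := OrdAt.of_two_slopes (F := fun t : ℝ => k * t + b) (m := k) (m' := -k)
    (isStarChart_real x one_pos) one_pos (fun s _ => by ring) fun s _ => by
      push_cast
      ring
  simpa using this

theorem ordAt_sup'_affine {s : Finset ℤ} (hs : s.Nonempty) (b : ℤ → ℝ) (x : ℝ) :
    ∃ κ, 0 ≤ κ ∧ OrdAt (fun t : ℝ => s.sup' hs fun k => k * t + b k) x κ := by
  induction hs using Finset.Nonempty.cons_induction with
  | singleton k => exact ⟨0, le_rfl, by simpa using ordAt_affine k (b k) x⟩
  | cons k s hk hs ih =>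
    obtain ⟨κ, hκ, h⟩ := ih
    obtain ⟨c, hc, hle⟩ := (ordAt_affine k (b k) x).sup h
    refine ⟨c, hle.elim id hκ.trans, ?_⟩
    simp only [Finset.sup'_cons hs]
    exact hc

theorem ordAt_max_zero_affine (k : ℤ) (b x : ℝ) :
    ∃ κ, 0 ≤ κ ∧ OrdAt (fun t : ℝ => max 0 (k * t + b)) x κ := by
  obtain ⟨c, hc, hle⟩ := (ordAt_const 0 x).sup (ordAt_affine k b x)
  exact ⟨c, hle.elim id id, hc⟩

namespace Model

variable {Γ : Type u} [MetricSpace Γ] (M : Model Γ)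

theorem exists_slope_of_edges {F : Γ → ℝ} {w : M.E → ℝ → ℝ}
    (hF : ∀ e, ∀ t ∈ Icc 0 (M.len e), F (M.path e t) = w e t)
    (hw : ∀ e t, ∃ a, OrdAt (w e) t a) (h : M.E × Bool) :
    ∃ m : ℤ, ∃ δ > 0, ∀ t ∈ Ico 0 δ, F (M.hpath h t) = F (M.base h) + m * t := by
  have hL := M.len_pos h.1
  rcases h with ⟨e, _ | _⟩
  · obtain ⟨a, ha⟩ := hw e 0
    obtain ⟨m, m', -, δ, hδ, -, h1, -⟩ := ha.exists_two_slopes (isStarChart_real 0 one_pos)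
    refine ⟨m, min δ (M.len e), lt_min hδ hL, fun t ht => ?_⟩
    have ht1 := ht.2.trans_le (min_le_left _ _)
    have ht2 := ht.2.trans_le (min_le_right _ _)
    have h2 := h1 t ⟨ht.1, ht1⟩
    rw [zero_add] at h2
    have h3 := hF e 0 ⟨le_rfl, hL.le⟩
    simp only [hpath_false, base_false, src]
    rw [hF e t ⟨ht.1, ht2.le⟩, h2, h3]
  · obtain ⟨a, ha⟩ := hw e (M.len e)
    obtain ⟨m, m', -, δ, hδ, -, -, h1⟩ := ha.exists_two_slopes (isStarChart_real _ one_pos)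
    refine ⟨m', min δ (M.len e), lt_min hδ hL, fun t ht => ?_⟩
    have ht1 := ht.2.trans_le (min_le_left _ _)
    have ht2 := ht.2.trans_le (min_le_right _ _)
    have h2 := h1 t ⟨ht.1, ht1⟩
    have h3 := hF e (M.len e) ⟨hL.le, le_rfl⟩
    simp only [hpath, cond_true, base_true, tgt]
    rw [hF e (M.len e - t) ⟨by linarith, by linarith [ht.1]⟩, h2, h3]

variable [MetricGraph Γ]

theorem exists_ordAt_of_edges {F : Γ → ℝ} {w : M.E → ℝ → ℝ}
    (hF : ∀ e, ∀ t ∈ Icc 0 (M.len e), F (M.path e t) = w e t)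
    (hw : ∀ e t, ∃ a, OrdAt (w e) t a) (p : Γ) : ∃ a, OrdAt F p a := by
  obtain hp | ⟨e, t, ht, rfl⟩ := M.cover_mem p
  · choose m hm using M.exists_slope_of_edges hF hw
    exact ⟨_, M.ordAt_vertex (v := ⟨p, hp⟩) fun h hh => by
      have := hm h
      rwa [hh] at this⟩
  · obtain ⟨a, ha⟩ := hw e t
    exact ⟨a, M.ordAt_of_edge (hF e) ht ha⟩

/-- Moving a chip along a half-edge. -/
theorem exists_move (hloop : ∀ e, M.src e ≠ M.tgt e) (h : M.E × Bool) :
    ∃ T : Γ → ℝ, (∀ p, ∃ a, OrdAt T p a ∧ (p ≠ M.base h → 0 ≤ a)) ∧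
      ∀ a, OrdAt T (M.base (M.flip h)) a → 1 ≤ a := by
  classical
  set v := M.base h with hv
  set L := M.len h.1 with hLdef
  have hL : 0 < L := M.len_pos h.1
  obtain ⟨l, hl, hle⟩ := exists_pos_le_of_finset Finset.univ M.len fun e _ => M.len_pos e
  obtain ⟨N, hN⟩ := exists_nat_ge (L / l)
  have hNL : ∀ e, L ≤ N * M.len e := fun e => by
    rw [div_le_iff₀ hl] at hN
    exact hN.trans (mul_le_mul_of_nonneg_left (hle e (Finset.mem_univ e)) (Nat.cast_nonneg _))
  -- The function has height L at v and vanishes at all other vertices. Along `h` it falls with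
  -- slope −1 and reaches 0 exactly at the far end, where it produces a chip; on other edges at v it
  -- falls with slope −N, steep enough to reach 0 no later than the far end.
  let w : M.E → ℝ → ℝ := fun e t =>
    if e = h.1 then (bif h.2 then max 0 ((1 : ℤ) * t + 0) else max 0 ((-1 : ℤ) * t + L)) else
    if M.src e = v then max 0 ((-N : ℤ) * t + L) else
    if M.tgt e = v then max 0 ((N : ℤ) * t + (L - N * M.len e)) else 0
  let c : M.V → ℝ := fun u => if u = v then L else 0
  have hwne : ∀ e t, 0 ≤ w e t := fun e t => by
    simp only [w]
    split_ifs
    · cases h.2 <;> exact le_max_left _ _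
    · exact le_max_left _ _
    · exact le_max_left _ _
    · exact le_rfl
  have hww : ∀ e t, ∃ a, 0 ≤ a ∧ OrdAt (w e) t a := fun e t => by
    simp only [w]
    split_ifs
    · cases h.2
      · exact ordAt_max_zero_affine _ _ t
      · exact ordAt_max_zero_affine _ _ t
    · exact ordAt_max_zero_affine _ _ t
    · exact ordAt_max_zero_affine _ _ t
    · exact ⟨0, le_rfl, ordAt_const 0 t⟩
  have hopp : M.base (M.flip h) ≠ v := by
    rw [hv]
    rcases h with ⟨e, _ | _⟩
    · exact (hloop e).symm
    · exact hloop e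
  obtain ⟨F, hFV, hFE⟩ := M.exists_glue c w (fun e => by
      simp only [w, c]
      by_cases he : e = h.1
      · rw [if_pos he]
        subst he
        rcases h with ⟨e, _ | _⟩
        · simp [hv, hL.le]
        · have : M.src e ≠ v := hopp
          simp [this]
      · rw [if_neg he]
        by_cases h1 : M.src e = v
        · simp [h1, hL.le]
        · rw [if_neg h1, if_neg h1]
          split_ifs
          · rw [mul_zero, zero_add]
            exact max_eq_left (by linarith [hNL e])
          · rfl) fun e => by
      simp only [w, c]
      by_cases he : e = h.1
      · rw [if_pos he]
        subst he
        rcases h with ⟨e, _ | _⟩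
        · have : M.tgt e ≠ v := hopp
          simp [this, hLdef]
        · simp [hv, hLdef, (M.len_pos e).le]
      · rw [if_neg he]
        by_cases h1 : M.src e = v
        · have : M.tgt e ≠ v := fun h2 => hloop e (h1.trans h2.symm)
          rw [if_pos h1, if_neg this]
          refine max_eq_left ?_
          push_cast
          linarith [hNL e]
        · rw [if_neg h1]
          split_ifs
          · push_cast
            rw [add_sub_cancel]
            exact max_eq_right hL.le
          · rfl
  have hF0 : ∀ x, 0 ≤ F x := fun x => by
    obtain hx | ⟨e, t, ht, rfl⟩ := M.cover_mem x
    · rw [hFV ⟨x, hx⟩]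
      simp only [c]
      split_ifs
      · exact hL.le
      · exact le_rfl
    · rw [hFE e t ⟨ht.1.le, ht.2.le⟩]
      exact hwne e t
  have hw' : ∀ e t, ∃ a, OrdAt (w e) t a := fun e t => (hww e t).imp fun _ h => h.2
  refine ⟨F, fun p => ?_, fun a ha => ?_⟩
  · obtain hp | ⟨e, t, ht, rfl⟩ := M.cover_mem p
    · obtain ⟨a, ha⟩ := M.exists_ordAt_of_edges hFE hw' p
      refine ⟨a, ha, fun hne => (ordAt_const 0 p).mono ha hF0 ?_⟩
      rw [hFV ⟨p, hp⟩]
      exact (if_neg fun h => hne (congrArg Subtype.val h)).symm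
    · obtain ⟨a, ha0, ha⟩ := hww e t
      exact ⟨a, M.ordAt_of_edge (hFE e) ht ha, fun _ => ha0⟩
  · obtain ⟨m, rfl, hm⟩ := M.exists_vertex_slopes ha
    have hzero : F (M.base (M.flip h)) = 0 := by
      rw [hFV]
      exact if_neg hopp
    have hnonneg : ∀ h' ∈ M.halfEdges (M.base (M.flip h)), 0 ≤ m h' := fun h' hh' => by
      obtain ⟨δ, hδ, h1⟩ := hm h' (M.mem_halfEdges.1 hh')
      have h2 := h1 (δ / 2) ⟨by linarith, by linarith⟩
      rw [hzero, zero_add] at h2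
      have h3 : (0 : ℝ) ≤ m h' := nonneg_of_mul_nonneg_left (h2 ▸ hF0 _) (by linarith : 0 < δ / 2)
      exact_mod_cast h3
    have hflip : m (M.flip h) = 1 := by
      obtain ⟨δ, hδ, h1⟩ := hm (M.flip h) rfl
      have hη0 : 0 < min δ L / 2 := by
        have := lt_min hδ hL
        linarith
      have hη1 : min δ L / 2 < δ := by linarith [min_le_left δ L]
      have hη2 : min δ L / 2 < L := by linarith [min_le_right δ L]
      have h2 := h1 (min δ L / 2) ⟨hη0.le, hη1⟩
      have h3 : F (M.hpath (M.flip h) (min δ L / 2)) = min δ L / 2 := by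
        set η := min δ L / 2
        rw [hpath_flip]
        change F (M.hpath h (L - η)) = η
        have : w h.1 (bif h.2 then M.len h.1 - (L - η) else L - η) = η := by
          simp only [w, if_true]
          cases h.2
          · simp only [cond_false]
            rw [max_eq_right (by push_cast; linarith)]
            push_cast
            ring
          · simp only [cond_true]
            rw [max_eq_right (by push_cast; linarith)]
            push_cast
            ring
        rw [hpath, hFE _ _ ?_, this]
        cases h.2
        · exact ⟨by simp only [cond_false]; linarith, by simp only [cond_false]; linarith⟩
        · exact ⟨by simp only [cond_true]; linarith, by simp only [cond_true]; linarith⟩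
      rw [h3, hzero, zero_add] at h2
      have h4 : (m (M.flip h) : ℝ) = 1 :=
        mul_right_cancel₀ hη0.ne' (h2.symm.trans (one_mul _).symm)
      exact_mod_cast h4
    rw [← hflip]
    exact Finset.single_le_sum hnonneg (by simp)

/-- Firing a set of vertices. -/
theorem exists_fire (A : Finset M.V) (hA : A.Nonempty) :
    ∃ T : Γ → ℝ, (∃ v ∈ A, 0 < T v) ∧ (∀ v ∉ A, T v = 0) ∧
      ∀ p, ∃ a, OrdAt T p a ∧ ((∀ v ∈ A, p ≠ v) → 0 ≤ a) ∧
        ∀ v ∈ A, p = v → a = -(open Classical in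
          ((M.halfEdges v).filter fun h => M.base (M.flip h) ∉ A).card : ℤ) := by
  classical
  obtain ⟨l, hl, hle⟩ := exists_pos_le_of_finset Finset.univ M.len fun e _ => M.len_pos e
  have hlen : ∀ e, l ≤ M.len e := fun e => hle e (Finset.mem_univ e)
  -- The function is l on A and on the edges inside A, and falls to 0 with slope −1 along each edge
  -- leaving A; there is room because l is at most every edge length.
  let w : M.E → ℝ → ℝ := fun e t =>
    if M.src e ∈ A then (if M.tgt e ∈ A then l else max 0 ((-1 : ℤ) * t + l)) else
    if M.tgt e ∈ A then max 0 ((1 : ℤ) * t + (l - M.len e)) else 0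
  let c : M.V → ℝ := fun u => if u ∈ A then l else 0
  have hwne : ∀ e t, 0 ≤ w e t := fun e t => by
    simp only [w]
    split_ifs
    · exact hl.le
    · exact le_max_left _ _
    · exact le_max_left _ _
    · exact le_rfl
  have hww : ∀ e t, ∃ a, 0 ≤ a ∧ OrdAt (w e) t a := fun e t => by
    simp only [w]
    split_ifs
    · exact ⟨0, le_rfl, ordAt_const l t⟩
    · exact ordAt_max_zero_affine _ _ t
    · exact ordAt_max_zero_affine _ _ t
    · exact ⟨0, le_rfl, ordAt_const 0 t⟩
  obtain ⟨F, hFV, hFE⟩ := M.exists_glue c w (fun e => by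
      have := hlen e
      simp only [w, c]
      split_ifs
      · rfl
      · simp [hl.le]
      · exact max_eq_left (by linarith)
      · rfl) fun e => by
      have := hlen e
      simp only [w, c]
      split_ifs
      · rfl
      · exact max_eq_left (by push_cast; linarith)
      · push_cast
        rw [one_mul, add_sub_cancel]
        exact max_eq_right hl.le
      · rfl
  have hF0 : ∀ x, 0 ≤ F x := fun x => by
    obtain hx | ⟨e, t, ht, rfl⟩ := M.cover_mem x
    · rw [hFV ⟨x, hx⟩]
      simp only [c]
      split_ifs
      · exact hl.le
      · exact le_rfl
    · rw [hFE e t ⟨ht.1.le, ht.2.le⟩]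
      exact hwne e t
  have hw' : ∀ e t, ∃ a, OrdAt (w e) t a := fun e t => (hww e t).imp fun _ h => h.2
  have hA' : ∀ v ∉ A, F v = 0 := fun v hv => by rw [hFV]; exact if_neg hv
  refine ⟨F, ?_, hA', fun p => ?_⟩
  · obtain ⟨v, hv⟩ := hA
    exact ⟨v, hv, by rw [hFV]; simpa [c, hv] using hl⟩
  · obtain hp | ⟨e, t, ht, rfl⟩ := M.cover_mem p
    · by_cases hpA : (⟨p, hp⟩ : M.V) ∈ A
      · refine ⟨∑ h ∈ M.halfEdges ⟨p, hp⟩, if M.base (M.flip h) ∉ A then -1 else 0,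
          M.ordAt_vertex (v := ⟨p, hp⟩) fun h hh => ⟨l, hl, fun t ht => ?_⟩,
          fun h => absurd rfl (h _ hpA), fun v hv hpv => ?_⟩
        · have h1 := hlen h.1
          have h2 := ht.1
          have h3 := ht.2
          rw [hFV, hpath, hFE h.1 _ (by
            cases h.2
            · exact ⟨by simp only [cond_false]; linarith, by simp only [cond_false]; linarith⟩
            · exact ⟨by simp only [cond_true]; linarith, by simp only [cond_true]; linarith⟩)]
          simp only [w, c, if_pos hpA]
          rcases h with ⟨e, _ | _⟩
          · have hs : M.src e ∈ A := by
              rw [base_false] at hh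
              rwa [hh]
            simp only [if_pos hs, flip, Bool.not_false, base_true, cond_false]
            split_ifs with h4
            · simp
            · rw [max_eq_right (by push_cast; linarith)]
              push_cast
              ring
          · have hs : M.tgt e ∈ A := by
              rw [base_true] at hh
              rwa [hh]
            simp only [if_pos hs, flip, Bool.not_true, base_false, cond_true]
            split_ifs with h4
            · simp
            · rw [max_eq_right (by push_cast; linarith)]
              push_cast
              ring
        · have : v = ⟨p, hp⟩ := Subtype.ext hpv.symm
          subst this
          rw [← Finset.sum_filter, Finset.sum_const]
          simp
      · obtain ⟨a, ha⟩ := M.exists_ordAt_of_edges hFE hw' p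
        refine ⟨a, ha, fun _ => (ordAt_const 0 p).mono ha hF0 (hA' ⟨p, hp⟩ hpA).symm,
          fun v hv hpv => ?_⟩
        have : v = ⟨p, hp⟩ := Subtype.ext hpv.symm
        exact absurd (this ▸ hv) hpA
    · obtain ⟨a, ha0, ha⟩ := hww e t
      exact ⟨a, M.ordAt_of_edge (hFE e) ht ha, fun _ => ha0, fun v _ hv =>
        absurd (hv ▸ v.2) (M.notMem e t ht)⟩

/-- Starting with 0 at q, the property spreads along half-edges. Moving a chip costs |j| at the base
vertex at worst, where j is the order of the move there, and |j| copies of the function already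
found for the base vertex pay for this. -/
theorem exists_pos_divisor [ConnectedSpace Γ] (hloop : ∀ e, M.src e ≠ M.tgt e) (q v : M.V) :
    ∃ F : Γ → ℝ, ∀ p, ∃ a, OrdAt F p a ∧ (p ≠ q → 0 ≤ a ∧ (p = v → 1 ≤ a)) := by
  have step : ∀ h : M.E × Bool,
      (∃ F : Γ → ℝ, ∀ p, ∃ a, OrdAt F p a ∧ (p ≠ q → 0 ≤ a ∧ (p = M.base h → 1 ≤ a))) →
      ∃ F : Γ → ℝ, ∀ p, ∃ a, OrdAt F p a ∧ (p ≠ q → 0 ≤ a ∧ (p = M.base (M.flip h) → 1 ≤ a)) := by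
    rintro h ⟨F, hF⟩
    obtain ⟨T, hT, hT1⟩ := M.exists_move hloop h
    obtain ⟨j, hj, -⟩ := hT (M.base h)
    refine ⟨(fun x => (|j| : ℤ) * F x) + T, fun p => ?_⟩
    obtain ⟨a, ha, ha0⟩ := hF p
    obtain ⟨b, hb, hb0⟩ := hT p
    refine ⟨|j| * a + b, (ha.intCast_mul _).add hb, fun hpq => ?_⟩
    obtain ⟨ha1, ha2⟩ := ha0 hpq
    by_cases hp : p = M.base h
    · have hbj : b = j := by
        rw [hp] at hb
        exact hb.unique hj
      have ha3 := ha2 hp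
      have h1 : |j| * 1 ≤ |j| * a := mul_le_mul_of_nonneg_left ha3 (abs_nonneg _)
      have h2 := neg_abs_le j
      refine ⟨by linarith, fun hpf => ?_⟩
      rw [hpf] at hb
      have := hT1 b hb
      linarith [mul_nonneg (abs_nonneg j) ha1]
    · have h1 := mul_nonneg (abs_nonneg j) ha1
      refine ⟨by linarith [hb0 hp], fun hpf => ?_⟩
      rw [hpf] at hb
      linarith [hT1 b hb]
  refine M.connected_induction (P := fun v => ∃ F : Γ → ℝ, ∀ p, ∃ a, OrdAt F p a ∧
    (p ≠ q → 0 ≤ a ∧ (p = v → 1 ≤ a))) q ?_ (fun e => ⟨step (e, false), step (e, true)⟩) v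
  exact ⟨fun _ => 0, fun p => ⟨0, ordAt_const 0 p, fun h => ⟨le_rfl, fun h' => absurd h' h⟩⟩⟩

end Model

/-! ### Divisors effective away from one point -/

section Reduced

variable {Γ : Type u} [MetricSpace Γ]

/-- The piecewise linear functions `F` with `F q = 0` such that `D + div F` is effective away from
`q`. -/
def effectiveOff (D : Γ →₀ ℤ) (q : Γ) : Set (Γ → ℝ) :=
  {F | F q = 0 ∧ ∀ p, ∃ a, OrdAt F p a ∧ (p ≠ q → 0 ≤ D p + a)}

theorem effectiveOff_sup {D : Γ →₀ ℤ} {q : Γ} {F G : Γ → ℝ} (hF : F ∈ effectiveOff D q)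
    (hG : G ∈ effectiveOff D q) : F ⊔ G ∈ effectiveOff D q := by
  refine ⟨by simp [hF.1, hG.1], fun p => ?_⟩
  obtain ⟨a, ha, ha'⟩ := hF.2 p
  obtain ⟨b, hb, hb'⟩ := hG.2 p
  obtain ⟨c, hc, hle⟩ := ha.sup hb
  refine ⟨c, hc, fun hp => ?_⟩
  rcases hle with h | h
  · linarith [ha' hp]
  · linarith [hb' hp]

variable [MetricGraph Γ]

theorem exists_loopless_model [CompactSpace Γ] (S : Finset Γ) :
    ∃ M : Model Γ, S ⊆ M.V ∧ ∀ e, M.src e ≠ M.tgt e := by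
  obtain ⟨M, hM, hS, -⟩ := exists_simple_model S (fun _ : Unit => (univ : Set Γ))
    (fun _ => isOpen_univ) fun x => ⟨(), mem_univ x⟩
  exact ⟨M, hS, hM.1⟩

/-- At each vertex v other than q a debt is at most |D v|, and |D v| copies of a function that
brings chips from q to v cover it without creating debts elsewhere. Subtracting a constant
normalizes the value at q. -/
theorem effectiveOff_nonempty [CompactSpace Γ] [ConnectedSpace Γ] (D : Γ →₀ ℤ) (q : Γ) :
    (effectiveOff D q).Nonempty := by
  classical
  obtain ⟨M, hM, hloop⟩ := exists_loopless_model (insert q D.support)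
  have hq : q ∈ M.V := hM (Finset.mem_insert_self _ _)
  choose F a ha ha' using M.exists_pos_divisor hloop ⟨q, hq⟩
  have key : ∀ p, OrdAt (fun x => ∑ v : M.V, (|D v| : ℤ) * F v x) p (∑ v : M.V, |D v| * a v p) := fun p =>
    OrdAt.sum _ fun v _ => (ha v p).intCast_mul _
  refine ⟨(fun x => ∑ v : M.V, (|D v| : ℤ) * F v x) - fun _ => ∑ v : M.V, (|D v| : ℤ) * F v q,
    by simp, fun p => ⟨_, (key p).sub (ordAt_const _ p), fun hpq => ?_⟩⟩
  have hnn : ∀ v : M.V, 0 ≤ |D v| * a v p := fun v => mul_nonneg (abs_nonneg _) (ha' v p hpq).1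
  rw [sub_zero]
  by_cases hp : D p = 0
  · rw [hp, zero_add]
    exact Finset.sum_nonneg fun v _ => hnn v
  · have hpV : p ∈ M.V := hM (Finset.mem_insert_of_mem (Finsupp.mem_support_iff.2 hp))
    have h1 := Finset.single_le_sum (f := fun v : M.V => |D v| * a v p) (fun v _ => hnn v)
      (Finset.mem_univ (⟨p, hpV⟩ : M.V))
    have h2 : |D p| * 1 ≤ |D p| * a ⟨p, hpV⟩ p :=
      mul_le_mul_of_nonneg_left ((ha' ⟨p, hpV⟩ p hpq).2 rfl) (abs_nonneg _)
    have h3 := neg_abs_le (D p)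
    simp only at h1
    linarith

end Reduced

namespace Model

variable {Γ : Type u} [MetricSpace Γ] (M : Model Γ) {F : Γ → ℝ} {κ : Γ →₀ ℤ} {m : M.E × Bool → ℤ}

theorem sum_kinks_nonneg (hκ : ∀ x ∉ M.V, 0 ≤ κ x) (h : M.E × Bool) :
    0 ≤ ∑ x ∈ M.kinks κ h, κ (M.hpath h x) :=
  Finset.sum_nonneg fun _ hx => hκ _ (M.hpath_notMem h (M.mem_kinks.1 hx).1)

/-- The slopes of a function are bounded in terms of lower bounds for its orders at the vertices,
if its orders away from the vertices are nonnegative. -/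
theorem slope_bound (hmv : ∀ v : M.V, ∑ h ∈ M.halfEdges v, m h = κ v)
    (hadd : ∀ h, m h + m (M.flip h) = -∑ x ∈ M.kinks κ h, κ (M.hpath h x))
    (hm : ∀ h, ∀ t ∈ Icc 0 (M.len h.1), F (M.hpath h t) =
        F (M.base h) + m h * t + ∑ x ∈ M.kinks κ h, κ (M.hpath h x) * max 0 (t - x))
    (hκ : ∀ x ∉ M.V, 0 ≤ κ x) {c : M.V → ℤ} (hc0 : ∀ v, 0 ≤ c v) (hc : ∀ v : M.V, -c v ≤ κ v)
    (h : M.E × Bool) : -∑ v, c v ≤ m h ∧ m h ≤ ∑ v, c v := by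
  classical
  have hpair : ∀ h, m h + m (M.flip h) ≤ 0 := fun h => by
    rw [hadd]
    exact neg_nonpos.2 (M.sum_kinks_nonneg hκ h)
  have hcross : ∀ h, F (M.base (M.flip h)) ≤ F (M.base h) → m h ≤ 0 := fun h hle => by
    have hL := M.len_pos h.1
    have h1 := M.le_of_edge_form hκ (hm h) ⟨hL.le, le_rfl⟩
    rw [M.hpath_len] at h1
    have h3 : (m h : ℝ) * M.len h.1 ≤ 0 := by linarith
    have h4 : (m h : ℝ) ≤ 0 := by
      by_contra hn
      exact absurd h3 (not_le.2 (mul_pos (not_le.1 hn) hL))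
    exact_mod_cast h4
  have lower : ∀ h, -∑ v, c v ≤ m h := by
    intro h
    -- Only the vertices at least as high as the base of h are counted. Their orders sum to at least
    -- −∑ c, while each edge contributes at most 0: inside the set by convexity, on the boundary
    -- because it leads downhill. So the contribution of the edge of h alone is at least −∑ c.
    let m' : M.E × Bool → ℤ := fun h' => if F (M.base h) ≤ F (M.base h') then m h' else 0
    have hpair' : ∀ h', m' h' + m' (M.flip h') ≤ 0 := fun h' => by
      simp only [m']
      split_ifs with h1 h2 h2
      · exact hpair h'
      · rw [add_zero]
        exact hcross h' ((not_le.1 h2).le.trans h1)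
      · rw [zero_add]
        refine hcross _ ?_
        rw [flip_flip]
        exact (not_le.1 h1).le.trans h2
      · simp
    have hsum := M.sum_halfEdges m'
    have hge : -∑ v, c v ≤ ∑ v, ∑ h' ∈ M.halfEdges v, m' h' := by
      rw [← Finset.sum_neg_distrib]
      refine Finset.sum_le_sum fun v _ => ?_
      by_cases hv : F (M.base h) ≤ F v
      · refine (hc v).trans_eq ?_
        rw [← hmv v]
        refine Finset.sum_congr rfl fun h' hh' => ?_
        simp only [m', M.mem_halfEdges.1 hh', if_pos hv]
      · rw [Finset.sum_eq_zero fun h' hh' => by simp only [m', M.mem_halfEdges.1 hh', if_neg hv]]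
        linarith [hc0 v]
    rw [hsum] at hge
    have hle : ∑ e, (m' (e, false) + m' (e, true)) ≤ m' (h.1, false) + m' (h.1, true) := by
      rw [← Finset.add_sum_erase _ _ (Finset.mem_univ h.1)]
      exact add_le_of_nonpos_right (Finset.sum_nonpos fun e _ => hpair' (e, false))
    have hh : m' (h.1, false) + m' (h.1, true) = m' h + m' (M.flip h) := by
      rcases h with ⟨e, _ | _⟩
      · rfl
      · exact add_comm _ _
    have h1 : m' h = m h := if_pos le_rfl
    have h2 : m' (M.flip h) ≤ 0 := by
      simp only [m']
      split_ifs with h3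
      · exact hcross _ (by rwa [flip_flip])
      · exact le_rfl
    linarith
  refine ⟨lower h, ?_⟩
  linarith [lower (M.flip h), hpair h]

/-- A function that is convex on an edge has supporting lines of integral slope. -/
theorem exists_support {h : M.E × Bool}
    (hadd : m h + m (M.flip h) = -∑ x ∈ M.kinks κ h, κ (M.hpath h x))
    (hm : ∀ t ∈ Icc 0 (M.len h.1), F (M.hpath h t) =
        F (M.base h) + m h * t + ∑ x ∈ M.kinks κ h, κ (M.hpath h x) * max 0 (t - x))
    (hκ : ∀ x ∉ M.V, 0 ≤ κ x) {C : ℤ} (hC : -C ≤ m h) (hC' : -C ≤ m (M.flip h)) {t : ℝ}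
    (ht : t ∈ Icc 0 (M.len h.1)) : ∃ k ∈ Finset.Icc (-C) C, ∀ s ∈ Icc 0 (M.len h.1),
      F (M.hpath h t) + k * (s - t) ≤ F (M.hpath h s) := by
  classical
  have hnn : ∀ x ∈ M.kinks κ h, 0 ≤ κ (M.hpath h x) := fun _ hx =>
    hκ _ (M.hpath_notMem h (M.mem_kinks.1 hx).1)
  have h1 : 0 ≤ ∑ x ∈ (M.kinks κ h).filter (· ≤ t), κ (M.hpath h x) :=
    Finset.sum_nonneg fun x hx => hnn x (Finset.mem_filter.1 hx).1
  have h2 : ∑ x ∈ (M.kinks κ h).filter (· ≤ t), κ (M.hpath h x) ≤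
      ∑ x ∈ M.kinks κ h, κ (M.hpath h x) :=
    Finset.sum_le_sum_of_subset_of_nonneg (Finset.filter_subset _ _) fun x hx _ => hnn x hx
  -- This is the slope to the right of t. It lies between the initial slope and −m (flip h), the
  -- slope after all kinks.
  refine ⟨m h + ∑ x ∈ (M.kinks κ h).filter (· ≤ t), κ (M.hpath h x),
    Finset.mem_Icc.2 ⟨by linarith, by linarith⟩, fun s hs => ?_⟩
  rw [hm t ht, hm s hs]
  push_cast
  rw [Finset.sum_filter]
  have key : ∑ x ∈ M.kinks κ h, (κ (M.hpath h x) : ℝ) * max 0 (t - x) +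
      (∑ x ∈ M.kinks κ h, if x ≤ t then (κ (M.hpath h x) : ℝ) else 0) * (s - t) ≤
      ∑ x ∈ M.kinks κ h, (κ (M.hpath h x) : ℝ) * max 0 (s - x) := by
    rw [Finset.sum_mul, ← Finset.sum_add_distrib]
    refine Finset.sum_le_sum fun x hx => ?_
    have hx0 : (0 : ℝ) ≤ κ (M.hpath h x) := by exact_mod_cast hnn x hx
    split_ifs with hxt
    · rw [max_eq_right (by linarith), ← mul_add]
      refine mul_le_mul_of_nonneg_left ?_ hx0
      rw [sub_add_sub_cancel']
      exact le_max_right _ _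
    · rw [max_eq_left (by linarith), mul_zero, zero_mul, add_zero]
      exact mul_nonneg hx0 (le_max_left _ _)
  linarith

end Model

/-- The burning algorithm: if every nonempty set of vertices that does not contain `q` can be
burnt at some vertex, then all vertices can be ordered accordingly. -/
theorem exists_burning_order {V H : Type*} [Fintype V] [DecidableEq V] (q : V) (d : V → ℤ)
    (star : V → Finset H) (opp : H → V)
    (hburn : ∀ A : Finset V, A.Nonempty → q ∉ A →
      ∃ v ∈ A, d v < ((star v).filter fun h => opp h ∉ A).card) :
    ∃ ρ : V → ℤ, Function.Injective ρ ∧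
      ∀ v, v ≠ q → d v < ((star v).filter fun h => ρ (opp h) < ρ v).card := by
  -- B is the burnt set. The count only involves neighbours in B, so changing ρ outside B does no
  -- harm; the next vertex to burn gets a value above all of B.
  have key : ∀ n : ℕ, ∀ B : Finset V, Bᶜ.card = n → q ∈ B → ∀ ρ : V → ℤ, InjOn ρ B →
      (∀ v ∈ B, v ≠ q → d v < ((star v).filter fun h => opp h ∈ B ∧ ρ (opp h) < ρ v).card) →
      ∃ ρ : V → ℤ, Function.Injective ρ ∧
        ∀ v, v ≠ q → d v < ((star v).filter fun h => ρ (opp h) < ρ v).card := by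
    intro n
    induction n with
    | zero =>
      intro B hB _ ρ hρ hd
      have hB' : B = Finset.univ := by
        rw [Finset.card_eq_zero] at hB
        rw [← compl_compl B, hB, Finset.compl_empty]
      subst hB'
      refine ⟨ρ, fun x y hxy => hρ (by simp) (by simp) hxy, fun v hv => ?_⟩
      simpa using hd v (Finset.mem_univ v) hv
    | succ n ih =>
      intro B hB hqB ρ hρ hd
      obtain ⟨v, hv, hdv⟩ := hburn Bᶜ (Finset.card_pos.1 (by omega)) (by simpa using hqB)
      have hvB : v ∉ B := by simpa using hv
      let ρ' : V → ℤ := Function.update ρ v (B.sup' ⟨q, hqB⟩ ρ + 1)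
      have hρ'v : ρ' v = B.sup' ⟨q, hqB⟩ ρ + 1 := Function.update_self _ _ _
      have hρ'B : ∀ u ∈ B, ρ' u = ρ u := fun u hu =>
        Function.update_of_ne (by rintro rfl; exact hvB hu) _ _
      have hlt : ∀ u ∈ B, ρ' u < ρ' v := fun u hu => by
        rw [hρ'v, hρ'B u hu]
        exact Int.lt_add_one_of_le (Finset.le_sup' ρ hu)
      refine ih (insert v B) ?_ (Finset.mem_insert_of_mem hqB) ρ' ?_ ?_
      · have h1 := Finset.card_compl (insert v B)
        have h2 := Finset.card_compl B
        rw [Finset.card_insert_of_notMem hvB] at h1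
        omega
      · intro x hx y hy hxy
        simp only [Finset.coe_insert, mem_insert_iff, SetLike.mem_coe] at hx hy
        rcases hx with rfl | hx <;> rcases hy with rfl | hy
        · rfl
        · exact absurd hxy (hlt y hy).ne'
        · exact absurd hxy (hlt x hx).ne
        · rw [hρ'B x hx, hρ'B y hy] at hxy
          exact hρ hx hy hxy
      · intro u hu huq
        rcases Finset.mem_insert.1 hu with rfl | hu
        · refine hdv.trans_le ?_
          norm_cast
          refine Finset.card_le_card fun h hh => ?_
          simp only [Finset.mem_filter, Finset.mem_compl, not_not] at hh ⊢
          exact ⟨hh.1, Finset.mem_insert_of_mem hh.2, hlt _ hh.2⟩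
        · refine (hd u hu huq).trans_le ?_
          norm_cast
          refine Finset.card_le_card fun h hh => ?_
          simp only [Finset.mem_filter] at hh ⊢
          refine ⟨hh.1, Finset.mem_insert_of_mem hh.2.1, ?_⟩
          rw [hρ'B _ hh.2.1, hρ'B u hu]
          exact hh.2.2
  refine key _ {q} rfl (Finset.mem_singleton_self q) (fun _ => 0) ?_ ?_
  · rw [Finset.coe_singleton]
    exact injOn_singleton _ _
  · intro v hv hvq
    exact absurd (Finset.mem_singleton.1 hv) hvq

/-! ### The reduced representative and the moderator above it -/

section Reduced

variable {Γ : Type u} [MetricSpace Γ] [MetricGraph Γ] [CompactSpace Γ] [ConnectedSpace Γ]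

/-- The pointwise largest function `F` with `F q = 0` such that `D + div F` is effective away from
`q`. -/
theorem exists_max_effectiveOff (D : Γ →₀ ℤ) (q : Γ) :
    ∃ F ∈ effectiveOff D q, ∀ G ∈ effectiveOff D q, ∀ x, G x ≤ F x := by
  classical
  obtain ⟨M, hM, -⟩ := exists_loopless_model (insert q D.support)
  have hq : q ∈ M.V := hM (Finset.mem_insert_self _ _)
  have hDV : ∀ x ∉ M.V, D x = 0 := fun x hx => by
    by_contra hne
    exact hx (hM (Finset.mem_insert_of_mem (Finsupp.mem_support_iff.2 hne)))
  obtain ⟨F₀, hF₀⟩ := effectiveOff_nonempty D q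
  obtain ⟨κ₀, hκ₀⟩ := exists_divisor fun p => (hF₀.2 p).imp fun _ h => h.1
  -- The members of `effectiveOff` may have arbitrarily negative order at q. Those above `F₀` touch
  -- it at q, so the order of `F₀` bounds theirs from below. Nothing is lost, since any G may be
  -- replaced by its maximum with `F₀`.
  let R : Set (Γ → ℝ) := {F | F ∈ effectiveOff D q ∧ ∀ x, F₀ x ≤ F x}
  have hF₀R : F₀ ∈ R := ⟨hF₀, fun _ => le_rfl⟩
  let c : M.V → ℤ := fun v => |D v| + |κ₀ v|
  have hc0 : ∀ v, 0 ≤ c v := fun v => add_nonneg (abs_nonneg _) (abs_nonneg _)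
  set C := ∑ v, c v with hC
  have hC0 : 0 ≤ C := Finset.sum_nonneg fun v _ => hc0 v
  -- the structure of the members of the family
  have hR : ∀ F ∈ R, ∃ κ : Γ →₀ ℤ, ∃ m : M.E × Bool → ℤ,
      (∀ v : M.V, v.1 ≠ q → -D v ≤ ∑ h ∈ M.halfEdges v, m h) ∧
      (∀ h, ∀ t ∈ Icc 0 (M.len h.1), F (M.base h) + m h * t ≤ F (M.hpath h t)) ∧
      (∀ h, -C ≤ m h) ∧
      ∀ h, ∀ t ∈ Icc 0 (M.len h.1), ∃ k ∈ Finset.Icc (-C) C, ∀ s ∈ Icc 0 (M.len h.1),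
        F (M.hpath h t) + k * (s - t) ≤ F (M.hpath h s) := by
    rintro F ⟨hF, hle⟩
    obtain ⟨κ, hκ⟩ := exists_divisor fun p => (hF.2 p).imp fun _ h => h.1
    have hκD : ∀ p, p ≠ q → 0 ≤ D p + κ p := fun p hp => by
      obtain ⟨a, ha, ha'⟩ := hF.2 p
      rw [(hκ p).unique ha]
      exact ha' hp
    have hκV : ∀ x ∉ M.V, 0 ≤ κ x := fun x hx => by
      have := hκD x fun h => hx (h ▸ hq)
      rwa [hDV x hx, zero_add] at this
    have hκc : ∀ v : M.V, -c v ≤ κ v := fun v => by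
      by_cases hv : v.1 = q
      · have h1 : κ₀ v ≤ κ v := (hκ₀ v).mono (hκ v) hle (by rw [hv, hF₀.1, hF.1])
        have h2 := neg_abs_le (κ₀ v)
        have h3 := abs_nonneg (D v)
        simp only [c]
        linarith
      · have h1 := hκD v hv
        have h2 := le_abs_self (D v)
        have h3 := abs_nonneg (κ₀ v)
        simp only [c]
        linarith
    obtain ⟨m, hmv, hadd, hm⟩ := M.exists_edge_slopes hκ
    have hb := fun h => (M.slope_bound hmv hadd hm hκV hc0 hκc h).1
    refine ⟨κ, m, fun v hv => ?_, fun h t ht => M.le_of_edge_form hκV (hm h) ht, hb,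
      fun h t ht => M.exists_support (hadd h) (hm h) hκV (hb h) (hb _) ht⟩
    rw [hmv]
    linarith [hκD v hv]
  -- boundedness
  have hbddV : ∀ v : M.V, BddAbove ((fun F : Γ → ℝ => F v) '' R) := by
    have hstep : ∀ h : M.E × Bool, BddAbove ((fun F : Γ → ℝ => F (M.base h)) '' R) →
        BddAbove ((fun F : Γ → ℝ => F (M.base (M.flip h))) '' R) := by
      rintro h ⟨B, hB⟩
      refine ⟨B + C * M.len h.1, ?_⟩
      rintro _ ⟨F, hF, rfl⟩
      obtain ⟨κ, m, -, hm, hmC, -⟩ := hR F hF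
      have hL := M.len_pos h.1
      have h1 := hm (M.flip h) (M.len h.1) ⟨hL.le, le_rfl⟩
      rw [M.hpath_flip, sub_self, M.hpath_zero] at h1
      have h2 : F (M.base h) ≤ B := hB ⟨F, hF, rfl⟩
      have h3 : (-C : ℝ) ≤ m (M.flip h) := by exact_mod_cast hmC (M.flip h)
      have h4 := mul_le_mul_of_nonneg_right h3 hL.le
      simp only
      linarith
    refine M.connected_induction ⟨q, hq⟩ ⟨0, ?_⟩ fun e => ⟨hstep (e, false), hstep (e, true)⟩
    rintro _ ⟨F, hF, rfl⟩
    exact hF.1.1.le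
  have hbdd : ∀ x, BddAbove ((fun F : Γ → ℝ => F x) '' R) := fun x => by
    obtain hx | ⟨e, t, ht, rfl⟩ := M.cover_mem x
    · exact hbddV ⟨x, hx⟩
    · obtain ⟨B, hB⟩ := hbddV (M.src e)
      refine ⟨B + C * t, ?_⟩
      rintro _ ⟨F, hF, rfl⟩
      obtain ⟨κ, m, -, -, -, hs⟩ := hR F hF
      obtain ⟨k, hk, hk'⟩ := hs (e, false) t ⟨ht.1.le, ht.2.le⟩
      have h1 := hk' 0 ⟨le_rfl, (M.len_pos e).le⟩
      have h2 : F (M.src e) ≤ B := hB ⟨F, hF, rfl⟩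
      rw [M.hpath_zero] at h1
      have h3 : (k : ℝ) ≤ C := by exact_mod_cast (Finset.mem_Icc.1 hk).2
      have h4 := mul_le_mul_of_nonneg_right h3 ht.1.le
      simp only [Model.hpath_false, Model.base_false] at h1 ⊢
      linarith
  let Fs : Γ → ℝ := fun x => sSup ((fun F : Γ → ℝ => F x) '' R)
  have hle : ∀ F ∈ R, ∀ x, F x ≤ Fs x := fun F hF x => le_csSup (hbdd x) ⟨F, hF, rfl⟩
  have hsup : ∀ x B, (∀ F ∈ R, F x ≤ B) → Fs x ≤ B := fun x B h =>
    csSup_le ⟨_, F₀, hF₀R, rfl⟩ (by rintro _ ⟨F, hF, rfl⟩; exact h F hF)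
  -- the supremum on the edges
  have hKne : (Finset.Icc (-C) C).Nonempty := Finset.nonempty_Icc.2 (by linarith)
  -- `S e k` collects the intercepts of lines of slope k below some member on e. Every member is the
  -- maximum of its supporting lines, with slopes in [−C, C], so on e the supremum is the maximum of
  -- one best line for each of finitely many slopes; in particular it is piecewise linear and
  -- convex.
  let S : M.E → ℤ → Set ℝ := fun e k =>
    {b | ∃ F ∈ R, ∀ s ∈ Icc 0 (M.len e), k * s + b ≤ F (M.path e s)}
  have hSbdd : ∀ e k, BddAbove (S e k) := fun e k => by
    refine ⟨Fs (M.path e 0), ?_⟩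
    rintro b ⟨F, hF, hb⟩
    have := hb 0 ⟨le_rfl, (M.len_pos e).le⟩
    rw [mul_zero, zero_add] at this
    exact this.trans (hle F hF _)
  have hSne : ∀ e k, (S e k).Nonempty := fun e k => by
    obtain ⟨κ, m, -, hm, hmC, -⟩ := hR F₀ hF₀R
    refine ⟨F₀ (M.src e) - (C + |(k : ℝ)|) * M.len e, F₀, hF₀R, fun s hs => ?_⟩
    have h1 := hm (e, false) s hs
    have h3 : (-C : ℝ) ≤ m (e, false) := by exact_mod_cast hmC (e, false)
    have h4 := mul_le_mul_of_nonneg_right h3 hs.1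
    have h5 : (k : ℝ) * s ≤ |(k : ℝ)| * s := mul_le_mul_of_nonneg_right (le_abs_self _) hs.1
    have hC0' : (0 : ℝ) ≤ C := by exact_mod_cast hC0
    have h6 := mul_le_mul_of_nonneg_left hs.2 (add_nonneg hC0' (abs_nonneg (k : ℝ)))
    simp only [Model.hpath_false, Model.base_false] at h1
    linarith
  let b : M.E → ℤ → ℝ := fun e k => sSup (S e k)
  have hedge : ∀ e, ∀ t ∈ Icc 0 (M.len e),
      Fs (M.path e t) = (Finset.Icc (-C) C).sup' hKne fun k => k * t + b e k := by
    intro e t ht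
    refine le_antisymm (hsup _ _ fun F hF => ?_) (Finset.sup'_le _ _ fun k _ => ?_)
    · obtain ⟨κ, m, -, -, -, hs⟩ := hR F hF
      obtain ⟨k, hk, hk'⟩ := hs (e, false) t ht
      have h1 : F (M.path e t) - k * t ∈ S e k := ⟨F, hF, fun s hs => by
        have := hk' s hs
        simp only [Model.hpath_false] at this
        linarith⟩
      have h2 : F (M.path e t) ≤ k * t + b e k := by linarith [le_csSup (hSbdd e k) h1]
      exact h2.trans (Finset.le_sup' (fun k : ℤ => (k : ℝ) * t + b e k) hk)
    · have : b e k ≤ Fs (M.path e t) - k * t := csSup_le (hSne e k) (by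
        rintro b ⟨F, hF, hb⟩
        linarith [hb t ht, hle F hF (M.path e t)])
      linarith
  have hw := fun e t => ordAt_sup'_affine hKne (b e) t
  have hw' : ∀ e t, ∃ a, OrdAt (fun t => (Finset.Icc (-C) C).sup' hKne fun k => k * t + b e k) t a :=
    fun e t => (hw e t).imp fun _ h => h.2
  refine ⟨Fs, ⟨le_antisymm (hsup q 0 fun F hF => hF.1.1.le) (hF₀.1 ▸ hle F₀ hF₀R q), fun p => ?_⟩,
    fun G hG x => ?_⟩
  · obtain hp | ⟨e, t, ht, rfl⟩ := M.cover_mem p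
    · choose m δ hδ hm using M.exists_slope_of_edges hedge hw'
      refine ⟨_, M.ordAt_vertex (v := ⟨p, hp⟩) (m := m) fun h hh => ⟨δ h, hδ h, fun t ht => by
        rw [hm h t ht, hh]⟩, fun hpq => ?_⟩
      set v : M.V := ⟨p, hp⟩
      obtain ⟨t₀, ht₀, hmin⟩ := exists_pos_le_of_finset Finset.univ
        (fun h => min (δ h) (M.len h.1)) fun h _ => lt_min (hδ h) (M.len_pos h.1)
      set t := t₀ / 2 with ht
      have ht0 : 0 < t := by linarith
      have htδ : ∀ h, t ∈ Ico 0 (δ h) := fun h =>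
        ⟨ht0.le, by linarith [hmin h (Finset.mem_univ h), min_le_left (δ h) (M.len h.1)]⟩
      have htL : ∀ h : M.E × Bool, t ∈ Icc 0 (M.len h.1) := fun h =>
        ⟨ht0.le, by linarith [hmin h (Finset.mem_univ h), min_le_right (δ h) (M.len h.1)]⟩
      set N := (M.halfEdges v).card with hN
      have h1 : ∑ h ∈ M.halfEdges v, Fs (M.hpath h t) =
          N * Fs v + ((∑ h ∈ M.halfEdges v, m h : ℤ) : ℝ) * t := by
        push_cast
        rw [Finset.sum_mul, ← nsmul_eq_mul, ← Finset.sum_const, ← Finset.sum_add_distrib]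
        refine Finset.sum_congr rfl fun h hh => ?_
        rw [hm h t (htδ h), M.mem_halfEdges.1 hh]
      -- At a fixed small t, the bound on the sum of slopes of F becomes an inequality between
      -- values, and inequalities between values pass to the supremum.
      have h2 : ∀ F ∈ R, N * F v - D p * t ≤ ∑ h ∈ M.halfEdges v, Fs (M.hpath h t) := by
        intro F hF
        obtain ⟨κ, n, hn, hn', -, -⟩ := hR F hF
        have h3 : ∑ h ∈ M.halfEdges v, (F v + n h * t) ≤ ∑ h ∈ M.halfEdges v, Fs (M.hpath h t) :=
          Finset.sum_le_sum fun h hh => by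
            have := hn' h t (htL h)
            rw [M.mem_halfEdges.1 hh] at this
            exact this.trans (hle F hF _)
        rw [Finset.sum_add_distrib, Finset.sum_const, nsmul_eq_mul, ← Finset.sum_mul] at h3
        have h4 : (-D p : ℝ) ≤ ∑ h ∈ M.halfEdges v, (n h : ℝ) := by exact_mod_cast hn v hpq
        have h5 := mul_le_mul_of_nonneg_right h4 ht0.le
        linarith
      have h3 : N * Fs v - D p * t ≤ ∑ h ∈ M.halfEdges v, Fs (M.hpath h t) := by
        -- Passing to the supremum divides by the valence; for valence 0 the bound for `F₀` is
        -- already the claim.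
        rcases N.eq_zero_or_pos with h0 | h0
        · have := h2 F₀ hF₀R
          rw [h0] at this ⊢
          simpa using this
        · have hN0 : (0 : ℝ) < N := by exact_mod_cast h0
          have : Fs v ≤ (∑ h ∈ M.halfEdges v, Fs (M.hpath h t) + D p * t) / N :=
            hsup _ _ fun F hF => by
              rw [le_div_iff₀ hN0]
              linarith [h2 F hF]
          rw [le_div_iff₀ hN0] at this
          linarith
      rw [h1] at h3
      have h6 : (0 : ℝ) ≤ D p + ((∑ h ∈ M.halfEdges v, m h : ℤ) : ℝ) := by
        refine nonneg_of_mul_nonneg_left ?_ ht0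
        linarith
      exact_mod_cast h6
    · obtain ⟨a, ha0, ha⟩ := hw e t
      refine ⟨a, M.ordAt_of_edge (hedge e) ht ha, fun _ => ?_⟩
      rw [hDV _ (M.notMem e t ht), zero_add]
      exact ha0
  · have hGR : F₀ ⊔ G ∈ R := ⟨effectiveOff_sup hF₀ hG, fun x => le_sup_left⟩
    exact le_sup_right.trans (hle _ hGR x)

/-- For the largest F, the divisor D' = D + div F is effective away from q, hence negative at q as
|D| = ∅. If some set A of vertices without q had at every vertex as many chips as edges leaving A,
firing A would contradict maximality. So fire spreads from q to all vertices. In the burning order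
D' ≤ indeg − 1 away from q by construction, and at q because D'(q) ≤ −1. -/
theorem exists_moderator {D : Γ →₀ ℤ} (hD : linearSystem D = ∅) :
    ∃ ν E : Γ →₀ ℤ, IsModerator ν ∧ 0 ≤ E ∧ LinEquiv (D + E) ν := by
  classical
  obtain ⟨q⟩ : Nonempty Γ := inferInstance
  obtain ⟨F, hF, hmax⟩ := exists_max_effectiveOff D q
  obtain ⟨κ, hκ⟩ := exists_divisor fun p => (hF.2 p).imp fun _ h => h.1
  set D' := D + κ with hD'
  have hlin : LinEquiv D D' := linEquiv_iff.2 ⟨-F, fun p => by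
    have := (hκ p).neg
    rwa [show D p - D' p = -κ p by simp [hD']]⟩
  have hoff : ∀ p, p ≠ q → 0 ≤ D' p := fun p hp => by
    obtain ⟨a, ha, ha'⟩ := hF.2 p
    have := ha' hp
    rwa [← (hκ p).unique ha] at this
  have hq0 : D' q < 0 := by
    by_contra hq
    have : D' ∈ linearSystem D := ⟨fun p => by
      by_cases hp : p = q
      · rw [hp]
        exact not_lt.1 hq
      · exact hoff p hp, hlin⟩
    rw [hD] at this
    exact this
  obtain ⟨M, hM, hloop⟩ := exists_loopless_model (insert q D'.support)
  have hqV : q ∈ M.V := hM (Finset.mem_insert_self _ _)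
  have hDV : ∀ x ∉ M.V, D' x = 0 := fun x hx => by
    by_contra hne
    exact hx (hM (Finset.mem_insert_of_mem (Finsupp.mem_support_iff.2 hne)))
  obtain ⟨ρ, hρ, hburn⟩ := exists_burning_order (⟨q, hqV⟩ : M.V) (fun v => D' v) M.halfEdges
    (fun h => M.base (M.flip h)) fun A hA hqA => by
      by_contra! hstuck
      obtain ⟨T, ⟨v, hv, hTv⟩, hT0, hT⟩ := M.exists_fire A hA
      have hmem : F + T ∈ effectiveOff D q := by
        refine ⟨by simp [hF.1, hT0 ⟨q, hqV⟩ hqA], fun p => ?_⟩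
        obtain ⟨a, ha, ha1, ha2⟩ := hT p
        refine ⟨κ p + a, (hκ p).add ha, fun hp => ?_⟩
        have hD'p : D' p = D p + κ p := rfl
        by_cases hpA : ∃ v ∈ A, p = v
        · obtain ⟨v, hv, rfl⟩ := hpA
          have h1 := ha2 v hv rfl
          have h2 := hstuck v hv
          rw [h1]
          rw [hD'p] at h2
          convert_to 0 ≤ D v + (κ v + -((((M.halfEdges v).filter fun h => M.base (M.flip h) ∉ A).card
            : ℕ) : ℤ))
          linarith
        · push Not at hpA
          have := ha1 hpA
          linarith [hoff p hp]
      have := hmax _ hmem v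
      simp only [Pi.add_apply] at this
      linarith
  let ν : Γ → ℤ := fun x => if hx : x ∈ M.V then
    (((M.halfEdges ⟨x, hx⟩).filter fun h => ρ (M.base (M.flip h)) < ρ ⟨x, hx⟩).card : ℤ) - 1 else 0
  have hνV : ∀ x ∉ M.V, ν x = 0 := fun x hx => dif_neg hx
  have hνfin : ν.support.Finite := M.V.finite_toSet.subset fun x hx => by
    by_contra hn
    exact hx (hνV x hn)
  let N : Γ →₀ ℤ := Finsupp.ofSupportFinite ν hνfin
  have hν : ∀ v : M.V, N v =
      (((M.halfEdges v).filter fun h => ρ (M.base (M.flip h)) < ρ v).card : ℤ) - 1 :=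
    fun v => dif_pos v.2
  refine ⟨N, N - D', ⟨M, ρ, fun e he => hloop e (hρ he), hνV, fun v => ?_⟩, fun p => ?_, ?_⟩
  · rw [hν v]
  · simp only [Finsupp.coe_zero, Pi.zero_apply, Finsupp.coe_sub, Pi.sub_apply, sub_nonneg]
    by_cases hp : p ∈ M.V
    · have h1 := hν ⟨p, hp⟩
      simp only at h1
      rw [h1]
      by_cases hpq : p = q
      · subst hpq
        have : (0 : ℤ) ≤ ((M.halfEdges ⟨p, hp⟩).filter fun h =>
          ρ (M.base (M.flip h)) < ρ ⟨p, hp⟩).card := Int.natCast_nonneg _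
        linarith
      · have := hburn ⟨p, hp⟩ fun h => hpq (congrArg Subtype.val h)
        exact Int.le_sub_one_of_lt this
    · rw [hDV p hp]
      exact (hνV p hp).ge
  · exact hlin.congr (by abel)

end Reduced

/-! ### Riemann–Roch for divisors on a connected graph -/

section RiemannRoch

variable {Γ : Type u} [MetricSpace Γ]

/-- The degrees of the effective divisors that cannot be subtracted from `D`. -/
def obstructedDegrees (D : Γ →₀ ℤ) : Set ℕ :=
  {m | ∃ E : Γ →₀ ℤ, 0 ≤ E ∧ divDegree E = m ∧ linearSystem (D - E) = ∅}

variable [MetricGraph Γ] [ConnectedSpace Γ]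

theorem obstructedDegrees_mono {D : Γ →₀ ℤ} {m m' : ℕ} (h : m ∈ obstructedDegrees D)
    (hle : m ≤ m') : m' ∈ obstructedDegrees D := by
  obtain ⟨q⟩ : Nonempty Γ := inferInstance
  obtain ⟨E, hE, hm, he⟩ := h
  have hk : 0 ≤ Finsupp.single q ((m' : ℤ) - m) := Finsupp.single_nonneg.2 (by omega)
  refine ⟨E + Finsupp.single q ((m' : ℤ) - m), add_nonneg hE hk,
    by rw [divDegree_add, divDegree_single, hm]; ring,
    eq_empty_of_forall_notMem fun B ⟨hB, hlin⟩ => ?_⟩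
  have : B + Finsupp.single q ((m' : ℤ) - m) ∈ linearSystem (D - E) :=
    ⟨add_nonneg hB hk, hlin.congr (by abel)⟩
  rw [he] at this
  exact this

variable [CompactSpace Γ]

/-- This form of the obstruction is self-dual: exchanging E with E' and replacing D and ν by K − D
and K − ν preserves the relation. -/
theorem mem_obstructedDegrees_iff {D : Γ →₀ ℤ} {m : ℕ} : m ∈ obstructedDegrees D ↔
    ∃ ν E E' : Γ →₀ ℤ, IsModerator ν ∧ 0 ≤ E ∧ 0 ≤ E' ∧ divDegree E = m ∧
      LinEquiv (D + E') (ν + E) := by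
  constructor
  · rintro ⟨E, hE, hm, h⟩
    obtain ⟨ν, E', hν, hE', hlin⟩ := exists_moderator h
    exact ⟨ν, E, E', hν, hE, hE', hm, hlin.congr (by abel)⟩
  · rintro ⟨ν, E, E', hν, hE, hE', hm, hlin⟩
    refine ⟨E, hE, hm, eq_empty_of_forall_notMem fun B ⟨hB, hlin'⟩ => ?_⟩
    have : B + E' ∈ linearSystem ν := by
      refine ⟨add_nonneg hB hE', ?_⟩
      have h1 : LinEquiv ν (D - E + E') := hlin.symm.congr (by abel)
      exact h1.trans (hlin'.congr (by abel))
    rw [hν.linearSystem_eq_empty] at this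
    exact this

theorem mem_obstructedDegrees_of_lt {D : Γ →₀ ℤ} {m : ℕ} (h : divDegree D < m) :
    m ∈ obstructedDegrees D := by
  obtain ⟨q⟩ : Nonempty Γ := inferInstance
  refine ⟨Finsupp.single q m, Finsupp.single_nonneg.2 (Int.natCast_nonneg m),
    divDegree_single q m, eq_empty_of_forall_notMem fun B ⟨hB, hlin⟩ => ?_⟩
  have h1 := hlin.divDegree_eq
  rw [divDegree_sub, divDegree_single] at h1
  linarith [divDegree_nonneg hB]

/-- Obstructed degrees are upward closed, so the set in the definition of the rank is an initial
segment ending just before the least obstructed degree. The value −1 for an empty linear system is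
the case in which 0 is obstructed. -/
theorem connectedRank_add_one (D : Γ →₀ ℤ) :
    connectedRank D + 1 = (sInf (obstructedDegrees D) : ℕ) := by
  have hne : (obstructedDegrees D).Nonempty :=
    ⟨(divDegree D).toNat + 1, mem_obstructedDegrees_of_lt (by omega)⟩
  have h0 : 0 ∈ obstructedDegrees D ↔ linearSystem D = ∅ := by
    constructor
    · rintro ⟨E, hE, hm, h⟩
      rwa [eq_zero_of_divDegree_eq_zero hE (by simpa using hm), sub_zero] at h
    · intro h
      exact ⟨0, le_rfl, rfl, by rwa [sub_zero]⟩
  have hset : {r : ℕ | ∀ E : Γ →₀ ℤ, 0 ≤ E → divDegree E = r → (linearSystem (D - E)).Nonempty} =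
      Iio (sInf (obstructedDegrees D)) := by
    ext r
    rw [mem_Iio]
    have : r < sInf (obstructedDegrees D) ↔ r ∉ obstructedDegrees D := by
      refine ⟨fun h hr => absurd (Nat.sInf_le hr) (not_le.2 h), fun h => ?_⟩
      by_contra hn
      exact h (obstructedDegrees_mono (Nat.sInf_mem hne) (not_lt.1 hn))
    rw [this]
    simp only [obstructedDegrees, mem_ofPred_eq, not_exists, not_and, ← nonempty_iff_ne_empty,
      ← ne_eq]
  rw [connectedRank]
  split_ifs with h
  · rw [hset]
    have hpos : 0 < sInf (obstructedDegrees D) := by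
      rw [Nat.pos_iff_ne_zero]
      intro h'
      have := Nat.sInf_mem hne
      rw [h', h0] at this
      exact h.ne_empty this
    obtain ⟨k, hk⟩ := Nat.exists_eq_add_one_of_ne_zero hpos.ne'
    have : sSup (Iio (k + 1)) = k := by
      rw [show Iio (k + 1) = Iic k by ext; simp]
      exact csSup_Iic
    rw [hk, this]
    push_cast
    ring
  · have := h0.2 (not_nonempty_iff_eq_empty.1 h)
    have := Nat.sInf_le this
    rw [Nat.le_zero.1 this]
    simp

theorem exists_obstructedDegrees_dual {D : Γ →₀ ℤ} {m : ℕ} (h : m ∈ obstructedDegrees D) :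
    ∃ m' ∈ obstructedDegrees (canonDiv Γ - D),
      2 * (m' : ℤ) = divDegree (canonDiv Γ) + 2 * m - 2 * divDegree D := by
  obtain ⟨ν, E, E', hν, hE, hE', hm, hlin⟩ := mem_obstructedDegrees_iff.1 h
  have hnn := divDegree_nonneg hE'
  have hdeg := hlin.divDegree_eq
  rw [divDegree_add, divDegree_add] at hdeg
  refine ⟨(divDegree E').toNat, mem_obstructedDegrees_iff.2 ⟨canonDiv Γ - ν, E', E, hν.canonDiv_sub,
    hE', hE, (Int.toNat_of_nonneg hnn).symm, hlin.symm.congr (by abel)⟩, ?_⟩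
  rw [Int.toNat_of_nonneg hnn]
  linarith [hν.two_mul_divDegree]

/-- The Riemann–Roch theorem for divisors on a compact connected metric graph. -/
theorem riemannRoch_connected (D : Γ →₀ ℤ) :
    2 * (connectedRank D - connectedRank (canonDiv Γ - D)) =
      2 * divDegree D - divDegree (canonDiv Γ) := by
  have hne : ∀ D : Γ →₀ ℤ, (obstructedDegrees D).Nonempty := fun D =>
    ⟨(divDegree D).toNat + 1, mem_obstructedDegrees_of_lt (by omega)⟩
  -- One inequality for all D suffices; its instance at K − D is the reverse one. Everything is
  -- doubled to avoid halving deg K.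
  have key : ∀ D : Γ →₀ ℤ, 2 * ((sInf (obstructedDegrees (canonDiv Γ - D)) : ℕ) : ℤ) ≤
      divDegree (canonDiv Γ) + 2 * (sInf (obstructedDegrees D) : ℕ) - 2 * divDegree D := by
    intro D
    obtain ⟨m', hm', h⟩ := exists_obstructedDegrees_dual (Nat.sInf_mem (hne D))
    have : ((sInf (obstructedDegrees (canonDiv Γ - D)) : ℕ) : ℤ) ≤ m' := by
      exact_mod_cast Nat.sInf_le hm'
    linarith
  have h1 := key D
  have h2 := key (canonDiv Γ - D)
  rw [sub_sub_cancel, divDegree_sub] at h2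
  have h3 := connectedRank_add_one D
  have h4 := connectedRank_add_one (canonDiv Γ - D)
  linarith

end RiemannRoch

/-! ### Passage to disconnected graphs -/

section Components

variable {X : Type u} [MetricSpace X]

theorem restrictComponent_apply (D : X →₀ ℤ) (c : ConnectedComponents X) (x : Component c) :
    restrictComponent D c x = D x := rfl

theorem restrictComponent_add (D D' : X →₀ ℤ) (c : ConnectedComponents X) :
    restrictComponent (D + D') c = restrictComponent D c + restrictComponent D' c := by
  ext x
  rfl

theorem restrictComponent_sub (D D' : X →₀ ℤ) (c : ConnectedComponents X) :
    restrictComponent (D - D') c = restrictComponent D c - restrictComponent D' c := by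
  ext x
  rfl

variable [MetricGraph X]

theorem isOpen_component (c : ConnectedComponents X) :
    IsOpen {x : X | ConnectedComponents.mk x = c} :=
  (isOpen_discrete {c}).preimage ConnectedComponents.continuous_coe

theorem LocIso.component (c : ConnectedComponents X) : LocIso (Subtype.val : Component c → X) :=
  LocIso.subtypeVal (isOpen_component c)

instance (c : ConnectedComponents X) : MetricGraph (Component c) := (LocIso.component c).metricGraph

instance (c : ConnectedComponents X) : ConnectedSpace (Component c) := by
  obtain ⟨x, rfl⟩ := ConnectedComponents.surjective_coe c
  have h : {y : X | ConnectedComponents.mk y = ConnectedComponents.mk x} = connectedComponent x :=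
    connectedComponents_preimage_singleton
  have h' : _root_.IsConnected {y : X | ConnectedComponents.mk y = ConnectedComponents.mk x} := by
    rw [h]
    exact isConnected_connectedComponent
  exact isConnected_iff_connectedSpace.1 h'

variable [CompactSpace X]

instance (c : ConnectedComponents X) : CompactSpace (Component c) :=
  isCompact_iff_compactSpace.1
    ((isClosed_singleton (x := c)).preimage ConnectedComponents.continuous_coe).isCompact

theorem restrictComponent_canonDiv (c : ConnectedComponents X) :
    restrictComponent (canonDiv X) c = canonDiv (Component c) := by
  ext x
  rw [restrictComponent_apply, canonDiv_apply, canonDiv_apply, (LocIso.component c).valence_eq]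

theorem divDegree_eq_sum_component (D : X →₀ ℤ) :
    divDegree D = ∑ᶠ c : ConnectedComponents X, divDegree (restrictComponent D c) := by
  classical
  have := Fintype.ofFinite (ConnectedComponents X)
  rw [finsum_eq_sum_of_fintype]
  induction D using Finsupp.induction_linear with
  | zero => simp [divDegree, restrictComponent]
  | add D D' h h' =>
    rw [divDegree_add, h, h', ← Finset.sum_add_distrib]
    refine Finset.sum_congr rfl fun c _ => ?_
    rw [← divDegree_add, restrictComponent_add]
  | single x a =>
    rw [Finset.sum_eq_single (ConnectedComponents.mk x)]
    · have : restrictComponent (Finsupp.single x a) (ConnectedComponents.mk x) =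
          Finsupp.single ⟨x, rfl⟩ a := by
        ext y
        simp only [restrictComponent_apply, Finsupp.single_apply, Subtype.ext_iff]
      rw [this, divDegree_single, divDegree_single]
    · intro c _ hc
      have : restrictComponent (Finsupp.single x a) c = 0 := by
        ext y
        rw [restrictComponent_apply, Finsupp.single_apply, if_neg]
        · rfl
        · rintro rfl
          exact hc y.2.symm
      rw [this]
      rfl
    · simp

/-- The Riemann–Roch theorem for divisors on a compact metric graph. -/
theorem riemannRoch_divRank (D : X →₀ ℤ) :
    2 * (divRank D - divRank (canonDiv X - D)) = 2 * divDegree D - divDegree (canonDiv X) := by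
  have := Fintype.ofFinite (ConnectedComponents X)
  rw [divRank, divRank, divDegree_eq_sum_component D, divDegree_eq_sum_component (canonDiv X)]
  simp only [finsum_eq_sum_of_fintype]
  rw [sub_sub_sub_cancel_right, ← Finset.sum_sub_distrib, Finset.mul_sum, Finset.mul_sum,
    ← Finset.sum_sub_distrib]
  refine Finset.sum_congr rfl fun c _ => ?_
  have h : restrictComponent (canonDiv X - D) c =
      canonDiv (Component c) - restrictComponent D c := by
    rw [← restrictComponent_canonDiv, restrictComponent_sub]
  rw [h, restrictComponent_canonDiv, ← riemannRoch_connected]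
  ring

end Components

/-! ### Invariance of the rank under locally isometric homeomorphisms -/

section Transport

variable {X Y : Type u} [MetricSpace X] [MetricSpace Y]

/-- Locally `g` is injective and isometric, so `f` is determined by `g ∘ f` near each point. -/
theorem LocIso.of_comp {Z : Type u} [MetricSpace Z] {g : Y → Z} {f : X → Y} (hg : LocIso g)
    (hf : Continuous f) (hgf : LocIso (g ∘ f)) : LocIso f where
  isOpenMap := by
    refine isOpenMap_iff_nhds_le.2 fun x s hs => ?_
    obtain ⟨ε, hε, hi⟩ := hg.isometric (f x)
    have h1 : f ⁻¹' Metric.ball (f x) ε ∩ f ⁻¹' s ∈ 𝓝 x :=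
      inter_mem (hf.continuousAt (Metric.ball_mem_nhds _ hε)) hs
    have h2 := hg.continuous.continuousAt (hgf.isOpenMap.image_mem_nhds h1)
    filter_upwards [h2, Metric.ball_mem_nhds (f x) hε] with y hy hyb
    obtain ⟨z, hz, hzy⟩ := hy
    have : f z = y := by
      rw [← dist_eq_zero, ← hi _ hz.1 _ hyb, dist_eq_zero]
      exact hzy
    exact this ▸ hz.2
  isometric x := by
    obtain ⟨ε, hε, hi⟩ := hg.isometric (f x)
    obtain ⟨ε', hε', hi'⟩ := hgf.isometric x
    obtain ⟨δ, hδ, hb⟩ := Metric.continuousAt_iff.1 (hf.continuousAt (x := x)) ε hε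
    refine ⟨min ε' δ, lt_min hε' hδ, fun y hy z hz => ?_⟩
    rw [← hi _ (hb (hy.trans_le (min_le_right _ _))) _ (hb (hz.trans_le (min_le_right _ _)))]
    exact hi' y (Metric.ball_subset_ball (min_le_left _ _) hy) z
      (Metric.ball_subset_ball (min_le_left _ _) hz)

theorem LocIso.comp {Z : Type u} [MetricSpace Z] {g : Y → Z} {f : X → Y} (hg : LocIso g)
    (hf : LocIso f) : LocIso (g ∘ f) where
  isOpenMap := hg.isOpenMap.comp hf.isOpenMap
  isometric x := by
    obtain ⟨ε, hε, hi⟩ := hg.isometric (f x)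
    obtain ⟨ε', hε', hi'⟩ := hf.isometric x
    refine ⟨min ε ε', lt_min hε hε', fun y hy z hz => ?_⟩
    have key : ∀ y ∈ Metric.ball x (min ε ε'), f y ∈ Metric.ball (f x) ε := fun y hy => by
      rw [Metric.mem_ball, hi' y (Metric.ball_subset_ball (min_le_right _ _) hy) x (Metric.mem_ball_self hε')]
      exact hy.trans_le (min_le_left _ _)
    rw [← hi' y (Metric.ball_subset_ball (min_le_right _ _) hy) z
      (Metric.ball_subset_ball (min_le_right _ _) hz)]
    exact hi _ (key y hy) _ (key z hz)

variable [MetricGraph X] [MetricGraph Y]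

/-- The function F makes D equivalent to the pullback of D'. Adding or subtracting it turns
functions witnessing |D − E| ≠ ∅ into functions witnessing the same for D' and the transported E,
and conversely. -/
theorem connectedRank_eq_of_locIso (e : X ≃ Y) (he : LocIso e) {D : X →₀ ℤ} {D' : Y →₀ ℤ}
    {F : X → ℝ} (hF : ∀ x, OrdAt F x (D x - D' (e x))) : connectedRank D = connectedRank D' := by
  have hls : ∀ (E : X →₀ ℤ) (E' : Y →₀ ℤ), (∀ x, E' (e x) = E x) →
      ((linearSystem (D - E)).Nonempty ↔ (linearSystem (D' - E')).Nonempty) := by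
    intro E E' hE
    constructor
    · rintro ⟨B, hB, hlin⟩
      obtain ⟨G, hG⟩ := linEquiv_iff.1 hlin
      refine ⟨B.equivMapDomain e, fun y => hB _, linEquiv_iff.2 ⟨(G - F) ∘ e.symm, fun y => ?_⟩⟩
      obtain ⟨x, rfl⟩ := e.surjective y
      rw [← he.ordAt_comp_iff]
      have h1 : ((G - F) ∘ e.symm) ∘ e = G - F := by
        ext x
        simp
      rw [h1]
      have h2 := (hG x).sub (hF x)
      convert h2 using 1
      simp only [Finsupp.coe_sub, Pi.sub_apply, Finsupp.equivMapDomain_apply,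
        Equiv.symm_apply_apply, hE]
      ring
    · rintro ⟨B, hB, hlin⟩
      obtain ⟨G, hG⟩ := linEquiv_iff.1 hlin
      refine ⟨B.equivMapDomain e.symm, fun y => hB _, linEquiv_iff.2 ⟨G ∘ e + F, fun x => ?_⟩⟩
      have h2 := (he.ordAt_comp_iff.2 (hG (e x))).add (hF x)
      convert h2 using 1
      simp only [Finsupp.coe_sub, Pi.sub_apply, Finsupp.equivMapDomain_apply, Equiv.symm_symm, hE]
      ring
  have hdeg : ∀ E : X →₀ ℤ, divDegree (E.equivMapDomain e) = divDegree E := fun E => by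
    rw [divDegree, divDegree, Finsupp.equivMapDomain_eq_mapDomain,
      Finsupp.sum_mapDomain_index (fun _ => rfl) fun _ _ _ => rfl]
  have hset : {r : ℕ | ∀ E : X →₀ ℤ, 0 ≤ E → divDegree E = r → (linearSystem (D - E)).Nonempty} =
      {r : ℕ | ∀ E : Y →₀ ℤ, 0 ≤ E → divDegree E = r → (linearSystem (D' - E)).Nonempty} := by
    ext r
    constructor
    · intro h E hE hr
      have h1 : (E.equivMapDomain e.symm).equivMapDomain e = E := by
        ext y
        simp
      refine (hls (E.equivMapDomain e.symm) E fun x => by simp).1 (h _ (fun y => hE _) ?_)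
      rw [← hdeg, h1, hr]
    · intro h E hE hr
      exact (hls E (E.equivMapDomain e) fun x => by simp).2
        (h _ (fun y => hE _) ((hdeg E).trans hr))
  have h0 := hls 0 0 fun _ => rfl
  rw [sub_zero, sub_zero] at h0
  rw [connectedRank, connectedRank, hset]
  by_cases h : (linearSystem D).Nonempty
  · rw [if_pos h, if_pos (h0.1 h)]
  · rw [if_neg h, if_neg fun h' => h (h0.2 h')]

theorem divRank_eq_of_locIso (e : X ≃ₜ Y) (he : LocIso e) {D : X →₀ ℤ} {D' : Y →₀ ℤ}
    {F : X → ℝ} (hF : ∀ x, OrdAt F x (D x - D' (e x))) : divRank D = divRank D' := by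
  let φ : ConnectedComponents X → ConnectedComponents Y := e.continuous.connectedComponentsMap
  have hφ : ∀ x, φ (ConnectedComponents.mk x) = ConnectedComponents.mk (e x) := fun x => rfl
  let ψ : ConnectedComponents Y → ConnectedComponents X := e.symm.continuous.connectedComponentsMap
  have hψ : ∀ y, ψ (ConnectedComponents.mk y) = ConnectedComponents.mk (e.symm y) := fun x => rfl
  have hψφ : ∀ c, ψ (φ c) = c := fun c => by
    obtain ⟨x, rfl⟩ := ConnectedComponents.surjective_coe c
    rw [hφ, hψ, e.symm_apply_apply]
  have hφψ : ∀ c, φ (ψ c) = c := fun c => by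
    obtain ⟨x, rfl⟩ := ConnectedComponents.surjective_coe c
    rw [hψ, hφ, e.apply_symm_apply]
  rw [divRank, divRank]
  congr 1
  refine finsum_eq_of_bijective φ (Function.bijective_iff_has_inverse.2 ⟨ψ, hψφ, hφψ⟩) fun c => ?_
  have hmem : ∀ x, ConnectedComponents.mk x = c ↔ ConnectedComponents.mk (e x) = φ c := fun x => by
    rw [← hφ]
    exact ⟨fun h => by rw [h], fun h => by rw [← hψφ c, ← h, hψφ]⟩
  let ec : Component c ≃ Component (φ c) := e.toEquiv.subtypeEquiv hmem
  have hec : LocIso ec := by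
    refine (LocIso.component (φ c)).of_comp ?_ (he.comp (LocIso.component c))
    exact (e.continuous.comp continuous_subtype_val).subtype_mk _
  rw [connectedRank_eq_of_locIso ec hec (D' := restrictComponent D' (φ c)) (F := F ∘ Subtype.val) fun x =>
    (LocIso.component c).ordAt_comp_iff.2 (hF x)]

end Transport

/-! ### Frames of a pushforward and independence of the multidivisor -/

namespace Multidivisor

variable {Γ : Type u} [MetricSpace Γ] {n : ℕ} (M : Multidivisor Γ n)

theorem locIso : LocIso M.f := ⟨M.isCoveringMap.isOpenMap, M.isometric⟩

instance [MetricGraph Γ] : MetricGraph M.X := M.locIso.metricGraph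

variable {M} {U V : Opens Γ}

/-- The numbering of the sheets that belongs to a frame. -/
def sheet (s : M.pushforward.Sec U) (p : U) : Fin n ≃ M.f ⁻¹' {p.1} := (s.1 p).1

/-- The functions on the sheets that belong to a frame. -/
def entry (s : M.pushforward.Sec U) (i : Fin n) (p : U) : ℝ := (s.1 p).2 i

theorem continuous_sheet (s : M.pushforward.Sec U) (i : Fin n) :
    Continuous fun p => (sheet s p i : M.X) := (s.2 i).1

theorem hasOrd_entry (s : M.pushforward.Sec U) (i : Fin n) (p : U) :
    HasOrd (entry s i) p (M.D (sheet s p i)) := (s.2 i).2 p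

theorem f_sheet (s : M.pushforward.Sec U) (p : U) (i : Fin n) : M.f (sheet s p i) = p :=
  (sheet s p i).2

/-- The frame with given sheets and functions. -/
def mkFrame (σ : ∀ p : U, Fin n ≃ M.f ⁻¹' {p.1}) (w : Fin n → U → ℝ)
    (hσ : ∀ i, Continuous fun p => (σ p i : M.X))
    (hw : ∀ i p, HasOrd (w i) p (M.D (σ p i))) : M.pushforward.Sec U :=
  ⟨fun p => (σ p, fun i => w i p), fun i => ⟨hσ i, hw i⟩⟩

theorem frame_ext {s t : M.pushforward.Sec U} (h : ∀ p i, (sheet s p i : M.X) = sheet t p i)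
    (h' : ∀ i p, entry s i p = entry t i p) : s = t :=
  Subtype.ext (funext fun p => Prod.ext (Equiv.ext fun i => Subtype.ext (h p i))
    (funext fun i => h' i p))

theorem sheet_smul (g : TGL n U) (s : M.pushforward.Sec U) (p : U) (i : Fin n) :
    sheet (g • s) p i = sheet s p ((g.perm p)⁻¹ i) := rfl

theorem entry_smul (g : TGL n U) (s : M.pushforward.Sec U) (i : Fin n) (p : U) :
    entry (g • s) i p = (g.fn i).1 p + entry s ((g.perm p)⁻¹ i) p := rfl

theorem exists_sheet (s : M.pushforward.Sec U) {x : M.X} (hx : M.f x ∈ U) :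
    ∃ i, (sheet s ⟨M.f x, hx⟩ i : M.X) = x :=
  ⟨(sheet s ⟨M.f x, hx⟩).symm ⟨x, rfl⟩, by rw [Equiv.apply_symm_apply]⟩

theorem sheet_injective (s : M.pushforward.Sec U) (p : U) {i j : Fin n}
    (h : (sheet s p i : M.X) = sheet s p j) : i = j :=
  (sheet s p).injective (Subtype.ext h)

/-- Continuous sheets that agree at a point agree in a neighbourhood. -/
theorem eventually_eq_of_sections {A : Type*} [TopologicalSpace A] {a b : A → M.X}
    (ha : Continuous a) (hb : Continuous b) (hab : ∀ p, M.f (a p) = M.f (b p)) {p : A}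
    (hp : a p = b p) : ∀ᶠ q in 𝓝 p, a q = b q := by
  obtain ⟨ε, hε, hi⟩ := M.isometric (a p)
  filter_upwards [ha.continuousAt (Metric.ball_mem_nhds (a p) hε),
    hb.continuousAt (Metric.ball_mem_nhds (b p) hε)] with q h1 h2
  rw [← hp] at h2
  rw [← dist_eq_zero, ← hi _ h1 _ h2, hab, dist_self]

theorem eventually_sheet_eq (s : M.pushforward.Sec U) (x : M.X) (hx : M.f x ∈ U) {i : Fin n}
    (hi : (sheet s ⟨M.f x, hx⟩ i : M.X) = x) :
    ∀ᶠ y in 𝓝 x, ∀ hy : M.f y ∈ U, (sheet s ⟨M.f y, hy⟩ i : M.X) = y := by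
  have hopen : IsOpen {y | M.f y ∈ U} := U.isOpen.preimage M.locIso.continuous
  have h := eventually_eq_of_sections (A := {y // M.f y ∈ U}) (p := ⟨x, hx⟩)
    (a := fun y => (sheet s ⟨M.f y, y.2⟩ i : M.X)) (b := fun y => y.1)
    ((continuous_sheet s i).comp ((M.locIso.continuous.comp continuous_subtype_val).subtype_mk _))
    continuous_subtype_val (fun y => f_sheet s _ i) hi
  have h' := (hopen.isOpenEmbedding_subtypeVal.map_nhds_eq ⟨x, hx⟩)
  rw [← h', Filter.eventually_map]
  filter_upwards [h] with y hy _ using hy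

/-- Two numberings of the sheets differ by a locally constant permutation, since continuous sheets
that agree at a point agree nearby. On a common sheet the two functions have the same divisor, so
their difference is harmonic. -/
theorem exists_smul_eq (s t : M.pushforward.Sec U) : ∃ g : TGL n U, g • s = t := by
  let σ : U → Equiv.Perm (Fin n) := fun p => (sheet s p).trans (sheet t p).symm
  have hσ : ∀ p i, sheet s p ((σ p)⁻¹ i) = sheet t p i := fun p i => by
    change sheet s p ((sheet s p).symm (sheet t p i)) = _
    rw [Equiv.apply_symm_apply]
  have hloc : ∀ p, ∀ᶠ q in 𝓝 p, σ q = σ p := by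
    intro p
    have : ∀ i, ∀ᶠ q in 𝓝 p, (sheet s q ((σ p)⁻¹ i) : M.X) = sheet t q i := fun i =>
      eventually_eq_of_sections (continuous_sheet s _) (continuous_sheet t i)
        (fun q => by rw [f_sheet, f_sheet]) (by rw [hσ])
    filter_upwards [eventually_all.2 this] with q hq
    rw [← inv_inj]
    ext1 i
    refine sheet_injective s q ?_
    rw [hσ, hq]
  let σc : LocallyConstant U (Equiv.Perm (Fin n)) := ⟨σ, IsLocallyConstant.iff_eventually_eq _ |>.2 hloc⟩
  refine ⟨⟨σc, fun i => ⟨fun p => entry t i p - entry s ((σ p)⁻¹ i) p, fun p => ?_⟩⟩,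
    frame_ext (fun p i => ?_) fun i p => ?_⟩
  · have h1 := (hasOrd_entry t i p).add (hasOrd_entry s ((σ p)⁻¹ i) p).neg
    rw [hσ, add_neg_cancel] at h1
    obtain ⟨W, hW, hWo, hp⟩ := _root_.mem_nhds_iff.1 (hloc p)
    obtain ⟨W', hW', rfl⟩ := isOpen_induced_iff.1 hWo
    refine h1.of_eq (W := ⟨W', hW'⟩) p.2 p.2 hp fun x hx hU _ => ?_
    have : σ ⟨x, hU⟩ = σ p := hW hx
    rw [this]
    exact (sub_eq_add_neg _ _).symm
  · rw [sheet_smul]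
    exact congrArg _ (hσ p i)
  · rw [entry_smul]
    exact sub_add_cancel _ _

/-- Finitely many compact subsets of Γ with frames near them cover, and the cover is the union of
their images under the n sheets. -/
theorem compactSpace [CompactSpace Γ]
    (hloc : ∀ p : Γ, ∃ U : Opens Γ, p ∈ U ∧ Nonempty (M.pushforward.Sec U)) : CompactSpace M.X := by
  choose U hU s using hloc
  replace s := fun p => (s p).some
  have hK : ∀ p, ∃ K ∈ 𝓝 p, IsCompact K ∧ K ⊆ U p := fun p => by
    obtain ⟨K, hK, hKU, hKc⟩ := local_compact_nhds ((U p).isOpen.mem_nhds (hU p))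
    exact ⟨K, hK, hKc, hKU⟩
  choose K hKn hKc hKU using hK
  obtain ⟨t, -, ht⟩ := isCompact_univ.elim_nhds_subcover K fun p _ => hKn p
  have hc : IsCompact (⋃ p ∈ t, ⋃ i : Fin n,
      (fun q : U p => (sheet (s p) q i : M.X)) '' (Subtype.val ⁻¹' K p)) := by
    refine t.isCompact_biUnion fun p _ => isCompact_iUnion fun i => ?_
    refine IsCompact.image ?_ (continuous_sheet (s p) i)
    rw [Subtype.isCompact_iff, image_preimage_eq_of_subset (by simpa using hKU p)]
    exact hKc p
  refine ⟨hc.of_isClosed_subset isClosed_univ fun x _ => ?_⟩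
  obtain ⟨p, hp, hx⟩ := mem_iUnion₂.1 (ht (mem_univ (M.f x)))
  obtain ⟨i, hi⟩ := exists_sheet (s p) (hKU p hx)
  exact mem_iUnion₂.2 ⟨p, hp, mem_iUnion.2 ⟨i, ⟨M.f x, hKU p hx⟩, hx, hi⟩⟩

/-- An isomorphism α sends a frame s to a frame α s, and equivariance makes the assignment from the
i-th sheet of s to the i-th sheet of α s independent of s. It glues to a homeomorphism θ of the
covers over Γ. Likewise the differences of the i-th entries of s and α s glue to a function F with
div F = D − θ^*D'. This is why the rank of a bundle is well defined. -/
theorem divRank_eq_of_isIso [MetricGraph Γ] {M M' : Multidivisor Γ n}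
    (h : M.pushforward.IsIso M'.pushforward)
    (hloc : ∀ p : Γ, ∃ U : Opens Γ, p ∈ U ∧ Nonempty (M.pushforward.Sec U)) :
    divRank M.D = divRank M'.D := by
  obtain ⟨α, hres, hsmul⟩ := h
  -- The same group element takes s to t and α s to α t, so its permutation and functions cancel
  -- from the comparison.
  have hind : ∀ (U V : Opens Γ) (s : M.pushforward.Sec U) (t : M.pushforward.Sec V) (p : Γ)
      (hU : p ∈ U) (hV : p ∈ V) (i j : Fin n),
      (sheet s ⟨p, hU⟩ i : M.X) = sheet t ⟨p, hV⟩ j →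
      (sheet (α U s) ⟨p, hU⟩ i : M'.X) = sheet (α V t) ⟨p, hV⟩ j ∧
      entry s i ⟨p, hU⟩ - entry (α U s) i ⟨p, hU⟩ = entry t j ⟨p, hV⟩ - entry (α V t) j ⟨p, hV⟩ := by
    intro U V s t p hU hV i j hij
    let q : (U ⊓ V : Opens Γ) := ⟨p, hU, hV⟩
    obtain ⟨g, hg⟩ := exists_smul_eq (M.pushforward.res inf_le_left s : M.pushforward.Sec (U ⊓ V))
      (M.pushforward.res inf_le_right t)
    have hg' : g • M'.pushforward.res inf_le_left (α U s) =
        M'.pushforward.res inf_le_right (α V t) := by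
      rw [← hres, ← hsmul, hg, hres]
    have h1 : ∀ j, sheet s ⟨p, hU⟩ ((g.perm q)⁻¹ j) = sheet t ⟨p, hV⟩ j := fun j => by
      have := congrArg (fun s => sheet s q j) hg
      exact this
    have h2 : sheet (α U s) ⟨p, hU⟩ ((g.perm q)⁻¹ j) = sheet (α V t) ⟨p, hV⟩ j := by
      have := congrArg (fun s => sheet s q j) hg'
      exact this
    have h3 : (g.fn j).1 q + entry s ((g.perm q)⁻¹ j) ⟨p, hU⟩ = entry t j ⟨p, hV⟩ := by
      have := congrArg (fun s => entry s j q) hg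
      exact this
    have h4 : (g.fn j).1 q + entry (α U s) ((g.perm q)⁻¹ j) ⟨p, hU⟩ = entry (α V t) j ⟨p, hV⟩ := by
      have := congrArg (fun s => entry s j q) hg'
      exact this
    have hi : i = (g.perm q)⁻¹ j := sheet_injective s _ (by rw [h1, hij])
    subst hi
    exact ⟨congrArg _ h2, by linarith⟩
  choose U hU s using hloc
  replace s := fun p => (s p).some
  choose ι hι using fun x : M.X => exists_sheet (s (M.f x)) (hU (M.f x))
  let θ : M.X → M'.X := fun x => sheet (α _ (s (M.f x))) ⟨M.f x, hU _⟩ (ι x)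
  let F : M.X → ℝ := fun x => entry (s (M.f x)) (ι x) ⟨M.f x, hU _⟩ -
    entry (α _ (s (M.f x))) (ι x) ⟨M.f x, hU _⟩
  have hf : ∀ x, M'.f (θ x) = M.f x := fun x => f_sheet _ _ _
  have hθF : ∀ (V : Opens Γ) (t : M.pushforward.Sec V) (x : M.X) (hx : M.f x ∈ V) (j : Fin n),
      (sheet t ⟨M.f x, hx⟩ j : M.X) = x → θ x = sheet (α V t) ⟨M.f x, hx⟩ j ∧
        F x = entry t j ⟨M.f x, hx⟩ - entry (α V t) j ⟨M.f x, hx⟩ := fun V t x hx j hj =>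
    hind _ _ _ _ _ _ _ _ _ ((hι x).trans hj.symm)
  have hev : ∀ x, ∀ᶠ y in 𝓝 x, ∃ hy : M.f y ∈ U (M.f x),
      θ y = sheet (α _ (s (M.f x))) ⟨M.f y, hy⟩ (ι x) ∧
      F y = entry (s (M.f x)) (ι x) ⟨M.f y, hy⟩ -
        entry (α _ (s (M.f x))) (ι x) ⟨M.f y, hy⟩ := fun x => by
    filter_upwards [eventually_sheet_eq (s (M.f x)) x (hU _) (hι x),
      M.locIso.continuous.continuousAt ((U (M.f x)).isOpen.mem_nhds (hU _))] with y hy hyU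
    exact ⟨hyU, hθF _ _ y hyU _ (hy hyU)⟩
  have hcont : Continuous θ := continuous_iff_continuousAt.2 fun x => by
    have h1 : ContinuousAt (fun y : {y // M.f y ∈ U (M.f x)} =>
        (sheet (α _ (s (M.f x))) ⟨M.f y, y.2⟩ (ι x) : M'.X)) ⟨x, hU _⟩ :=
      ((continuous_sheet _ _).comp
        ((M.locIso.continuous.comp continuous_subtype_val).subtype_mk _)).continuousAt
    have hopen : IsOpen {y | M.f y ∈ U (M.f x)} := (U _).isOpen.preimage M.locIso.continuous
    refine (hopen.isOpenEmbedding_subtypeVal.continuousAt_iff (x := ⟨x, hU _⟩)).1 (h1.congr ?_)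
    filter_upwards [continuous_subtype_val.continuousAt (hev x)] with y hy
    exact hy.2.1.symm
  have hinj : Function.Injective θ := fun x y hxy => by
    have hfxy : M.f y = M.f x := by rw [← hf, ← hf, hxy]
    obtain ⟨j, hj⟩ := exists_sheet (s (M.f x)) (x := y) (hfxy ▸ hU _)
    have h1 := (hθF _ _ y (hfxy ▸ hU _) j hj).1
    have h2 : (⟨M.f y, hfxy ▸ hU _⟩ : U (M.f x)) = ⟨M.f x, hU _⟩ := Subtype.ext hfxy
    rw [← hxy] at h1
    have h3 : (sheet (α _ (s (M.f x))) ⟨M.f x, hU _⟩ (ι x) : M'.X) =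
        sheet (α _ (s (M.f x))) ⟨M.f x, hU _⟩ j := by
      rw [h2] at h1
      exact h1
    have h4 := sheet_injective _ _ h3
    rw [h2, ← h4] at hj
    exact (hι x).symm.trans hj
  have hsurj : Function.Surjective θ := fun y => by
    obtain ⟨j, hj⟩ := exists_sheet (α _ (s (M'.f y))) (x := y) (hU _)
    let x : M.X := sheet (s (M'.f y)) ⟨M'.f y, hU _⟩ j
    have hx : M.f x = M'.f y := f_sheet _ _ _
    refine ⟨x, ?_⟩
    have h2 : (⟨M.f x, hx ▸ hU _⟩ : U (M'.f y)) = ⟨M'.f y, hU _⟩ := Subtype.ext hx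
    rw [(hθF _ (s (M'.f y)) x (hx ▸ hU _) j (by rw [h2])).1, h2, hj]
  have hθ : LocIso θ := by
    refine M'.locIso.of_comp hcont ?_
    rw [show M'.f ∘ θ = M.f from funext hf]
    exact M.locIso
  let e : M.X ≃ₜ M'.X := (Equiv.ofBijective θ ⟨hinj, hsurj⟩).toHomeomorphOfContinuousOpen hcont
    hθ.isOpenMap
  refine divRank_eq_of_locIso e hθ (F := F) fun x => ?_
  have h1 := (hasOrd_entry (s (M.f x)) (ι x) ⟨M.f x, hU _⟩).add
    (hasOrd_entry (α _ (s (M.f x))) (ι x) ⟨M.f x, hU _⟩).neg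
  rw [hι x, ← sub_eq_add_neg] at h1
  refine (M.locIso.ordAt_comp_iff.2 (hasOrd_iff.1 h1)).congr ?_
  filter_upwards [hev x] with y hy
  obtain ⟨hy, -, hFy⟩ := hy
  rw [hFy, Function.comp_apply, extendZero_of_mem _ hy]
  exact (sub_eq_add_neg _ _).symm

theorem mapDomain_apply_eq_sum (D : M.X →₀ ℤ) (s : M.pushforward.Sec U) (p : U) :
    D.mapDomain M.f p = ∑ i, D (sheet s p i) := by
  classical
  induction D using Finsupp.induction_linear with
  | zero => simp
  | add D D' h h' => simp [Finsupp.mapDomain_add, h, h', Finset.sum_add_distrib]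
  | single x a =>
    rw [Finsupp.mapDomain_single, Finsupp.single_apply]
    by_cases hx : M.f x = p
    · have hx' : M.f x ∈ U := hx ▸ p.2
      obtain rfl : p = ⟨M.f x, hx'⟩ := Subtype.ext hx.symm
      obtain ⟨i, hi⟩ := exists_sheet s hx'
      rw [if_pos rfl, Finset.sum_eq_single i]
      · rw [hi, Finsupp.single_eq_same]
      · intro j _ hj
        rw [Finsupp.single_apply, if_neg]
        intro h
        exact hj (sheet_injective s _ (h.symm.trans hi.symm))
      · simp
    · rw [if_neg hx]
      refine (Finset.sum_eq_zero fun i _ => ?_).symm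
      rw [Finsupp.single_apply, if_neg]
      rintro rfl
      exact hx (f_sheet s p i)

theorem divDegree_mapDomain (D : M.X →₀ ℤ) : divDegree (D.mapDomain M.f) = divDegree D :=
  Finsupp.sum_mapDomain_index (fun _ => rfl) fun _ _ _ => rfl

/-- Riemann–Hurwitz without ramification: local isometries preserve valences, so K_X is the pullback
of K_Γ and its pushforward is n K_Γ. -/
theorem divDegree_canonDiv [MetricGraph Γ] [CompactSpace Γ] [CompactSpace M.X]
    (hloc : ∀ p : Γ, ∃ U : Opens Γ, p ∈ U ∧ Nonempty (M.pushforward.Sec U)) :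
    divDegree (canonDiv M.X) = n * divDegree (canonDiv Γ) := by
  have h : (canonDiv M.X).mapDomain M.f = n • canonDiv Γ := by
    ext p
    obtain ⟨U, hU, ⟨s⟩⟩ := hloc p
    rw [mapDomain_apply_eq_sum _ s ⟨p, hU⟩]
    have : ∀ i, canonDiv M.X (sheet s ⟨p, hU⟩ i) = canonDiv Γ p := fun i => by
      rw [canonDiv_apply, M.locIso.valence_eq, f_sheet, canonDiv_apply]
    simp [this]
  have h' : ∀ k : ℕ, divDegree (k • canonDiv Γ) = k * divDegree (canonDiv Γ) := fun k => by
    induction k with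
    | zero => simp [divDegree]
    | succ k ih =>
      rw [succ_nsmul, divDegree_add, ih]
      push_cast
      ring
  rw [← divDegree_mapDomain, h, h']

end Multidivisor

/-! ### Isomorphisms from compatible trivializations -/

namespace TGLSheaf

variable {Γ : Type u} [MetricSpace Γ] {n : ℕ} {P E : TGLSheaf Γ n} {ι : Type u} {U : ι → Opens Γ}

/-- The sections `a` and `b` have the same coordinates with respect to the trivializations `t` of
`P` and `s` of `E`. -/
def SameCoords (t : ∀ i, P.Sec (U i)) (s : ∀ i, E.Sec (U i)) {W : Opens Γ} (a : P.Sec W)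
    (b : E.Sec W) : Prop :=
  ∀ i, ∃ g : TGL n (W ⊓ U i), g • P.res inf_le_right (t i) = P.res inf_le_left a ∧
    g • E.res inf_le_right (s i) = E.res inf_le_left b

theorem SameCoords.symm {t : ∀ i, P.Sec (U i)} {s : ∀ i, E.Sec (U i)} {W : Opens Γ} {a : P.Sec W}
    {b : E.Sec W} (h : SameCoords t s a b) : SameCoords s t b a :=
  fun i => (h i).imp fun _ hg => hg.symm

theorem SameCoords.res {t : ∀ i, P.Sec (U i)} {s : ∀ i, E.Sec (U i)} {W W' : Opens Γ}
    {a : P.Sec W} {b : E.Sec W} (h : SameCoords t s a b) (hW : W' ≤ W) :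
    SameCoords t s (P.res hW a) (E.res hW b) := by
  intro i
  obtain ⟨g, h1, h2⟩ := h i
  have hle : W' ⊓ U i ≤ W ⊓ U i := inf_le_inf_right _ hW
  refine ⟨TGL.res hle g, ?_, ?_⟩
  · have := congrArg (P.res hle) h1
    rw [P.res_smul, P.res_res, P.res_res] at this
    rw [P.res_res, this]
  · have := congrArg (E.res hle) h2
    rw [E.res_smul, E.res_res, E.res_res] at this
    rw [E.res_res, this]

theorem SameCoords.smul {t : ∀ i, P.Sec (U i)} {s : ∀ i, E.Sec (U i)} {W : Opens Γ}
    {a : P.Sec W} {b : E.Sec W} (h : SameCoords t s a b) (g : TGL n W) :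
    SameCoords t s (g • a) (g • b) := by
  intro i
  obtain ⟨k, h1, h2⟩ := h i
  refine ⟨TGL.res inf_le_left g * k, ?_, ?_⟩
  · rw [mul_smul, h1, P.res_smul]
  · rw [mul_smul, h2, E.res_smul]

/-- The coordinates of `a` in the trivializations `t` are applied to the trivializations `s`. The
resulting local sections agree on overlaps because both families have the same transition functions,
and the sheaf property glues them. -/
theorem existsUnique_sameCoords (hcov : ∀ p, ∃ i, p ∈ U i) {t : ∀ i, P.Sec (U i)}
    {s : ∀ i, E.Sec (U i)}
    (ht : ∀ i V (h : V ≤ U i) (a : P.Sec V), ∃! g : TGL n V, g • P.res h (t i) = a)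
    (hts : ∀ i j, ∃ g : TGL n (U i ⊓ U j), g • P.res inf_le_right (t j) = P.res inf_le_left (t i) ∧
      g • E.res inf_le_right (s j) = E.res inf_le_left (s i)) {W : Opens Γ} (a : P.Sec W) :
    ∃! b : E.Sec W, SameCoords t s a b := by
  choose g hg hguniq using fun i => ht i (W ⊓ U i) inf_le_right (P.res inf_le_left a)
  obtain ⟨b, hb, hbuniq⟩ := E.sheaf.existsUnique_gluing' (fun i => W ⊓ U i) W
    (fun i => homOfLE inf_le_left)
    (fun x hx => by
      obtain ⟨i, hi⟩ := hcov x
      exact Opens.mem_iSup.2 ⟨i, hx, hi⟩)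
    (fun i => g i • E.res inf_le_right (s i)) fun i j => by
      change E.res _ _ = E.res _ _
      obtain ⟨k, hk, hk'⟩ := hts i j
      let Z := (W ⊓ U i) ⊓ (W ⊓ U j)
      have hZ : Z ≤ U i ⊓ U j := inf_le_inf inf_le_right inf_le_right
      have hZi : Z ≤ W ⊓ U i := inf_le_left
      have hZj : Z ≤ W ⊓ U j := inf_le_right
      have hkP : TGL.res hZ k • P.res (hZj.trans inf_le_right) (t j) =
          P.res (hZi.trans inf_le_right) (t i) := by
        have := congrArg (P.res hZ) hk
        rwa [P.res_smul, P.res_res, P.res_res] at this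
      have hkE : TGL.res hZ k • E.res (hZj.trans inf_le_right) (s j) =
          E.res (hZi.trans inf_le_right) (s i) := by
        have := congrArg (E.res hZ) hk'
        rwa [E.res_smul, E.res_res, E.res_res] at this
      have hi := congrArg (P.res hZi) (hg i)
      have hj := congrArg (P.res hZj) (hg j)
      rw [P.res_smul, P.res_res, P.res_res, ← hkP, smul_smul] at hi
      rw [P.res_smul, P.res_res, P.res_res] at hj
      have heq := (ht j Z (hZj.trans inf_le_right) _).unique hi hj
      rw [E.res_smul, E.res_smul, E.res_res, E.res_res, ← hkE, smul_smul, heq]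
  refine ⟨b, fun i => ⟨g i, hg i, (hb i).symm⟩, fun b' hb' => hbuniq b' fun i => ?_⟩
  obtain ⟨k, hk, hk'⟩ := hb' i
  rw [← hguniq i k hk]
  exact hk'.symm

/-- Two sheaves with compatible families of trivializations are isomorphic. -/
theorem isIso_of_cover (hcov : ∀ p, ∃ i, p ∈ U i) {t : ∀ i, P.Sec (U i)} {s : ∀ i, E.Sec (U i)}
    (ht : ∀ i V (h : V ≤ U i) (a : P.Sec V), ∃! g : TGL n V, g • P.res h (t i) = a)
    (hs : ∀ i V (h : V ≤ U i) (a : E.Sec V), ∃! g : TGL n V, g • E.res h (s i) = a)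
    (hts : ∀ i j, ∃ g : TGL n (U i ⊓ U j), g • P.res inf_le_right (t j) = P.res inf_le_left (t i) ∧
      g • E.res inf_le_right (s j) = E.res inf_le_left (s i)) : P.IsIso E := by
  choose α hα hαu using fun (W : Opens Γ) (a : P.Sec W) => existsUnique_sameCoords hcov ht hts a
  choose β hβ hβu using fun (W : Opens Γ) (b : E.Sec W) => existsUnique_sameCoords hcov hs
    (fun i j => (hts i j).imp fun _ h => h.symm) b
  refine ⟨fun W => ⟨α W, β W, fun a => (hβu W _ _ (hα W a).symm).symm,
    fun b => (hαu W _ _ (hβ W b).symm).symm⟩, fun W W' h a => ?_, fun W g a => ?_⟩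
  · exact (hαu W' _ _ ((hα W a).res h)).symm
  · exact (hαu W _ _ ((hα W a).smul g)).symm

theorem IsIso.symm (h : P.IsIso E) : E.IsIso P := by
  obtain ⟨α, h1, h2⟩ := h
  refine ⟨fun U => (α U).symm, fun U V h s => ?_, fun U g s => ?_⟩
  · rw [Equiv.symm_apply_eq, h1, Equiv.apply_symm_apply]
  · rw [Equiv.symm_apply_eq, h2, Equiv.apply_symm_apply]

theorem IsIso.trans {F : TGLSheaf Γ n} (h : P.IsIso E) (h' : E.IsIso F) : P.IsIso F := by
  obtain ⟨α, h1, h2⟩ := h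
  obtain ⟨β, h3, h4⟩ := h'
  exact ⟨fun U => (α U).trans (β U), fun U V h s => by simp [h1, h3],
    fun U g s => by simp [h2, h4]⟩

end TGLSheaf

theorem Multidivisor.existsUnique_smul_eq {Γ : Type u} [MetricSpace Γ] {n : ℕ}
    {M : Multidivisor Γ n} {U : Opens Γ} (s t : M.pushforward.Sec U) :
    ∃! g : TGL n U, g • s = t := by
  obtain ⟨g, hg⟩ := exists_smul_eq s t
  refine ⟨g, hg, fun k hk => ?_⟩
  have h1 : ∀ p, k.perm p = g.perm p := fun p => by
    rw [← inv_inj]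
    ext1 i
    refine sheet_injective s p ?_
    rw [← sheet_smul, ← sheet_smul, hk, hg]
  refine TGL.ext (LocallyConstant.ext h1) (funext fun i => Subtype.ext (funext fun p => ?_))
  have h2 := entry_smul k s i p
  have h3 := entry_smul g s i p
  rw [hk] at h2
  rw [hg, ← h1] at h3
  linarith

/-! ### Covers from gluing data -/

/-- Gluing data for a cover: numberings of the `n` points over every `x` of an open set `U i`, whose
changes are constant on the overlaps. -/
structure SheetData (Γ : Type u) [MetricSpace Γ] (n : ℕ) where
  ι : Type u
  U : ι → Opens Γ
  num : ι → Γ → Equiv.Perm (Fin n)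
  radius : ℝ
  radius_pos : 0 < radius
  exists_ball : ∀ x, ∃ i, Metric.ball x radius ⊆ (U i : Set Γ)
  compat : ∀ i j, ∀ x ∈ U i, x ∈ U j → ∀ y ∈ U i, y ∈ U j →
    num i x * (num j x)⁻¹ = num i y * (num j y)⁻¹

namespace SheetData

variable {Γ : Type u} [MetricSpace Γ] {n : ℕ}

/-- The points of the cover given by gluing data. -/
@[ext]
structure Total (S : SheetData Γ n) where
  pt : Γ
  idx : Fin n

variable {S : SheetData Γ n}

/-- Two points of the cover lie on the same sheet over one of the open sets. -/
def SameSheet (x y : S.Total) : Prop :=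
  ∃ i, x.pt ∈ S.U i ∧ y.pt ∈ S.U i ∧ S.num i x.pt x.idx = S.num i y.pt y.idx

/-- Changes of numbering are constant on overlaps, so the relation can be tested in any open set
containing both points. -/
theorem sameSheet_iff {x y : S.Total} {i : S.ι} (hx : x.pt ∈ S.U i) (hy : y.pt ∈ S.U i) :
    SameSheet x y ↔ S.num i x.pt x.idx = S.num i y.pt y.idx := by
  refine ⟨fun ⟨j, hxj, hyj, h⟩ => ?_, fun h => ⟨i, hx, hy, h⟩⟩
  have h1 := S.compat i j _ hx hxj _ hy hyj
  have h2 := congrArg (fun σ : Equiv.Perm (Fin n) => σ (S.num j x.pt x.idx)) h1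
  simp only [Equiv.Perm.mul_apply] at h2
  have e1 : (S.num j x.pt)⁻¹ (S.num j x.pt x.idx) = x.idx := Equiv.symm_apply_apply _ _
  have e2 : (S.num j y.pt)⁻¹ (S.num j y.pt y.idx) = y.idx := Equiv.symm_apply_apply _ _
  rwa [e1, h, e2] at h2

-- Only nearby points on a common sheet keep their distance in Γ; all other pairs are put at
-- distance `radius`. The triangle inequality then needs transitivity of `SameSheet` only at short
-- distances, where one open set of the cover contains all three points.
open Classical in
noncomputable instance : Dist S.Total where
  dist x y := if dist x.pt y.pt < S.radius ∧ SameSheet x y then dist x.pt y.pt else S.radius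

theorem dist_of_sameSheet {x y : S.Total} (h : dist x.pt y.pt < S.radius) (h' : SameSheet x y) :
    dist x y = dist x.pt y.pt := if_pos ⟨h, h'⟩

theorem dist_of_not {x y : S.Total} (h : ¬ (dist x.pt y.pt < S.radius ∧ SameSheet x y)) :
    dist x y = S.radius := if_neg h

theorem dist_le_radius (x y : S.Total) : dist x y ≤ S.radius := by
  by_cases h : dist x.pt y.pt < S.radius ∧ SameSheet x y
  · rw [dist_of_sameSheet h.1 h.2]
    exact h.1.le
  · exact (dist_of_not h).le

theorem sameSheet_of_dist_lt {x y : S.Total} (h : dist x y < S.radius) :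
    dist x.pt y.pt < S.radius ∧ SameSheet x y := by
  by_contra hn
  exact h.ne (dist_of_not hn)

theorem SameSheet.symm {x y : S.Total} (h : SameSheet x y) : SameSheet y x := by
  obtain ⟨i, hx, hy, h⟩ := h
  exact ⟨i, hy, hx, h.symm⟩

theorem SameSheet.refl (x : S.Total) : SameSheet x x := by
  obtain ⟨i, hi⟩ := S.exists_ball x.pt
  have := hi (Metric.mem_ball_self S.radius_pos)
  exact ⟨i, this, this, rfl⟩

theorem SameSheet.trans {x y z : S.Total} (hxy : SameSheet x y) (hyz : SameSheet y z)
    (hx : dist x.pt y.pt < S.radius) (hz : dist y.pt z.pt < S.radius) : SameSheet x z := by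
  obtain ⟨i, hi⟩ := S.exists_ball y.pt
  have hxi : x.pt ∈ S.U i := hi hx
  have hyi : y.pt ∈ S.U i := hi (Metric.mem_ball_self S.radius_pos)
  have hzi : z.pt ∈ S.U i := hi (by rwa [Metric.mem_ball, dist_comm])
  rw [sameSheet_iff hxi hyi] at hxy
  rw [sameSheet_iff hyi hzi] at hyz
  rw [sameSheet_iff hxi hzi, hxy, hyz]

noncomputable instance : MetricSpace S.Total where
  dist_self x := by
    rw [dist_of_sameSheet (by rw [dist_self]; exact S.radius_pos) (SameSheet.refl x), dist_self]
  dist_comm x y := by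
    by_cases h : dist x.pt y.pt < S.radius ∧ SameSheet x y
    · rw [dist_of_sameSheet h.1 h.2, dist_of_sameSheet (by rw [dist_comm]; exact h.1) h.2.symm,
        dist_comm]
    · rw [dist_of_not h, dist_of_not fun h' => h ⟨by rw [dist_comm]; exact h'.1, h'.2.symm⟩]
  dist_triangle x y z := by
    have hle := dist_le_radius x z
    have hnn : ∀ a b : S.Total, 0 ≤ dist a b := fun a b => by
      by_cases h : dist a.pt b.pt < S.radius ∧ SameSheet a b
      · rw [dist_of_sameSheet h.1 h.2]
        exact dist_nonneg
      · rw [dist_of_not h]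
        exact S.radius_pos.le
    by_cases h1 : dist x.pt y.pt < S.radius ∧ SameSheet x y
    swap
    · rw [dist_of_not h1]
      linarith [hnn y z]
    by_cases h2 : dist y.pt z.pt < S.radius ∧ SameSheet y z
    swap
    · rw [dist_of_not h2]
      linarith [hnn x y]
    rw [dist_of_sameSheet h1.1 h1.2, dist_of_sameSheet h2.1 h2.2]
    have h3 := dist_triangle x.pt y.pt z.pt
    by_cases h4 : dist x.pt z.pt < S.radius
    · rwa [dist_of_sameSheet h4 (h1.2.trans h2.2 h1.1 h2.1)]
    · linarith
  eq_of_dist_eq_zero {x y} h := by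
    have h1 := sameSheet_of_dist_lt (h.trans_lt S.radius_pos)
    rw [dist_of_sameSheet h1.1 h1.2, dist_eq_zero] at h
    obtain ⟨i, -, -, hi⟩ := h1.2
    rw [h] at hi
    exact Total.ext h ((S.num i y.pt).injective hi)

theorem isometric_pt (x : S.Total) : ∃ ε > 0, ∀ y ∈ Metric.ball x ε, ∀ z ∈ Metric.ball x ε,
    dist y.pt z.pt = dist y z := by
  refine ⟨S.radius / 2, half_pos S.radius_pos, fun y hy z hz => ?_⟩
  have hyz : dist y z < S.radius := by
    have := dist_triangle_right y z x
    rw [Metric.mem_ball] at hy hz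
    linarith
  have h := sameSheet_of_dist_lt hyz
  rw [dist_of_sameSheet h.1 h.2]

theorem continuous_pt : Continuous (Total.pt : S.Total → Γ) := by
  refine continuous_iff_continuousAt.2 fun x => Metric.continuousAt_iff.2 fun ε hε => ?_
  obtain ⟨δ, hδ, h⟩ := isometric_pt x
  refine ⟨min δ ε, lt_min hδ hε, fun {y} hy => ?_⟩
  rw [h y (hy.trans_le (min_le_left _ _)) x (Metric.mem_ball_self hδ)]
  exact hy.trans_le (min_le_right _ _)

/-- The point with the number `j` over a point of `U i`. -/
def point (S : SheetData Γ n) (i : S.ι) (j : Fin n) (p : Γ) : S.Total := ⟨p, (S.num i p)⁻¹ j⟩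

theorem continuous_point (i : S.ι) (j : Fin n) : Continuous fun p : S.U i => S.point i j p := by
  refine continuous_iff_continuousAt.2 fun p => Metric.continuousAt_iff.2 fun ε hε => ?_
  refine ⟨min ε S.radius, lt_min hε S.radius_pos, fun {q} hq => ?_⟩
  have h1 : dist q.1 p.1 < S.radius := hq.trans_le (min_le_right _ _)
  have h2 : SameSheet (S.point i j q) (S.point i j p) :=
    (sameSheet_iff (i := i) q.2 p.2).2 (by simp [point])
  rw [dist_of_sameSheet h1 h2]
  exact hq.trans_le (min_le_left _ _)

theorem eventually_num_eq {i : S.ι} (x : S.Total) (hx : x.pt ∈ S.U i) :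
    ∀ᶠ y in 𝓝 x, S.num i y.pt y.idx = S.num i x.pt x.idx := by
  filter_upwards [Metric.ball_mem_nhds x S.radius_pos,
    continuous_pt.continuousAt ((S.U i).isOpen.mem_nhds hx)] with y hy hyU
  exact (sameSheet_iff hyU hx).1 (sameSheet_of_dist_lt hy).2

theorem isCoveringMap_pt : IsCoveringMap (Total.pt : S.Total → Γ) := by
  intro p
  obtain ⟨i, hi⟩ := S.exists_ball p
  have hp : p ∈ S.U i := hi (Metric.mem_ball_self S.radius_pos)
  refine IsEvenlyCovered.to_isEvenlyCovered_preimage (I := Fin n) ⟨inferInstance, S.U i, hp,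
    (S.U i).isOpen, (S.U i).isOpen.preimage continuous_pt, ?_, ?_⟩
  · exact
      { toFun := fun x => (⟨x.1.pt, x.2⟩, S.num i x.1.pt x.1.idx)
        invFun := fun q => ⟨S.point i q.2 q.1, q.1.2⟩
        left_inv := fun x => Subtype.ext (Total.ext rfl (Equiv.symm_apply_apply _ _))
        right_inv := fun q => Prod.ext rfl (Equiv.apply_symm_apply _ _)
        continuous_toFun := by
          refine Continuous.prodMk ((continuous_pt.comp continuous_subtype_val).subtype_mk _) ?_
          refine continuous_iff_continuousAt.2 fun x => ?_
          refine (continuousAt_const (y := S.num i x.1.pt x.1.idx)).congr ?_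
          filter_upwards [continuous_subtype_val.continuousAt (eventually_num_eq x.1 x.2)] with y hy
          exact hy.symm
        continuous_invFun := by
          refine Continuous.subtype_mk ?_ _
          refine continuous_prod_of_discrete_right.2 fun j => continuous_point i j }
  · intro x
    rfl

/-- The numbering of the fibre over a point of `U i`. -/
def fiberEquiv (S : SheetData Γ n) (i : S.ι) (p : Γ) :
    Fin n ≃ (Total.pt : S.Total → Γ) ⁻¹' {p} where
  toFun j := ⟨S.point i j p, rfl⟩
  invFun x := S.num i p x.1.idx
  left_inv _ := Equiv.apply_symm_apply _ _
  right_inv x := Subtype.ext (Total.ext x.2.symm (Equiv.symm_apply_apply _ _))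

/-- The multidivisor given by gluing data and a divisor on the cover. -/
noncomputable def multidivisor (S : SheetData Γ n) (D : S.Total →₀ ℤ) : Multidivisor Γ n where
  X := S.Total
  f := Total.pt
  isCoveringMap := isCoveringMap_pt
  isometric := isometric_pt
  degree p := by
    obtain ⟨i, -⟩ := S.exists_ball p
    rw [encard, ← ENat.card_congr (S.fiberEquiv i p)]
    simp
  D := D

end SheetData

/-- A piecewise linear function with integer slopes that interpolates between zero and a given
linear function. -/
theorem exists_interpolation {L : ℝ} (hL : 0 < L) (m : ℤ) (c : ℝ) :
    ∃ u : ℝ → ℝ, (∀ t, ∃ a, OrdAt u t a) ∧ (∀ t ≤ L / 2, u t = 0) ∧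
      ∀ t, 3 * L / 4 ≤ t → u t = c + m * t := by
  -- The function is 0 up to L/2, then rises with slope m + N until L/2 + h/N, then has slope m. The
  -- surplus slope N gains N · (h/N) = h, exactly the value of the target at L/2. N has the sign of
  -- h and is so large that the second kink comes before 3L/4.
  set h := c + m * (L / 2) with hh
  obtain ⟨N, hN, hq0, hq⟩ : ∃ N : ℤ, (N : ℝ) ≠ 0 ∧ 0 ≤ h / N ∧ h / N ≤ L / 4 := by
    obtain ⟨k, hk⟩ := exists_nat_gt (4 * |h| / L)
    have hk0 : (0 : ℝ) < k := lt_of_le_of_lt (by positivity) hk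
    have h1 : |h| / k ≤ L / 4 := by
      rw [div_lt_iff₀ hL] at hk
      rw [div_le_iff₀ hk0]
      linarith
    rcases le_total 0 h with h0 | h0
    · exact ⟨k, by exact_mod_cast hk0.ne', by push_cast; positivity,
        by push_cast; rwa [abs_of_nonneg h0] at h1⟩
    · rw [abs_of_nonpos h0] at h1
      refine ⟨-k, by push_cast; exact neg_ne_zero.2 hk0.ne', ?_, ?_⟩
      · push_cast
        exact div_nonneg_of_nonpos h0 (by linarith)
      · push_cast
        rwa [div_neg, ← neg_div]
  refine ⟨fun t => ((m + N : ℤ) : ℝ) * max 0 (t - L / 2) - (N : ℝ) * max 0 (t - (L / 2 + h / N)),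
    fun t => ⟨_, ((ordAt_max_zero_sub _ t).intCast_mul (m + N)).sub
      ((ordAt_max_zero_sub _ t).intCast_mul N)⟩, fun t ht => ?_, fun t ht => ?_⟩
  · simp only
    rw [max_eq_left (by linarith), max_eq_left (by linarith)]
    simp
  · simp only
    rw [max_eq_right (by linarith), max_eq_right (by linarith)]
    have : (N : ℝ) * (h / N) = h := mul_div_cancel₀ h hN
    push_cast
    linear_combination this

/-! ### Cocycles over stars and the presentation of a bundle as a pushforward -/

namespace TGLSheaf

variable {Γ : Type u} [MetricSpace Γ] {n : ℕ} {E : TGLSheaf Γ n}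

/-- Simple transitivity on triple overlaps gives the cocycle identity, which is recorded pointwise
for the permutations and the functions. -/
theorem IsVectorBundle.exists_cocycle (hE : E.IsVectorBundle) {ι : Type*} {U : ι → Opens Γ}
    (s : ∀ i, E.Sec (U i)) : ∃ g : ∀ u v, TGL n (U u ⊓ U v),
      (∀ u v, g u v • E.res inf_le_right (s v) = E.res inf_le_left (s u)) ∧
      ∀ u v w x (hu : x ∈ U u) (hv : x ∈ U v) (hw : x ∈ U w),
        (g u w).perm ⟨x, hu, hw⟩ = (g u v).perm ⟨x, hu, hv⟩ * (g v w).perm ⟨x, hv, hw⟩ ∧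
        ∀ i, ((g u w).fn i).1 ⟨x, hu, hw⟩ = ((g u v).fn i).1 ⟨x, hu, hv⟩ +
          ((g v w).fn (((g u v).perm ⟨x, hu, hv⟩)⁻¹ i)).1 ⟨x, hv, hw⟩ := by
  choose g hg hgu using fun u v => hE.simply_transitive (U u ⊓ U v) (E.res inf_le_right (s v))
    (E.res inf_le_left (s u))
  refine ⟨g, hg, fun u v w x hu hv hw => ?_⟩
  let W := U u ⊓ U v ⊓ U w
  have huv : W ≤ U u ⊓ U v := inf_le_left
  have hvw : W ≤ U v ⊓ U w := inf_le_inf_right _ inf_le_right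
  have huw : W ≤ U u ⊓ U w := inf_le_inf_right _ inf_le_left
  have key : ∀ {u v} (h : W ≤ U u ⊓ U v),
      TGL.res h (g u v) • E.res (h.trans inf_le_right) (s v) = E.res (h.trans inf_le_left) (s u) := by
    intro u v h
    have := congrArg (E.res h) (hg u v)
    rwa [E.res_smul, E.res_res, E.res_res] at this
  have heq : TGL.res huw (g u w) = TGL.res huv (g u v) * TGL.res hvw (g v w) := by
    refine (hE.simply_transitive W (E.res (huw.trans inf_le_right) (s w))
      (E.res (huw.trans inf_le_left) (s u))).unique (key huw) ?_
    rw [mul_smul, key hvw, key huv]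
  exact ⟨congrArg (fun g : TGL n W => g.perm ⟨x, ⟨hu, hv⟩, hw⟩) heq,
    fun i => congrArg (fun g : TGL n W => (g.fn i).1 ⟨x, ⟨hu, hv⟩, hw⟩) heq⟩

end TGLSheaf

namespace Model

variable {Γ : Type u} [MetricSpace Γ] (M : Model Γ)

/-- The open star of a vertex as an open set. -/
def starOpens (v : M.V) : Opens Γ := ⟨M.star v, M.isOpen_star v⟩

theorem mem_starOpens_self (v : M.V) : v.1 ∈ M.starOpens v := Or.inl rfl

variable {M}

theorem eq_of_mem_star {x : Γ} {v : M.V} (hx : x ∈ M.V) (h : x ∈ M.star v) : v = ⟨x, hx⟩ := by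
  rcases h with h | h
  · exact Subtype.ext (mem_singleton_iff.1 h).symm
  · simp only [mem_iUnion] at h
    obtain ⟨e, -, t, ht, rfl⟩ := h
    exact absurd hx (M.notMem e t ht)

theorem path_mem_star_iff {e : M.E} {t : ℝ} (ht : t ∈ Ioo 0 (M.len e)) {v : M.V} :
    M.path e t ∈ M.star v ↔ v = M.src e ∨ v = M.tgt e := by
  constructor
  · rintro (h | h)
    · exact absurd (mem_singleton_iff.1 h ▸ v.2) (M.notMem e t ht)
    · simp only [mem_iUnion] at h
      obtain ⟨e', he', t', ht', h⟩ := h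
      obtain ⟨rfl, -⟩ := M.inj e' e t' ht' t ht h
      exact he'.imp Eq.symm Eq.symm
  · intro h
    refine Or.inr (mem_biUnion (x := e) ?_ ⟨t, ht, rfl⟩)
    exact h.imp Eq.symm Eq.symm

/-- Distinct open stars of a simple model intersect in at most one open edge. -/
theorem IsSimple.exists_edge (hM : M.IsSimple) {u v : M.V} (huv : u ≠ v) {x y : Γ}
    (hxu : x ∈ M.star u) (hxv : x ∈ M.star v) (hyu : y ∈ M.star u) (hyv : y ∈ M.star v) :
    ∃ e, (u = M.src e ∨ u = M.tgt e) ∧ (v = M.src e ∨ v = M.tgt e) ∧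
      (∃ t ∈ Ioo 0 (M.len e), M.path e t = x) ∧ ∃ t ∈ Ioo 0 (M.len e), M.path e t = y := by
  have key : ∀ x ∈ M.star u, x ∈ M.star v → ∃ e, (u = M.src e ∨ u = M.tgt e) ∧
      (v = M.src e ∨ v = M.tgt e) ∧ ∃ t ∈ Ioo 0 (M.len e), M.path e t = x := by
    intro x hu hv
    obtain hx | ⟨e, t, ht, rfl⟩ := M.cover_mem x
    · exact absurd ((eq_of_mem_star hx hu).trans (eq_of_mem_star hx hv).symm) huv
    · exact ⟨e, (path_mem_star_iff ht).1 hu, (path_mem_star_iff ht).1 hv, t, ht, rfl⟩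
  obtain ⟨e, hu, hv, hx⟩ := key x hxu hxv
  obtain ⟨e', hu', hv', hy⟩ := key y hyu hyv
  have hset : ∀ e, (u = M.src e ∨ u = M.tgt e) → (v = M.src e ∨ v = M.tgt e) →
      ({M.src e, M.tgt e} : Set M.V) = {u, v} := by
    rintro e (h1 | h1) (h2 | h2)
    · exact absurd (h1.trans h2.symm) huv
    · rw [h1, h2]
    · rw [h1, h2, pair_comm]
    · exact absurd (h1.trans h2.symm) huv
  obtain rfl := hM.2 e e' ((hset e hu hv).trans (hset e' hu' hv').symm)
  exact ⟨e, hu, hv, hx, hy⟩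

variable (M) in
/-- A choice of a star containing a given point, which is the star of the source of an edge in the
interior of that edge. -/
theorem exists_home : ∃ h : Γ → M.V, (∀ x, x ∈ M.star (h x)) ∧
    ∀ e, ∀ t ∈ Ioo 0 (M.len e), h (M.path e t) = M.src e := by
  have key : ∀ x, ∃ v : M.V, x ∈ M.star v ∧
      ∀ e, ∀ t ∈ Ioo 0 (M.len e), M.path e t = x → v = M.src e := by
    intro x
    obtain hx | ⟨e, t, ht, rfl⟩ := M.cover_mem x
    · refine ⟨⟨x, hx⟩, Or.inl rfl, fun e t ht h => ?_⟩
      exact absurd (h ▸ hx) (M.notMem e t ht)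
    · refine ⟨M.src e, (path_mem_star_iff ht).2 (Or.inl rfl), fun e' t' ht' h => ?_⟩
      obtain ⟨rfl, -⟩ := M.inj e' e t' ht' t ht h
      rfl
  choose h hmem hpath using key
  exact ⟨h, hmem, fun e t ht => hpath _ e t ht rfl⟩

end Model

theorem harmonic.ordAt_extendZero {Γ : Type u} [MetricSpace Γ] [MetricGraph Γ] {U : Opens Γ}
    (f : harmonic U) {p : Γ} (hp : p ∈ U) : OrdAt (extendZero U f.1) p 0 :=
  hasOrd_iff.1 (f.2 ⟨p, hp⟩)

/-- Harmonic functions are affine on open edges. -/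
theorem harmonic.exists_affine {Γ : Type u} [MetricSpace Γ] [MetricGraph Γ] {M : Model Γ}
    {U : Opens Γ} (f : harmonic U) {e : M.E} (h : ∀ t ∈ Ioo 0 (M.len e), M.path e t ∈ U) :
    ∃ m : ℤ, ∃ c : ℝ, ∀ t ∈ Ioo 0 (M.len e), extendZero U f.1 (M.path e t) = c + m * t := by
  obtain ⟨m, c, hmc⟩ := exists_hinge_form (u := fun t => extendZero U f.1 (M.path e t))
    (L := M.len e) (κ := 0) (S := ∅) (fun t _ h => absurd rfl h) fun t ht =>
      (M.ordAt_interior_iff ht).1 (harmonic.ordAt_extendZero f (h t ht))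
  exact ⟨m, c, fun t ht => by simpa using hmc t ht⟩

theorem LocallyConstant.eq_on_edge {Γ : Type u} [MetricSpace Γ] {M : Model Γ} {U : Opens Γ}
    {A : Type*} (f : LocallyConstant U A) {e : M.E} (h : ∀ t ∈ Ioo 0 (M.len e), M.path e t ∈ U)
    {t t' : ℝ} (ht : t ∈ Ioo 0 (M.len e)) (ht' : t' ∈ Ioo 0 (M.len e)) :
    f ⟨M.path e t, h t ht⟩ = f ⟨M.path e t', h t' ht'⟩ := by
  have hpre : _root_.IsPreconnected (univ : Set (Ioo 0 (M.len e))) :=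
    (isPreconnected_iff_preconnectedSpace.1 isPreconnected_Ioo).isPreconnected_univ
  have hcont : Continuous fun t : Ioo 0 (M.len e) => (⟨M.path e t, h t t.2⟩ : U) :=
    (continuousOn_iff_continuous_domRestrict.1
      ((M.continuousOn_path e).mono Ioo_subset_Icc_self)).subtype_mk _
  refine eq_of_eventually_eq hpre (f := fun t : Ioo 0 (M.len e) => f ⟨M.path e t, h t t.2⟩)
    (fun x _ => ?_) (mem_univ ⟨t, ht⟩) (mem_univ ⟨t', ht'⟩)
  rw [nhdsWithin_univ]
  exact hcont.continuousAt ((IsLocallyConstant.iff_eventually_eq _).1 f.isLocallyConstant _)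

/-- Every vector bundle is the pushforward of a line bundle along a cover. -/
theorem TGLSheaf.IsVectorBundle.exists_multidivisor {Γ : Type u} [MetricSpace Γ] [MetricGraph Γ]
    [CompactSpace Γ] {n : ℕ} {E : TGLSheaf Γ n} (hE : E.IsVectorBundle) :
    ∃ M : Multidivisor Γ n, M.pushforward.IsIso E := by
  classical
  choose O hO hsec using hE.exists_local_section
  obtain ⟨G, hG, -, hstar⟩ := exists_simple_model ∅ (fun p => (O p : Set Γ)) (fun p => (O p).isOpen)
    fun p => ⟨p, hO p⟩
  choose i hi using hstar
  let U : G.V → Opens Γ := G.starOpens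
  let s : ∀ v, E.Sec (U v) := fun v => E.res (hi v) (hsec (i v)).some
  obtain ⟨g, hg, hcoc⟩ := hE.exists_cocycle s
  obtain ⟨home, hhome, hhome_path⟩ := G.exists_home
  -- Extended by 1 and 0 outside the overlaps, the two parts of the cocycle become total functions
  -- on Γ and can be manipulated pointwise.
  let π : G.V → G.V → Γ → Equiv.Perm (Fin n) := fun u v x =>
    if h : x ∈ U u ⊓ U v then (g u v).perm ⟨x, h⟩ else 1
  have hπ : ∀ u v x (h : x ∈ U u ⊓ U v), π u v x = (g u v).perm ⟨x, h⟩ := fun u v x h => dif_pos h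
  let φ : G.V → G.V → Fin n → Γ → ℝ := fun u v i => extendZero (U u ⊓ U v) ((g u v).fn i).1
  have hφ : ∀ u v i x (h : x ∈ U u ⊓ U v), φ u v i x = ((g u v).fn i).1 ⟨x, h⟩ :=
    fun u v i x h => extendZero_of_mem _ h
  have hπc : ∀ u v w x, x ∈ U u → x ∈ U v → x ∈ U w → π u w x = π u v x * π v w x := by
    intro u v w x hu hv hw
    rw [hπ u w x ⟨hu, hw⟩, hπ u v x ⟨hu, hv⟩, hπ v w x ⟨hv, hw⟩]
    exact (hcoc u v w x hu hv hw).1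
  have hφc : ∀ u v w i x, x ∈ U u → x ∈ U v → x ∈ U w →
      φ u w i x = φ u v i x + φ v w ((π u v x)⁻¹ i) x := by
    intro u v w i x hu hv hw
    rw [hφ u w i x ⟨hu, hw⟩, hφ u v i x ⟨hu, hv⟩, hπ u v x ⟨hu, hv⟩, hφ v w _ x ⟨hv, hw⟩]
    exact (hcoc u v w x hu hv hw).2 i
  have hπ1 : ∀ u x, x ∈ U u → π u u x = 1 := fun u x hx => by
    have := hπc u u u x hx hx hx
    exact (mul_eq_left.1 this.symm)
  have hφ0 : ∀ u i x, x ∈ U u → φ u u i x = 0 := fun u i x hx => by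
    have := hφc u u u i x hx hx hx
    rw [hπ1 u x hx] at this
    simpa using this
  have hedge : ∀ e (u v : G.V), (u = G.src e ∨ u = G.tgt e) → (v = G.src e ∨ v = G.tgt e) →
      ∀ t ∈ Ioo 0 (G.len e), G.path e t ∈ U u ⊓ U v := fun e u v hu hv t ht =>
    ⟨(Model.path_mem_star_iff ht).2 hu, (Model.path_mem_star_iff ht).2 hv⟩
  -- Simplicity of the model enters here: all points common to two distinct stars lie on one open
  -- edge, which is connected.
  have hπconst : ∀ u v, ∀ x ∈ U u, x ∈ U v → ∀ y ∈ U u, y ∈ U v → π u v x = π u v y := by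
    intro u v x hxu hxv y hyu hyv
    by_cases huv : u = v
    · subst huv
      rw [hπ1 u x hxu, hπ1 u y hyu]
    · obtain ⟨e, hu, hv, ⟨t, ht, rfl⟩, t', ht', rfl⟩ := hG.exists_edge huv hxu hxv hyu hyv
      rw [hπ u v _ (hedge e u v hu hv t ht), hπ u v _ (hedge e u v hu hv t' ht')]
      exact LocallyConstant.eq_on_edge _ (hedge e u v hu hv) ht ht'
  -- the cover
  obtain ⟨c, hc, hball⟩ := lebesgue_number_lemma_of_metric (s := (univ : Set Γ)) isCompact_univ
    (fun v => (U v).isOpen) fun x _ => mem_iUnion.2 ⟨home x, hhome x⟩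
  let S : SheetData Γ n :=
    { ι := G.V
      U := U
      -- The index of a point over x refers to the trivialization at the home star of x; `num v`
      -- translates it to the star of v.
      num := fun v x => π v (home x) x
      radius := c
      radius_pos := hc
      exists_ball := fun x => hball x (mem_univ x)
      compat := fun u v x hxu hxv y hyu hyv => by
        have key : ∀ x, x ∈ U u → x ∈ U v →
            π u (home x) x * (π v (home x) x)⁻¹ = π u v x := fun x hu hv => by
          rw [hπc u v _ x hu hv (hhome x), mul_inv_cancel_right]
        rw [key x hxu hxv, key y hyu hyv]
        exact hπconst u v x hxu hxv y hyu hyv }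
  -- the functions on the sheets
  have hu : ∀ (e : G.E) (i : Fin n), ∃ u : ℝ → ℝ, (∀ t, ∃ a, OrdAt u t a) ∧
      (∀ t ≤ G.len e / 2, u t = 0) ∧ ∀ t ∈ Ioo 0 (G.len e), 3 * G.len e / 4 ≤ t →
        u t = φ (G.src e) (G.tgt e) i (G.path e t) := by
    intro e i
    obtain ⟨m, b, hmb⟩ := harmonic.exists_affine ((g (G.src e) (G.tgt e)).fn i)
      (hedge e _ _ (Or.inl rfl) (Or.inr rfl))
    obtain ⟨u, h1, h2, h3⟩ := exists_interpolation (G.len_pos e) m b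
    exact ⟨u, h1, h2, fun t ht ht' => (h3 t ht').trans (hmb t ht).symm⟩
  choose u huPL hu0 hu1 using hu
  -- ω is the section in the trivialization of the home star. It may jump at the end of an edge,
  -- where the home star changes from the source to the target; the transition function compensates
  -- for the jump.
  have hω : ∀ i, ∃ F : Γ → ℝ, (∀ v : G.V, F v = 0) ∧
      ∀ e, ∀ t ∈ Ioo 0 (G.len e), F (G.path e t) = u e i t := by
    intro i
    obtain ⟨F, h1, h2⟩ := G.exists_glue (fun _ => 0)
      (fun e t => if t < G.len e then u e i t else 0)
      (fun e => by
        rw [if_pos (G.len_pos e), hu0 e i 0 (by linarith [G.len_pos e])])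
      (fun e => if_neg (lt_irrefl _))
    exact ⟨F, h1, fun e t ht => by rw [h2 e t ⟨ht.1.le, ht.2.le⟩, if_pos ht.2]⟩
  choose ω hωV hωe using hω
  let w : G.V → Fin n → Γ → ℝ := fun v i x =>
    φ v (home x) i x + ω ((π v (home x) x)⁻¹ i) x
  have hw : ∀ a b i x, x ∈ U a → x ∈ U b → w a i x = φ a b i x + w b ((π a b x)⁻¹ i) x := by
    intro a b i x ha hb
    simp only [w]
    rw [hφc a b (home x) i x ha hb (hhome x), hπc a b (home x) x ha hb (hhome x), mul_inv_rev,
      Equiv.Perm.mul_apply, add_assoc]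
  have hwhome : ∀ v i x, x ∈ U v → home x = v → w v i x = ω i x := by
    intro v i x hx hv
    simp only [w]
    rw [hv, hφ0 v i x hx, hπ1 v x hx, zero_add, inv_one, Equiv.Perm.one_apply]
  -- Changing the star adds a harmonic function and applies a locally constant renumbering; neither
  -- affects orders.
  have htransfer : ∀ a b i p κ, p ∈ U a → p ∈ U b →
      OrdAt (w b ((π a b p)⁻¹ i)) p κ → OrdAt (w a i) p κ := by
    intro a b i p κ ha hb h
    have h1 := (harmonic.ordAt_extendZero ((g a b).fn i) (p := p) ⟨ha, hb⟩).add h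
    rw [zero_add] at h1
    refine h1.congr ?_
    filter_upwards [(U a).isOpen.mem_nhds ha, (U b).isOpen.mem_nhds hb] with x hxa hxb
    rw [hw a b i x hxa hxb, hπconst a b x hxa hxb p ha hb]
    rfl
  have hPL : ∀ p i, ∃ κ, OrdAt (w (home p) i) p κ := by
    intro p i
    obtain hp | ⟨e, t, ht, rfl⟩ := G.cover_mem p
    · have hhp : home p = ⟨p, hp⟩ := Model.eq_of_mem_star hp (hhome p)
      rw [hhp]
      have hwp : w ⟨p, hp⟩ i p = 0 := by
        rw [hwhome _ i p (G.mem_starOpens_self ⟨p, hp⟩) hhp]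
        exact hωV i ⟨p, hp⟩
      refine ⟨_, G.ordAt_vertex (v := ⟨p, hp⟩) (m := 0) fun h hh => ⟨G.len h.1 / 4,
        by linarith [G.len_pos h.1], fun t ht => ?_⟩⟩
      simp only [Pi.zero_apply, Int.cast_zero, zero_mul, add_zero]
      rw [hwp]
      have hL := G.len_pos h.1
      rcases ht.1.eq_or_lt with rfl | ht0
      · rw [G.hpath_zero, hh]
        exact hwp
      rcases h with ⟨e, _ | _⟩
      · simp only [Model.base_false] at hh
        have htI : t ∈ Ioo 0 (G.len e) := ⟨ht0, by simp only at hL; linarith [ht.2]⟩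
        rw [Model.hpath_false, hwhome _ i _ ((Model.path_mem_star_iff htI).2 (Or.inl hh.symm))
          ((hhome_path e t htI).trans hh), hωe i e t htI]
        exact hu0 e i t (by simp only at hL; linarith [ht.2])
      · simp only [Model.base_true] at hh
        simp only at hL ht
        have htI : G.len e - t ∈ Ioo 0 (G.len e) := ⟨by linarith [ht.2], by linarith⟩
        have hsrc : G.path e (G.len e - t) ∈ U (G.src e) :=
          (Model.path_mem_star_iff htI).2 (Or.inl rfl)
        have htgt : G.path e (G.len e - t) ∈ U (G.tgt e) :=
          (Model.path_mem_star_iff htI).2 (Or.inr rfl)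
        -- Near its end the interpolating function equals the transition function from the target to
        -- the source trivialization; by the cocycle identity the section vanishes when written over
        -- the target star.
        have h0 := hφc (G.tgt e) (G.src e) (G.tgt e) i _ htgt hsrc htgt
        rw [hφ0 _ i _ htgt] at h0
        change w _ i (G.path e (G.len e - t)) = 0
        rw [← hh, hw _ (G.src e) i _ htgt hsrc, hwhome (G.src e) _ _ hsrc (hhome_path e _ htI),
          hωe _ e _ htI, hu1 e _ _ htI (by linarith [ht.2])]
        exact h0.symm
    · obtain ⟨a, ha⟩ := huPL e i t
      rw [hhome_path e t ht]
      refine ⟨a, (G.ordAt_interior_iff ht).2 (ha.congr ?_)⟩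
      filter_upwards [Ioo_mem_nhds ht.1 ht.2] with r hr
      rw [hwhome _ i _ ((Model.path_mem_star_iff hr).2 (Or.inl rfl)) (hhome_path e r hr),
        hωe i e r hr]
  -- the divisor
  choose d hd using hPL
  have hdS : ∀ (v : G.V) p j, p ∈ U v → OrdAt (w v j) p (d p (S.point v j p).idx) :=
    fun v p j hp => htransfer v (home p) j p _ hp (hhome p) (hd p _)
  -- Finiteness is checked on the compact space Γ; the absolute values prevent cancellation among
  -- the sheets.
  have hfin : (Function.support fun p => ∑ i, |d p i|).Finite := by
    refine finite_support_of_eventually fun p => ?_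
    have h1 : ∀ᶠ q in 𝓝[≠] p, ∀ j, OrdAt (w (home p) j) q 0 :=
      eventually_all.2 fun j => (hd p j).eventually_zero
    filter_upwards [h1, nhdsWithin_le_nhds ((U (home p)).isOpen.mem_nhds (hhome p))] with q hq hqU
    refine Finset.sum_eq_zero fun i _ => ?_
    have h2 := (hdS (home p) q (S.num (home p) q i) hqU).unique (hq _)
    have h3 : (S.point (home p) (S.num (home p) q i) q).idx = i := Equiv.symm_apply_apply _ _
    rw [h3] at h2
    rw [h2, abs_zero]
  let D : S.Total →₀ ℤ := Finsupp.ofSupportFinite (fun x => d x.pt x.idx) (by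
    refine ((hfin.prod (finite_univ (α := Fin n))).image
      fun q => (⟨q.1, q.2⟩ : S.Total)).subset fun x hx => ?_
    refine ⟨(x.pt, x.idx), ⟨?_, mem_univ _⟩, rfl⟩
    intro h0
    have := (Finset.sum_eq_zero_iff_of_nonneg fun i _ => abs_nonneg (d x.pt i)).1 h0 x.idx
      (Finset.mem_univ _)
    exact hx (abs_eq_zero.1 this))
  let t : ∀ v, (S.multidivisor D).pushforward.Sec (U v) := fun v =>
    Multidivisor.mkFrame (M := S.multidivisor D) (fun p => S.fiberEquiv v p) (fun i p => w v i p)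
      (fun i => SheetData.continuous_point (S := S) v i)
      fun i p => (hdS v p i p.2).hasOrd fun _ => rfl
  refine ⟨S.multidivisor D, TGLSheaf.isIso_of_cover (U := U) (fun p => ⟨home p, hhome p⟩) (t := t)
    (s := s) (fun _ _ _ _ => Multidivisor.existsUnique_smul_eq _ _)
    (fun _ _ _ _ => hE.simply_transitive _ _ _) fun a b => ⟨g a b, ?_, hg a b⟩⟩
  refine Multidivisor.frame_ext (fun p i => ?_) fun i p => ?_
  · rw [Multidivisor.sheet_smul]
    refine SheetData.Total.ext rfl ?_
    change (π b (home p) p)⁻¹ (((g a b).perm p)⁻¹ i) = (π a (home p) p)⁻¹ i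
    rw [hπc a b (home p) p p.2.1 p.2.2 (hhome p), mul_inv_rev, Equiv.Perm.mul_apply,
      hπ a b p p.2]
  · rw [Multidivisor.entry_smul]
    change ((g a b).fn i).1 p + w b (((g a b).perm p)⁻¹ i) p = w a i p
    rw [hw a b i p p.2.1 p.2.2, hφ a b i p p.2, hπ a b p p.2]

/-! ### The degree -/

namespace TGLSheaf

variable {Γ : Type u} [MetricSpace Γ] [MetricGraph Γ] {n : ℕ} {E : TGLSheaf Γ n}

/-- Summing the entries of a frame over all sheets gives a function on the star with divisor f_*D.
Renumberings disappear in the sum, so these functions differ on an edge by the sum of the entries of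
the transition function, and the degree formula applies to f_*D. In particular the degree does not
depend on model and trivializations. -/
theorem HasSlopes.sum_eq_divDegree {G : Model Γ} {m : G.E → Fin n → ℤ} (h : E.HasSlopes G m)
    {M : Multidivisor Γ n} (hM : M.pushforward.IsIso E) : ∑ e, ∑ i, m e i = divDegree M.D := by
  obtain ⟨U, s, g, hU, hg, hm⟩ := h
  obtain ⟨α, hres, hsmul⟩ := hM.symm
  have hmem : ∀ v x, x ∈ U v ↔ x ∈ G.star v := fun v x => by rw [← hU v]; rfl
  rw [← Multidivisor.divDegree_mapDomain]
  refine G.sum_slopes_eq_divDegree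
    (Φ := fun v x => ∑ i, extendZero (U v) (Multidivisor.entry (α _ (s v)) i) x)
    (fun v p hp => ?_) fun e t ht t' ht' => ?_
  · have hp' := (hmem v p).2 hp
    rw [Multidivisor.mapDomain_apply_eq_sum _ (α _ (s v)) ⟨p, hp'⟩]
    exact OrdAt.sum _ fun i _ => hasOrd_iff.1 (Multidivisor.hasOrd_entry (α _ (s v)) i ⟨p, hp'⟩)
  · have hpath : ∀ t ∈ Ioo 0 (G.len e), G.path e t ∈ U (G.src e) ⊓ U (G.tgt e) := fun t ht =>
      ⟨(hmem _ _).2 ((Model.path_mem_star_iff ht).2 (Or.inl rfl)),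
        (hmem _ _).2 ((Model.path_mem_star_iff ht).2 (Or.inr rfl))⟩
    have hg' : M.pushforward.res inf_le_left (α _ (s (G.src e))) =
        g e • M.pushforward.res inf_le_right (α _ (s (G.tgt e))) := by
      rw [← hres, ← hres, ← hsmul, hg]
    have key : ∀ t (ht : t ∈ Ioo 0 (G.len e)),
        ∑ i, extendZero (U (G.src e)) (Multidivisor.entry (α _ (s (G.src e))) i) (G.path e t) -
          ∑ i, extendZero (U (G.tgt e)) (Multidivisor.entry (α _ (s (G.tgt e))) i) (G.path e t) =
        ∑ i, ((g e).fn i).1 ⟨G.path e t, hpath t ht⟩ := by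
      intro t ht
      have hx := hpath t ht
      simp only [extendZero_of_mem _ hx.1, extendZero_of_mem _ hx.2]
      rw [sub_eq_iff_eq_add, ← Equiv.sum_comp ((g e).perm ⟨_, hx⟩)⁻¹
        fun i => Multidivisor.entry (α _ (s (G.tgt e))) i ⟨_, hx.2⟩, ← Finset.sum_add_distrib]
      refine Finset.sum_congr rfl fun i _ => ?_
      exact congrArg (fun r => Multidivisor.entry r i ⟨_, hx⟩) hg'
    rw [key t ht, key t' ht', ← Finset.sum_sub_distrib]
    push_cast
    rw [Finset.sum_mul]
    exact Finset.sum_congr rfl fun i _ => hm e i t ht t' ht' _ _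

theorem IsVectorBundle.exists_hasSlopes [CompactSpace Γ] (hE : E.IsVectorBundle) :
    ∃ G : Model Γ, G.IsSimple ∧ ∃ m, E.HasSlopes G m := by
  choose O hO hsec using hE.exists_local_section
  obtain ⟨G, hG, -, hstar⟩ := exists_simple_model ∅ (fun p => (O p : Set Γ)) (fun p => (O p).isOpen)
    fun p => ⟨p, hO p⟩
  choose i hi using hstar
  let s : ∀ v, E.Sec (G.starOpens v) := fun v => E.res (hi v) (hsec (i v)).some
  choose g hg _ using fun e => hE.simply_transitive (G.starOpens (G.src e) ⊓ G.starOpens (G.tgt e))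
    (E.res inf_le_right (s (G.tgt e))) (E.res inf_le_left (s (G.src e)))
  have hpath : ∀ e, ∀ t ∈ Ioo 0 (G.len e),
      G.path e t ∈ G.starOpens (G.src e) ⊓ G.starOpens (G.tgt e) := fun e t ht =>
    ⟨(Model.path_mem_star_iff ht).2 (Or.inl rfl), (Model.path_mem_star_iff ht).2 (Or.inr rfl)⟩
  choose m c hmc using fun e i => harmonic.exists_affine ((g e).fn i) (hpath e)
  refine ⟨G, hG, m, G.starOpens, s, g, fun v => rfl, fun e => (hg e).symm,
    fun e i t ht t' ht' h h' => ?_⟩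
  have h1 := hmc e i t ht
  have h2 := hmc e i t' ht'
  rw [extendZero_of_mem _ h] at h1
  rw [extendZero_of_mem _ h'] at h2
  rw [h1, h2]
  ring

theorem IsVectorBundle.degree_eq [CompactSpace Γ] (hE : E.IsVectorBundle)
    {M : Multidivisor Γ n} (hM : M.pushforward.IsIso E) : E.degree = divDegree M.D := by
  have h : ∃ d : ℤ, ∃ M : Model Γ, M.IsSimple ∧ ∃ m, E.HasSlopes M m ∧ d = ∑ e, ∑ i, m e i := by
    obtain ⟨G, hG, m, hm⟩ := hE.exists_hasSlopes
    exact ⟨_, G, hG, m, hm, rfl⟩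
  rw [degree, dif_pos h]
  obtain ⟨G, -, m, hm, hd⟩ := h.choose_spec
  rw [hd, hm.sum_eq_divDegree hM]

end TGLSheaf

/-! ### The twisted dual -/

/-- A point that is not isolated has at least one ray, and the whole slope can be put on it. At an
isolated point all orders are 0 while K is −2, so ℋ(K) would have no sections there. -/
theorem exists_ordAt {Γ : Type u} [MetricSpace Γ] [MetricGraph Γ] [PerfectSpace Γ] (p : Γ) (a : ℤ) :
    ∃ F : Γ → ℝ, OrdAt F p a := by
  classical
  obtain ⟨k, r, φ, h⟩ := MetricGraph.exists_chart p
  have hk : k ≠ 0 := by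
    rintro rfl
    have h1 := h.isOpen
    rw [iUnion_of_empty] at h1
    exact not_isOpen_singleton p (by simpa using h1)
  obtain ⟨k, rfl⟩ := Nat.exists_eq_succ_of_ne_zero hk
  let F : Γ → ℝ := fun x => if ∃ t ∈ Ico 0 r, φ 0 t = x then a * dist x p else 0
  have hFp : F p = 0 := by
    simp only [F, dist_self, mul_zero, ite_self]
  refine ⟨F, ?_⟩
  have hs : ∑ i : Fin (k + 1), (if i = 0 then a else 0) = a := by simp
  have := OrdAt.of_slopes (f := F) h h.pos (fun i => if i = 0 then a else 0) fun i t ht => by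
    rw [hFp, zero_add]
    by_cases hi : i = 0
    · subst hi
      rw [if_pos rfl]
      simp only [F]
      rw [if_pos ⟨t, ht, rfl⟩, h.dist_center 0 ht.1 ht.2]
    · rw [if_neg hi, Int.cast_zero, zero_mul]
      by_cases hx : ∃ t' ∈ Ico 0 r, φ 0 t' = φ i t
      · simp only [F]
        rw [if_pos hx]
        obtain ⟨t', ht', hx⟩ := hx
        obtain ⟨h1, h2⟩ := h.eq_iff ht' ht hx
        rcases h2 with h2 | h2
        · exact absurd h2.symm hi
        · rw [← h1, h2, h.center, dist_self, mul_zero]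
      · exact if_neg hx
  rwa [hs] at this

theorem exists_canonical_section {Γ : Type u} [MetricSpace Γ] [MetricGraph Γ] [PerfectSpace Γ]
    (p : Γ) : ∃ U : Opens Γ, p ∈ U ∧ Nonempty ((lineBundle (canonicalDivisor Γ)).Sec U) := by
  obtain ⟨F, hF⟩ := exists_ordAt p (canonicalDivisor Γ p)
  have h : ∀ᶠ y in 𝓝 p, OrdAt F y (canonicalDivisor Γ y) := by
    filter_upwards [eventually_nhdsWithin_iff.1
      (hF.eventually_zero.and (eventually_valence_eq_two p))] with y hy
    by_cases hyp : y = p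
    · rw [hyp]
      exact hF
    · have := hy hyp
      rw [canonicalDivisor, this.2]
      exact this.1
  obtain ⟨W, hW, hWo, hp⟩ := _root_.mem_nhds_iff.1 h
  exact ⟨⟨W, hWo⟩, hp, ⟨⟨fun x => F x.1, fun x => (hW x.2).hasOrd fun _ => rfl⟩⟩⟩

section Scalars

variable {Γ : Type u} [MetricSpace Γ] {n : ℕ} {U V : Opens Γ}

namespace TGL

theorem scalar_mul_scalar (f f' : harmonic U) :
    scalar n f * scalar n f' = scalar n (f + f') := rfl

theorem scalar_zero : scalar n (0 : harmonic U) = 1 := rfl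

theorem dual_dual (g : TGL n U) : dual (dual g) = g :=
  TGL.ext rfl (neg_neg (G := Fin n → harmonic U) g.fn)

theorem dual_scalar (f : harmonic U) : dual (scalar n f) = scalar n (-f) := rfl

theorem res_scalar (h : V ≤ U) (f : harmonic U) :
    res h (scalar n f) = scalar n (harmonic.res h f) := rfl

end TGL

variable {K : Γ → ℤ}

/-- The difference of two sections of a line bundle. -/
def sectionSub (l l' : (lineBundle K).Sec U) : harmonic U :=
  ⟨fun x => l.1 x - l'.1 x, fun p => by
    have h := (l.2 p).add (l'.2 p).neg
    rw [add_neg_cancel] at h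
    simp only [sub_eq_add_neg]
    exact h⟩

theorem sectionSub_smul (l l' : (lineBundle K).Sec U) :
    TGL.scalar 1 (sectionSub l l') • l' = l :=
  Subtype.ext (funext fun x => sub_add_cancel (l.1 x) (l'.1 x))

theorem sectionSub_self (l : (lineBundle K).Sec U) : sectionSub l l = 0 :=
  Subtype.ext (funext fun x => sub_self (l.1 x))

theorem sectionSub_smul_left (f : harmonic U) (l l' : (lineBundle K).Sec U) :
    sectionSub (TGL.scalar 1 f • l) l' = f + sectionSub l l' :=
  Subtype.ext (funext fun x => add_sub_assoc (f.1 x) (l.1 x) (l'.1 x))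

theorem res_sectionSub (h : V ≤ U) (l l' : (lineBundle K).Sec U) :
    harmonic.res h (sectionSub l l') =
      sectionSub ((lineBundle K).res h l) ((lineBundle K).res h l') := rfl

variable {E : TGLSheaf Γ n}

/-- The section `l ⊗ s` of `ℋ(K) ⊗ E^*`, for a section `l` of `ℋ(K)` and a frame `s` of `E`. -/
def tensorMk (l : (lineBundle K).Sec U) (s : E.Sec U) :
    TGLSheaf.TensorSec (lineBundle K) E.dual U where
  app V hV l' := (TGL.scalar n (sectionSub l' ((lineBundle K).res hV l)) • E.res hV s : E.Sec V)
  app_res V W hV hW l' := by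
    change _ = E.res hW (_ • _)
    rw [E.res_smul, E.res_res, TGL.res_scalar, res_sectionSub, (lineBundle K).res_res]
  app_smul V hV f l' := by
    change _ = (TGL.dual (TGL.scalar n (-f)) • (_ • _ : E.Sec V) : E.Sec V)
    rw [sectionSub_smul_left, TGL.dual_scalar, neg_neg, smul_smul, TGL.scalar_mul_scalar]

theorem tensorMk_app (l : (lineBundle K).Sec U) (s : E.Sec U) (hV : V ≤ U)
    (l' : (lineBundle K).Sec V) : (tensorMk l s).app V hV l' =
      (TGL.scalar n (sectionSub l' ((lineBundle K).res hV l)) • E.res hV s : E.Sec V) := rfl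

theorem tensor_smul_app (g : TGL n U) (a : TGLSheaf.TensorSec (lineBundle K) E.dual U) (hV : V ≤ U)
    (l : (lineBundle K).Sec V) : (g • a).app V hV l =
      (TGL.dual (TGL.res hV g) • (show E.Sec V from a.app V hV l) : E.Sec V) := rfl

theorem res_tensorMk (h : V ≤ U) (l : (lineBundle K).Sec U) (s : E.Sec U) :
    ((lineBundle K).tensor E.dual).res h (tensorMk l s) =
      tensorMk ((lineBundle K).res h l) (E.res h s) := by
  refine TGLSheaf.TensorSec.ext (funext fun W => funext fun hW => funext fun l' => ?_)
  change (TGL.scalar n (sectionSub l' ((lineBundle K).res (hW.trans h) l)) •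
    E.res (hW.trans h) s : E.Sec W) = (TGL.scalar n (sectionSub l' ((lineBundle K).res hW
      ((lineBundle K).res h l))) • E.res hW (E.res h s) : E.Sec W)
  rw [E.res_res, (lineBundle K).res_res]

/-- Sections of ℋ(K) differ by harmonic functions, so equivariance determines a section of the
tensor product by its value at `l`; for l ⊗ s that value is s. Questions about the tensor product
thus reduce to E. -/
theorem smul_tensorMk_eq_iff (g : TGL n U) (l : (lineBundle K).Sec U) (s : E.Sec U)
    (a : TGLSheaf.TensorSec (lineBundle K) E.dual U) :
    g • tensorMk l s = a ↔ TGL.dual g • s = (show E.Sec U from a.app U le_rfl l) := by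
  constructor
  · rintro rfl
    rw [tensor_smul_app, tensorMk_app, (lineBundle K).res_self, sectionSub_self, TGL.scalar_zero,
      one_smul, E.res_self]
    rfl
  · intro h
    refine TGLSheaf.TensorSec.ext (funext fun W => funext fun hW => funext fun l' => ?_)
    have h1 := a.app_smul W hW (sectionSub l' ((lineBundle K).res hW l)) ((lineBundle K).res hW l)
    rw [sectionSub_smul] at h1
    have h2 := a.app_res U W le_rfl hW l
    have h3 := congrArg (E.res hW) h
    rw [E.res_smul] at h3
    rw [tensor_smul_app, tensorMk_app, h1, h2]
    change _ = (TGL.dual (TGL.scalar n (-sectionSub l' ((lineBundle K).res hW l))) •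
      E.res hW (a.app U le_rfl l) : E.Sec W)
    rw [← h3, TGL.dual_scalar, neg_neg, smul_smul, smul_smul, TGL.scalar_mul_comm]
    rfl

end Scalars

namespace Multidivisor

variable {Γ : Type u} [MetricSpace Γ] {n : ℕ}

/-- The multidivisor with the same cover and another divisor. -/
def withDivisor (M : Multidivisor Γ n) (D : M.X →₀ ℤ) : Multidivisor Γ n := { M with D := D }

variable [MetricGraph Γ] [PerfectSpace Γ] {E : TGLSheaf Γ n}

/-- For a frame t of f_*ℋ(D) and a local section l of ℋ(K_Γ), the functions l − t_i on the same
sheets form a frame of f_*ℋ(K_X − D), because valences agree along f. These frames correspond to l ⊗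
α(t), where α is the given isomorphism. -/
theorem exists_isIso_tensor_dual (hE : E.IsVectorBundle) {M : Multidivisor Γ n} [CompactSpace M.X]
    (hM : M.pushforward.IsIso E) :
    (∀ p : Γ, ∃ U : Opens Γ, p ∈ U ∧
      Nonempty ((M.withDivisor (canonDiv M.X - M.D)).pushforward.Sec U)) ∧
    (M.withDivisor (canonDiv M.X - M.D)).pushforward.IsIso
      ((lineBundle (canonicalDivisor Γ)).tensor E.dual) := by
  set L := lineBundle (canonicalDivisor Γ) with hL
  obtain ⟨α, hres, hsmul⟩ := hM
  have hloc : ∀ p : Γ, ∃ U : Opens Γ, p ∈ U ∧ Nonempty (M.pushforward.Sec U) ∧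
      Nonempty (L.Sec U) := fun p => by
    obtain ⟨U, hU, ⟨s⟩⟩ := hE.exists_local_section p
    obtain ⟨V, hV, ⟨l⟩⟩ := exists_canonical_section p
    exact ⟨U ⊓ V, ⟨hU, hV⟩, ⟨(α _).symm (E.res inf_le_left s)⟩, ⟨L.res inf_le_right l⟩⟩
  choose U hU t l using hloc
  replace t := fun p => (t p).some
  replace l := fun p => (l p).some
  let T : ∀ p, (M.withDivisor (canonDiv M.X - M.D)).pushforward.Sec (U p) := fun p =>
    mkFrame (M := M.withDivisor (canonDiv M.X - M.D)) (fun q => sheet (t p) q)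
      (fun i q => (l p).1 q - entry (t p) i q) (fun i => continuous_sheet (t p) i) fun i q => by
        have h := ((l p).2 q).add (hasOrd_entry (t p) i q).neg
        have h1 : canonicalDivisor Γ q + -M.D (sheet (t p) q i) =
            (canonDiv M.X - M.D) (sheet (t p) q i) := by
          rw [Finsupp.sub_apply, canonDiv_apply, M.locIso.valence_eq, f_sheet, ← sub_eq_add_neg]
          rfl
        rw [h1] at h
        simp only [sub_eq_add_neg]
        exact h
  refine ⟨fun p => ⟨U p, hU p, ⟨T p⟩⟩, TGLSheaf.isIso_of_cover (U := U) (fun p => ⟨p, hU p⟩)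
    (t := T) (s := fun p => tensorMk (l p) (α _ (t p))) (fun _ _ _ _ => existsUnique_smul_eq _ _)
    (fun p V hV a => ?_) fun p q => ?_⟩
  · obtain ⟨k, hk, hku⟩ := hE.simply_transitive V (E.res hV (α _ (t p)))
      (a.app V le_rfl (L.res hV (l p)))
    refine ⟨TGL.dual k, ?_, fun g hg => ?_⟩
    · refine (congrArg _ (res_tensorMk hV _ _)).trans ((smul_tensorMk_eq_iff _ _ _ _).2 ?_)
      rw [TGL.dual_dual]
      exact hk
    · have h1 := (smul_tensorMk_eq_iff g _ _ a).1
        ((congrArg _ (res_tensorMk hV (l p) (α _ (t p)))).symm.trans hg)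
      rw [← hku _ h1, TGL.dual_dual]
  · obtain ⟨g, hg⟩ := exists_smul_eq (M.pushforward.res inf_le_right (t q))
      (M.pushforward.res (inf_le_left : U p ⊓ U q ≤ U p) (t p))
    have hgE : g • E.res inf_le_right (α _ (t q)) = E.res inf_le_left (α _ (t p)) := by
      rw [← hres, ← hsmul, hg, hres]
    let f : harmonic (U p ⊓ U q) := sectionSub (L.res inf_le_left (l p)) (L.res inf_le_right (l q))
    -- If g takes t_q to t_p, both families of trivializations change by the dual of g, shifted by
    -- the scalar l_p − l_q.
    refine ⟨TGL.scalar n f * TGL.dual g, frame_ext (fun x i => ?_) fun i x => ?_, ?_⟩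
    · exact congrArg (fun r => (sheet r x i : M.X)) hg
    · have h1 : (g.fn i).1 x + entry (t q) ((g.perm x)⁻¹ i) ⟨x, x.2.2⟩ =
          entry (t p) i ⟨x, x.2.1⟩ := congrArg (fun r => entry r i x) hg
      change ((l p).1 ⟨x, x.2.1⟩ - (l q).1 ⟨x, x.2.2⟩) + -(g.fn i).1 x +
        ((l q).1 ⟨x, x.2.2⟩ - entry (t q) ((g.perm x)⁻¹ i) ⟨x, x.2.2⟩) =
          (l p).1 ⟨x, x.2.1⟩ - entry (t p) i ⟨x, x.2.1⟩
      linarith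
    · rw [res_tensorMk, res_tensorMk]
      refine (smul_tensorMk_eq_iff _ _ _ _).2 ?_
      rw [tensorMk_app, TGL.dual_mul, TGL.dual_dual, mul_smul, hgE, TGL.dual_scalar, E.res_self,
        L.res_self]
      congr 2
      exact Subtype.ext (funext fun x => neg_sub _ _)

end Multidivisor

/-! ### Weil–Riemann–Roch -/

namespace TGLSheaf

variable {Γ : Type u} [MetricSpace Γ] [MetricGraph Γ] [CompactSpace Γ] [PerfectSpace Γ] {n : ℕ}
  {E : TGLSheaf Γ n}

/-- The Weil–Riemann–Roch theorem. -/
theorem IsVectorBundle.riemannRoch (hE : E.IsVectorBundle) :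
    E.bakerNorineRank - ((lineBundle (canonicalDivisor Γ)).tensor E.dual).bakerNorineRank =
      E.degree + n * eulerChar Γ := by
  have h := hE.exists_multidivisor
  set M := h.choose with hMdef
  have hM : M.pushforward.IsIso E := h.choose_spec
  have hloc : ∀ p : Γ, ∃ U : Opens Γ, p ∈ U ∧ Nonempty (M.pushforward.Sec U) := fun p => by
    obtain ⟨α, -, -⟩ := hM
    obtain ⟨U, hU, ⟨s⟩⟩ := hE.exists_local_section p
    exact ⟨U, hU, ⟨(α _).symm s⟩⟩
  have := Multidivisor.compactSpace hloc
  obtain ⟨hloc', hiso⟩ := Multidivisor.exists_isIso_tensor_dual hE hM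
  have h' : ∃ M' : Multidivisor Γ n,
      M'.pushforward.IsIso ((lineBundle (canonicalDivisor Γ)).tensor E.dual) := ⟨_, hiso⟩
  have h1 : E.bakerNorineRank = divRank M.D := dif_pos h
  have h2 : ((lineBundle (canonicalDivisor Γ)).tensor E.dual).bakerNorineRank =
      divRank (canonDiv M.X - M.D) := by
    -- The rank of the twisted dual refers to its own choice of multidivisor, which must be compared
    -- with the cover X carrying K_X − D.
    rw [bakerNorineRank, dif_pos h']
    exact (Multidivisor.divRank_eq_of_isIso (hiso.trans h'.choose_spec.symm) hloc').symm
  have h3 := riemannRoch_divRank M.D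
  have h4 := Multidivisor.divDegree_canonDiv hloc
  have h5 := two_mul_eulerChar (Γ := Γ)
  rw [h1, h2, hE.degree_eq hM]
  have h6 : (n : ℤ) * (2 * eulerChar Γ) = -(n * divDegree (canonDiv Γ)) := by rw [h5]; ring
  linarith

end TGLSheaf

end TropicalBundle

open TropicalBundle in
theorem theoremA {Γ : Type u} [MetricSpace Γ] [MetricGraph Γ] [CompactSpace Γ] [PerfectSpace Γ]
    {n : ℕ} (E : TGLSheaf Γ n) (hE : E.IsVectorBundle) :
    E.bakerNorineRank - ((lineBundle (canonicalDivisor Γ)).tensor E.dual).bakerNorineRank =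
        E.degree + n * eulerChar Γ ∧
      (ConnectedSpace Γ →
        E.bakerNorineRank - ((lineBundle (canonicalDivisor Γ)).tensor E.dual).bakerNorineRank =
          E.degree - n * (genus Γ - 1)) := by
  refine ⟨hE.riemannRoch, fun _ => ?_⟩
  rw [hE.riemannRoch, genus]
  ring
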